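/- **Setting.** For an $n$-qubit state $\rho$ let $O_\rho$ be the state oracle $O_\rho(\sigma)=\rho\otimes\mathrm{Tr}_{\mathsf{state}}(\sigma)$, which discards the contents of a fixed $n$-qubit state register of a device on $n'\ge n$ qubits and prepares $\rho$ there. A $\lambda$-noisy circuit with access to $O_\rho$ starts from $|0^{n'}\rangle$, applies a sequence of layers, each of which is a depth-1 unitary (a tensor product of gates on disjoint sets of at most two qubits) or one call to $O_\rho$, and measures in the computational basis; the state preparation and every layer are followed by the single-qubit depolarizing channel $D_\lambda[\sigma]=(1-\lambda)\sigma+\lambda I/2$ on every qubit. A $\mathsf{NISQ}_\lambda$ algorithm is a probabilistic classical algorithm that adaptively runs $\lambda$-noisy circuits, with any number of qubits and layers, and sees their measured bit strings; its number of queries is the total number of calls to $O_\rho$. A $\mathsf{BPP}^{\mathsf{QNC}^0}$ algorithm is such an algorithm with $\lambda=0$ that is uniform in $n$, runs in time polynomial in $n$, and runs only circuits with at most a constant number of layers. A Pauli operator is an element of $\{I,X,Y,Z\}^{\otimes n}$, and $\rho_{s,P}=2^{-n}(I+s\,P)$ for $s\in\{0,1\}$ and a Pauli operator $P\ne I^{\otimes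 n}$. **Theorem.** (1) For every $\eta>0$ there is $c>0$ such that for all $\lambda\in[0,1]$, $n\ge1$ and $N$, every $\mathsf{NISQ}_\lambda$ algorithm with access to $O_\rho$ that makes at most $N$ queries and does one of the following satisfies $N(1-\lambda)^{n}\ge c$, that is, it needs $\Omega((1-\lambda)^{-n})$ queries: * for some fixed $P$ that acts nontrivially on all $n$ qubits, it determines $s$ from $O_{\rho_{s,P}}$ with probability at least $\frac12+\eta$, on average over uniform $s\in\{0,1\}$; * it determines $P$ from $O_{\rho_{1,P}}$ with probability at least $3^{-n}+\eta$, on average over the $3^n$ operators $P$ that act nontrivially on all qubits; * for some $\varepsilon<\frac12$ and every $n$-qubit state $\rho$, it outputs, with probability at least $\frac12+\eta$, numbers that approximate $|\mathrm{Tr}(P\rho)|$ within $\varepsilon$ for all Pauli operators $P$ simultaneously. (2) For every $\delta>0$ there is a $\mathsf{BPP}^{\mathsf{QNC}^0}$ algorithm that, for all $n\ge1$, $s\in\{0,1\}$ and $P\neq I^{\otimes n}$, makes $O(n)$ queries to $O_{\rho_{s,P}}$ and outputs $s$, and also $P$ if $s=1$, with probability at least $1-\delta^n$. (3) For all $\varepsilon,\delta>0$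 there is a $\mathsf{BPP}^{\mathsf{QNC}^0}$ algorithm that, for all $n\ge1$ and every $n$-qubit state $\rho$, makes $O(n)$ queries to $O_\rho$ and collects data from which, with probability at least $1-\delta^n$, a deterministic polynomial-time procedure computes, for every Pauli operator $P$ given to it, a number within $\varepsilon$ of $|\mathrm{Tr}(P\rho)|$, for all $P$ simultaneously. The constants in $O(n)$, the depth and the polynomial depend only on $\delta$ in (2) and on $\varepsilon,\delta$ in (3). -/

import Mathlib

noncomputable section

namespace NISQ

/-! ### Quantum states and Pauli operators -/

/-- Computational basis states (bit strings) of `m` qubits. -/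
abbrev Bits (m : ℕ) : Type := Fin m → Fin 2

/-- Operators on `m` qubits, as matrices in the computational basis. -/
abbrev Op (m : ℕ) : Type := Matrix (Bits m) (Bits m) ℂ

open scoped ComplexOrder in
/-- Density matrices. -/
def IsState {m : ℕ} (ρ : Op m) : Prop := ρ.PosSemidef ∧ ρ.trace = 1

/-- The single-qubit Pauli matrices `I, X, Y, Z`, numbered `0, 1, 2, 3`. -/
def pauli : Fin 4 → Matrix (Fin 2) (Fin 2) ℂ
  | 0 => 1
  | 1 => !![0, 1; 1, 0]
  | 2 => !![0, -Complex.I; Complex.I, 0]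
  | 3 => !![1, 0; 0, -1]

/-- An `n`-qubit Pauli operator `P₁ ⊗ ⋯ ⊗ Pₙ`, given by its tensor factors. `0` is the identity. -/
abbrev PauliString (n : ℕ) : Type := Fin n → Fin 4

/-- The matrix of the tensor product `P₁ ⊗ ⋯ ⊗ Pₙ`. -/
def PauliString.op {n : ℕ} (P : PauliString n) : Op n :=
  Matrix.of fun x y => ∏ j, pauli (P j) (x j) (y j)

/-- `P` acts nontrivially on every qubit. -/
def PauliString.FullWeight {n : ℕ} (P : PauliString n) : Prop := ∀ j, P j ≠ 0

instance {n : ℕ} : DecidablePred (PauliString.FullWeight (n := n)) :=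
  fun P => inferInstanceAs (Decidable (∀ j, P j ≠ 0))

/-- The operator `(I + s P) / 2 ^ n`. -/
def pauliState {n : ℕ} (s : Fin 2) (P : PauliString n) : Op n :=
  ((2 : ℂ) ^ n)⁻¹ • (1 + ((s : ℕ) : ℂ) • P.op)

/-! ### Depth-1 unitaries -/

/-- A one- or two-qubit gate placed on `m` qubits. -/
inductive Gate (m : ℕ) : Type
  | one (a : Fin m) (U : Matrix.unitaryGroup (Fin 2) ℂ)
  | two (a b : Fin m) (hab : a ≠ b) (U : Matrix.unitaryGroup (Fin 2 × Fin 2) ℂ)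

/-- The qubits that a gate touches. -/
def Gate.support {m : ℕ} : Gate m → Finset (Fin m)
  | .one a _ => {a}
  | .two a b _ _ => {a, b}

/-- The gate tensored with the identity on the other qubits. -/
def Gate.op {m : ℕ} : Gate m → Op m
  | .one a U => Matrix.of fun x y =>
      if ∀ j, j ≠ a → x j = y j then U.1 (x a) (y a) else 0
  | .two a b _ U => Matrix.of fun x y =>
      if ∀ j, j ≠ a → j ≠ b → x j = y j then U.1 (x a, x b) (y a, y b) else 0

/-- A depth-1 unitary: a tensor product of gates on disjoint sets of at most two qubits, and of the
identity on the qubits that are left over. -/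
structure DepthOne (m : ℕ) where
  gates : List (Gate m)
  disjoint : gates.Pairwise fun g h => Disjoint g.support h.support

/-- The matrix of a depth-1 unitary; the factors commute. -/
def DepthOne.op {m : ℕ} (L : DepthOne m) : Op m := (L.gates.map Gate.op).prod

/-! ### Noise, the state oracle and noisy circuits -/

/-- The single-qubit depolarizing channel `ρ ↦ (1 - lam) ρ + lam (tr ρ) I / 2`. -/
def depolarize (lam : ℝ) (σ : Matrix (Fin 2) (Fin 2) ℂ) : Matrix (Fin 2) (Fin 2) ℂ :=
  ((1 - lam : ℝ) : ℂ) • σ + ((lam / 2 : ℝ) : ℂ) • σ.trace • 1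

/-- The `m`-fold tensor power of the depolarizing channel: it sends `⨂ⱼ |x' j⟩⟨y' j|` to
`⨂ⱼ depolarize lam |x' j⟩⟨y' j|`. -/
def depolarizeAll (lam : ℝ) {m : ℕ} (σ : Op m) : Op m :=
  Matrix.of fun x y => ∑ x' : Bits m, ∑ y' : Bits m,
    (∏ j, depolarize lam (Matrix.single (x' j) (y' j) 1) (x j) (y j)) * σ x' y'

/-- The state oracle on `n + w` qubits, whose first `n` qubits are the state register and whose last
`w` qubits are the workspace: `σ ↦ ρ ⊗ Tr_state σ`. -/
def stateOracle {n : ℕ} (ρ : Op n) {w : ℕ} (σ : Op (n + w)) : Op (n + w) :=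
  Matrix.of fun x y =>
    ρ (fun i => x (Fin.castAdd w i)) (fun i => y (Fin.castAdd w i)) *
      ∑ z : Bits n, σ (Fin.append z fun i => x (Fin.natAdd n i))
        (Fin.append z fun i => y (Fin.natAdd n i))

/-- A layer of a circuit: a depth-1 unitary, or one call to the state oracle. -/
inductive Layer (n w : ℕ) : Type
  | unitary (U : DepthOne (n + w))
  | oracle

/-- A circuit with an `n`-qubit state register and `w` workspace qubits: its layers, in order. -/
abbrev Circuit (n w : ℕ) : Type := List (Layer n w)

/-- The noiseless action of a layer when the state oracle prepares `ρ`. -/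
def Layer.apply {n w : ℕ} (ρ : Op n) : Layer n w → Op (n + w) → Op (n + w)
  | .unitary U, σ => U.op * σ * U.op.conjTranspose
  | .oracle, σ => stateOracle ρ σ

/-- The final state of the noisy circuit: the preparation of `|0⋯0⟩⟨0⋯0|` and each layer are
followed by depolarizing noise on all qubits. -/
def Circuit.final {n w : ℕ} (lam : ℝ) (ρ : Op n) (C : Circuit n w) : Op (n + w) :=
  C.foldl (fun σ L => depolarizeAll lam (L.apply ρ σ)) (depolarizeAll lam (Matrix.single 0 0 1))

/-- The probability that the computational basis measurement at the end yields `s`. -/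
def Circuit.outProb {n w : ℕ} (lam : ℝ) (ρ : Op n) (C : Circuit n w) (s : Bits (n + w)) : ℝ :=
  (C.final lam ρ s s).re

/-- The number of calls to the state oracle in a circuit. -/
def Circuit.calls {n w : ℕ} (C : Circuit n w) : ℕ :=
  C.countP fun L => match L with
    | .oracle => true
    | .unitary _ => false

/-! ### Hybrid algorithms as interaction trees

A hybrid algorithm on `n`-qubit states with output in `β` is the tree of everything that a
probabilistic classical computer can do with access to the (noisy) quantum device: toss coins, run
circuits chosen adaptively, read the measured bit strings, and finally give an output. With the
noise rate `lam` this is a `NISQ_lam` algorithm with access to the state oracle. No computability is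
demanded of the tree; the machine model below produces such trees. -/

/-- Hybrid classical-quantum algorithms. -/
inductive HybridAlg (n : ℕ) (β : Type) : Type 1
  | output (b : β)
  | rand (α : Type) (μ : PMF α) (next : α → HybridAlg n β)
  | query (w : ℕ) (C : Circuit n w) (next : Bits (n + w) → HybridAlg n β)

namespace HybridAlg

variable {n : ℕ} {β : Type}

open Classical in
/-- The probability that the output lies in `E`, at noise rate `lam` and with the state oracle for
`ρ`. -/
def prob (lam : ℝ) (ρ : Op n) (E : Set β) : HybridAlg n β → ℝ
  | .output b => if b ∈ E then 1 else 0
  | .rand _ μ next => ∑' a, (μ a).toReal * prob lam ρ E (next a)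
  | .query _ C next => ∑ s, C.outProb lam ρ s * prob lam ρ E (next s)

/-- On every path at most `N` calls are made to the state oracle, in all circuits together. -/
def QueriesAtMost : HybridAlg n β → ℕ → Prop
  | .output _, _ => True
  | .rand _ μ next, N => ∀ a ∈ μ.support, QueriesAtMost (next a) N
  | .query _ C next, N => C.calls ≤ N ∧ ∀ s, QueriesAtMost (next s) (N - C.calls)

/-- Every circuit that is run has at most `d` layers, oracle calls included. -/
def DepthAtMost (d : ℕ) : HybridAlg n β → Prop
  | .output _ => True
  | .rand _ μ next => ∀ a ∈ μ.support, DepthAtMost d (next a)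
  | .query _ C next => C.length ≤ d ∧ ∀ s, DepthAtMost d (next s)

/-- On every path the output satisfies `p`. -/
def Always (p : β → Prop) : HybridAlg n β → Prop
  | .output b => p b
  | .rand _ μ next => ∀ a ∈ μ.support, Always p (next a)
  | .query _ _ next => ∀ s, Always p (next s)

end HybridAlg

/-! ### The classical computer: uniform programs with a step count

A random access machine over natural numbers with addition and truncated subtraction at unit cost,
structured control, fair coins, and a query tape on which a circuit over the gate set
`{H, T, CNOT, SWAP}` is written gate by gate. Running the circuit on `m` qubits with `T` layers is
charged `m (T + 1)` steps. Such machines are polynomially equivalent to probabilistic Turing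
machines. -/

/-- The Hadamard gate. -/
def hadamard : Matrix.unitaryGroup (Fin 2) ℂ :=
  ⟨((√2 : ℝ) : ℂ)⁻¹ • !![1, 1; 1, -1], by
    have h : ((√2 : ℝ) : ℂ) * ((√2 : ℝ) : ℂ) = 2 := by
      rw [← Complex.ofReal_mul, Real.mul_self_sqrt (by norm_num)]; norm_num
    have h' : (((√2 : ℝ) : ℂ))⁻¹ * ((√2 : ℝ) : ℂ)⁻¹ = 1 / 2 := by
      rw [← mul_inv, h]; norm_num
    rw [Matrix.mem_unitaryGroup_iff]
    ext i j
    fin_cases i <;> fin_cases j <;>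
      simp [Matrix.mul_apply, Matrix.star_apply, Fin.sum_univ_two, h'] <;> norm_num⟩

/-- The `T` gate `diag(1, exp(iπ/4))`. -/
def tGate : Matrix.unitaryGroup (Fin 2) ℂ :=
  ⟨!![1, 0; 0, Complex.exp ((Real.pi / 4 : ℝ) * Complex.I)], by
    have h : Complex.exp ((Real.pi / 4 : ℝ) * Complex.I) *
        (starRingEnd ℂ) (Complex.exp ((Real.pi / 4 : ℝ) * Complex.I)) = 1 := by
      rw [Complex.mul_conj, Complex.normSq_eq_norm_sq, Complex.norm_exp_ofReal_mul_I]
      norm_num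
    rw [Matrix.mem_unitaryGroup_iff]
    ext i j
    fin_cases i <;> fin_cases j <;>
      simp [Matrix.mul_apply, Matrix.star_apply, Fin.sum_univ_two, -Complex.ofReal_div, h]⟩

/-- A permutation of the two-qubit basis states, as a unitary. -/
def permGate (e : Equiv.Perm (Fin 2 × Fin 2)) : Matrix.unitaryGroup (Fin 2 × Fin 2) ℂ :=
  ⟨Matrix.of fun x y => if x = e y then 1 else 0, by
    rw [Matrix.mem_unitaryGroup_iff]
    ext x y
    rw [Matrix.mul_apply, ← Equiv.sum_comp e.symm]
    simp [Matrix.star_apply, Matrix.one_apply]⟩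

/-- The controlled-NOT gate `|a, b⟩ ↦ |a, b + a⟩`. -/
def cnotGate : Matrix.unitaryGroup (Fin 2 × Fin 2) ℂ :=
  permGate ⟨fun x => (x.1, x.2 + x.1), fun x => (x.1, x.2 + x.1), by decide, by decide⟩

/-- The swap gate `|a, b⟩ ↦ |b, a⟩`. -/
def swapGate : Matrix.unitaryGroup (Fin 2 × Fin 2) ℂ :=
  permGate (Equiv.prodComm _ _)

/-- A gate written on the query tape, with its qubits numbered from `0`. -/
inductive RawGate : Type
  | H (a : ℕ)
  | T (a : ℕ)
  | CNOT (a b : ℕ)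
  | SWAP (a b : ℕ)

/-- A layer written on the query tape. -/
inductive RawLayer : Type
  | gates (l : List RawGate)
  | oracle

/-- The gate that is meant, if its operands are distinct qubits of the device. -/
def RawGate.decode (m : ℕ) : RawGate → Option (Gate m)
  | .H a => if h : a < m then some (.one ⟨a, h⟩ hadamard) else none
  | .T a => if h : a < m then some (.one ⟨a, h⟩ tGate) else none
  | .CNOT a b => if h : a < m ∧ b < m ∧ a ≠ b then
      some (.two ⟨a, h.1⟩ ⟨b, h.2.1⟩ (fun e => h.2.2 (congrArg Fin.val e)) cnotGate) else none
  | .SWAP a b => if h : a < m ∧ b < m ∧ a ≠ b then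
      some (.two ⟨a, h.1⟩ ⟨b, h.2.1⟩ (fun e => h.2.2 (congrArg Fin.val e)) swapGate) else none

open Classical in
/-- The layer that is meant, if its gates are valid and disjoint. -/
def RawLayer.decode (n w : ℕ) : RawLayer → Option (Layer n w)
  | .oracle => some .oracle
  | .gates l => (l.mapM (RawGate.decode (n + w))).bind fun gs =>
      if h : gs.Pairwise (fun g g' => Disjoint g.support g'.support) then
        some (.unitary ⟨gs, h⟩) else none

/-- The memory of the machine: scalar variables, arrays, and the query tape (last layer first). -/
structure Memory : Type where
  var : ℕ → ℕ
  arr : ℕ → ℕ → ℕ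
  tape : List RawLayer

/-- The memory at the start: variable `0` holds `n`, and all else is zero or empty. -/
def Memory.init (n : ℕ) : Memory := ⟨fun x => if x = 0 then n else 0, fun _ _ => 0, []⟩

/-- Assignment to a variable. -/
def Memory.setVar (M : Memory) (x v : ℕ) : Memory := { M with var := Function.update M.var x v }

/-- Overwriting of a whole array. -/
def Memory.setArr (M : Memory) (A : ℕ) (f : ℕ → ℕ) : Memory :=
  { M with arr := Function.update M.arr A f }

/-- Appending a gate to the layer that is being written. -/
def Memory.addGate (M : Memory) (g : RawGate) : Memory :=
  { M with tape := match M.tape with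
    | .gates l :: t => .gates (g :: l) :: t
    | t => .gates [g] :: t }

/-- A finite sequence of numbers as the contents of an array, padded by zeros. -/
def padZero {m k : ℕ} (v : Fin m → Fin k) : ℕ → ℕ := fun i => if h : i < m then v ⟨i, h⟩ else 0

/-- Programs. `x, y, z` are names of variables, `A` of arrays, `c` is a constant. -/
inductive Prog : Type
  /-- `x := c` -/
  | const (x c : ℕ)
  /-- `x := y + z` -/
  | add (x y z : ℕ)
  /-- `x := y - z`, truncated -/
  | sub (x y z : ℕ)
  /-- `x := A[y]` -/
  | load (x A y : ℕ)
  /-- `A[y] := x` -/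
  | store (A y x : ℕ)
  /-- `x :=` a fair random bit -/
  | coin (x : ℕ)
  /-- start a new layer of gates on the query tape -/
  | newLayer
  /-- write a layer that calls the state oracle -/
  | oracleLayer
  /-- write a gate on the qubit numbered by the value of `y`, or of `y` and `z` -/
  | gateH (y : ℕ)
  | gateT (y : ℕ)
  | gateCNOT (y z : ℕ)
  | gateSWAP (y z : ℕ)
  /-- run the circuit on the tape with as many workspace qubits as `y` says, put the measured bits
  into the array `A`, and clear the tape -/
  | runCircuit (y A : ℕ)
  | seq (p q : Prog)
  /-- if `x ≠ 0` then `p` else `q` -/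
  | ite (x : ℕ) (p q : Prog)
  /-- while `x ≠ 0` do `p` -/
  | while (x : ℕ) (p : Prog)

/-- Run a list of programs, one after the other, for at most `t` time units. The output is the final
memory, or `none` if the time did not suffice or an ill-formed circuit was submitted. -/
def run (n : ℕ) (t : ℕ) (K : List Prog) (M : Memory) : HybridAlg n (Option Memory) :=
  match t, K with
  | _, [] => .output (some M)
  | 0, _ :: _ => .output none
  | t + 1, .const x c :: K => run n t K (M.setVar x c)
  | t + 1, .add x y z :: K => run n t K (M.setVar x (M.var y + M.var z))
  | t + 1, .sub x y z :: K => run n t K (M.setVar x (M.var y - M.var z))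
  | t + 1, .load x A y :: K => run n t K (M.setVar x (M.arr A (M.var y)))
  | t + 1, .store A y x :: K =>
      run n t K (M.setArr A (Function.update (M.arr A) (M.var y) (M.var x)))
  | t + 1, .coin x :: K =>
      .rand (Fin 2) (PMF.uniformOfFintype (Fin 2)) fun b => run n t K (M.setVar x b)
  | t + 1, .newLayer :: K => run n t K { M with tape := .gates [] :: M.tape }
  | t + 1, .oracleLayer :: K => run n t K { M with tape := .oracle :: M.tape }
  | t + 1, .gateH y :: K => run n t K (M.addGate (.H (M.var y)))
  | t + 1, .gateT y :: K => run n t K (M.addGate (.T (M.var y)))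
  | t + 1, .gateCNOT y z :: K => run n t K (M.addGate (.CNOT (M.var y) (M.var z)))
  | t + 1, .gateSWAP y z :: K => run n t K (M.addGate (.SWAP (M.var y) (M.var z)))
  | t + 1, .runCircuit y A :: K =>
      match M.tape.reverse.mapM (RawLayer.decode n (M.var y)) with
      | none => .output none
      | some C =>
          if (n + M.var y) * (C.length + 1) ≤ t then
            .query (M.var y) C fun s =>
              run n (t - (n + M.var y) * (C.length + 1)) K
                { M.setArr A (padZero s) with tape := [] }
          else .output none
  | t + 1, .seq p q :: K => run n t (p :: q :: K) M
  | t + 1, .ite x p q :: K => run n t ((if M.var x ≠ 0 then p else q) :: K) M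
  | t + 1, .while x p :: K =>
      if M.var x ≠ 0 then run n t (p :: .while x p :: K) M else run n t K M
termination_by t

/-- The behaviour of the program `A` on input `n` within time `t`. -/
def Prog.exec (A : Prog) (n t : ℕ) : HybridAlg n (Option Memory) := run n t [A] (Memory.init n)

/-- The memory `M` with the Pauli string `P` written into array `0`. -/
def Memory.withPauli {n : ℕ} (M : Memory) (P : PauliString n) : Memory := M.setArr 0 (padZero P)

/-- `IsBPPQNC0 A p d q`: on every input `n ≥ 1` and for all measurement outcomes and coins, the
program `A` halts regularly within time `p n`, runs only circuits of depth at most the constant `d`,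
and makes at most `q n` calls to the state oracle. -/
def Prog.IsBPPQNC0 (A : Prog) (p : Polynomial ℕ) (d : ℕ) (q : ℕ → ℕ) : Prop :=
  ∀ n : ℕ, 1 ≤ n →
    (A.exec n (p.eval n)).Always (fun o => o.isSome = true) ∧
    (A.exec n (p.eval n)).DepthAtMost d ∧
    (A.exec n (p.eval n)).QueriesAtMost (q n)

end NISQ

end

/-! Lower bound. Put e = (1 - λ)^n. Depolarizing noise multiplies each nontrivial tensor factor of a
Pauli string by 1 - λ, hence a full-weight P by e. The noisy version of the state for s = 1 is
therefore the mixture, with weights 1 - e and e, of the maximally mixed state and the state itself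
(`depolarizeAll_pauliState_one`): a noisy call to one oracle behaves, with weight 1 - e, like a
noisy call to the other. All layers are linear and positive, so along a circuit the state for s = 1
dominates (1 - e)^calls times the state for s = 0 in the positive semidefinite order
(`Circuit.posSemidef_sub`). On the diagonal this compares outcome probabilities, and induction over
the interaction tree gives (1 - e)^N Pr₀[E] ≤ Pr₁[E] for every event E
(`HybridAlg.pow_mul_prob_le`). By Bernoulli's inequality Pr₀[E] - N e ≤ Pr₁[E]. Each of the three
tasks exhibits events whose probabilities must differ by η, so η ≤ N e.

Upper bound. One circuit calls the oracle, swaps the copy into the workspace, calls the oracle again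
and measures corresponding qubits in the Bell basis. The operators P ⊗ P are all diagonal in that
basis, so each outcome assigns to every P a sign `bellSign`, and the mean of this sign is Tr((P ⊗
P)(ρ ⊗ ρ)) = |Tr(Pρ)|² (`sum_outProb_mul_bellSign`). The same samples serve all 4^n strings. An
exponential tail bound and a union bound over strings and directions make O(n) samples enough, with
failure probability at most δ^n (`le_expect_of_accurate`, `le_expect_of_determined`).

For estimation, the empirical mean of the signs is clipped at zero and its square root is taken on a
finite grid (`gridCount_accurate`). For identification, the signs of the identity and, if s = 1, of
P are always 1, whereas every other string has unbiased signs and is unlikely to keep a constant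
sign. The exponent of the sign is linear over the field with two elements in the outcome bits
extended by a constant one, so the strings of sign 1 on all samples form a null space. Elimination
computes spanning rows of it (`IsNullBasis.step`); when the samples are good, every row is zero or
the vector of P, and the entrywise maximum of the rows is the answer (`IsNullBasis.sup_eq`).

Both procedures are explicit programs. Their correctness and running time are proved in a small
program logic: `Terminates` for deterministic code, and `Samples` for code that repeats a fixed
circuit and is deterministic otherwise. -/

noncomputable section
namespace NISQ

open Matrix
open scoped ComplexOrder

/-! ### Tensor products and partial traces -/

/-- The tensor product of operators on the state register and on the workspace. -/
def tensor {n w : ℕ} (A : Op n) (B : Op w) : Op (n + w) :=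
  Matrix.of fun x y =>
    A (fun i => x (Fin.castAdd w i)) (fun i => y (Fin.castAdd w i)) *
      B (fun i => x (Fin.natAdd n i)) (fun i => y (Fin.natAdd n i))

/-- The partial trace over the state register. -/
def traceState {n w : ℕ} (σ : Op (n + w)) : Op w :=
  Matrix.of fun x y => ∑ z : Bits n, σ (Fin.append z x) (Fin.append z y)

lemma stateOracle_eq {n w : ℕ} (ρ : Op n) (σ : Op (n + w)) :
    stateOracle ρ σ = tensor ρ (traceState σ) := rfl

lemma sum_bits_add {n w : ℕ} {M : Type*} [AddCommMonoid M] (f : Bits (n + w) → M) :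
    ∑ x, f x = ∑ a : Bits n, ∑ b : Bits w, f (Fin.append a b) := by
  rw [← Fintype.sum_prod_type' (f := fun a b => f (Fin.append a b)),
    ← (Fin.appendEquiv n w (α := Fin 2)).sum_comp]
  rfl

lemma tensor_append {n w : ℕ} (A : Op n) (B : Op w) (a a' : Bits n) (b b' : Bits w) :
    tensor A B (Fin.append a b) (Fin.append a' b') = A a a' * B b b' := by
  simp [tensor]

lemma trace_tensor {n w : ℕ} (A : Op n) (B : Op w) :
    (tensor A B).trace = A.trace * B.trace := by
  simp only [Matrix.trace, Matrix.diag_apply]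
  rw [sum_bits_add, Finset.sum_mul_sum]
  simp [tensor_append]

lemma trace_traceState {n w : ℕ} (σ : Op (n + w)) : (traceState σ).trace = σ.trace := by
  simp only [Matrix.trace, Matrix.diag_apply]
  rw [sum_bits_add, Finset.sum_comm]
  rfl

lemma PosSemidef.tensor {n w : ℕ} {A : Op n} {B : Op w} (hA : A.PosSemidef)
    (hB : B.PosSemidef) : (tensor A B).PosSemidef :=
  (hA.kronecker hB).submatrix fun x : Bits (n + w) =>
    ((fun i => x (Fin.castAdd w i) : Bits n), (fun i => x (Fin.natAdd n i) : Bits w))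

lemma PosSemidef.traceState {n w : ℕ} {σ : Op (n + w)} (h : σ.PosSemidef) :
    (traceState σ).PosSemidef := by
  have : NISQ.traceState σ =
      ∑ z : Bits n, σ.submatrix (fun x : Bits w => (Fin.append z x : Bits (n + w)))
        (fun x : Bits w => (Fin.append z x : Bits (n + w))) := by
    ext x y
    simp [NISQ.traceState, Matrix.sum_apply]
  rw [this]
  exact posSemidef_sum _ fun z _ => h.submatrix _

/-! ### The depolarizing channel -/

/-- The product operator with tensor factors `f`. -/
def prodOp {m : ℕ} (f : Fin m → Matrix (Fin 2) (Fin 2) ℂ) : Op m :=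
  Matrix.of fun x y => ∏ j, f j (x j) (y j)

lemma PauliString.op_eq_prodOp {n : ℕ} (P : PauliString n) :
    P.op = prodOp fun j => pauli (P j) := rfl

lemma prodOp_one {m : ℕ} : prodOp (fun _ : Fin m => 1) = 1 := by
  ext x y
  simp only [prodOp, Matrix.of_apply, Matrix.one_apply, Finset.prod_ite_zero,
    Finset.prod_const_one, Finset.mem_univ, true_implies, funext_iff]

lemma trace_prodOp {m : ℕ} (f : Fin m → Matrix (Fin 2) (Fin 2) ℂ) :
    (prodOp f).trace = ∏ j, (f j).trace := by
  simp only [Matrix.trace, Matrix.diag_apply, prodOp, Matrix.of_apply]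
  rw [Finset.prod_univ_sum, Fintype.piFinset_univ]

lemma prodOp_mul {m : ℕ} (f g : Fin m → Matrix (Fin 2) (Fin 2) ℂ) :
    prodOp f * prodOp g = prodOp fun j => f j * g j := by
  ext x y
  simp only [Matrix.mul_apply, prodOp, Matrix.of_apply, ← Finset.prod_mul_distrib]
  rw [Finset.prod_univ_sum, Fintype.piFinset_univ]

lemma depolarize_eq_sum_single (lam : ℝ) (σ : Matrix (Fin 2) (Fin 2) ℂ) (x y : Fin 2) :
    ∑ a, ∑ b, depolarize lam (Matrix.single a b 1) x y * σ a b = depolarize lam σ x y := by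
  fin_cases x <;> fin_cases y <;>
    simp [depolarize, Fin.sum_univ_two, Matrix.trace_fin_two] <;> ring

/-- The defining sum over pairs of global bit strings is an expanded product of sums over
single-qubit indices; folding it back lets the noise act factor by factor. -/
lemma depolarizeAll_prodOp (lam : ℝ) {m : ℕ} (f : Fin m → Matrix (Fin 2) (Fin 2) ℂ) :
    depolarizeAll lam (prodOp f) = prodOp fun j => depolarize lam (f j) := by
  ext x y
  simp only [depolarizeAll, prodOp, Matrix.of_apply, ← Finset.prod_mul_distrib]
  simp_rw [← depolarize_eq_sum_single lam (f _)]
  rw [Finset.prod_univ_sum, Fintype.piFinset_univ]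
  refine Finset.sum_congr rfl fun x' _ => ?_
  rw [Finset.prod_univ_sum, Fintype.piFinset_univ]

/-- The weights of the Pauli operators in the depolarizing channel. -/
def pauliWeight (lam : ℝ) (k : Fin 4) : ℝ := if k = 0 then 1 - 3 * lam / 4 else lam / 4

lemma pauliWeight_nonneg {lam : ℝ} (h0 : 0 ≤ lam) (h1 : lam ≤ 1) (k : Fin 4) :
    0 ≤ pauliWeight lam k := by
  unfold pauliWeight; split <;> linarith

/-- Depolarizing is conjugation by a random Pauli matrix: the identity with weight 1 - 3λ/4, and X,
Y, Z with weight λ/4 each. -/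
lemma depolarize_single_eq (lam : ℝ) (a b x y : Fin 2) :
    depolarize lam (Matrix.single a b 1) x y =
      ∑ k, (pauliWeight lam k : ℂ) * (pauli k x a * star (pauli k y b)) := by
  fin_cases x <;> fin_cases y <;> fin_cases a <;> fin_cases b <;>
    simp [depolarize, Fin.sum_univ_four, pauliWeight, pauli] <;> ring

/-- Multiplying out the single-qubit Kraus sums gives one term per Pauli string. Positivity of the
noise for 0 ≤ λ ≤ 1, and its absence at λ = 0, are read off from this form. -/
lemma depolarizeAll_eq_sum (lam : ℝ) {m : ℕ} (σ : Op m) :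
    depolarizeAll lam σ =
      ∑ Q : PauliString m, ((∏ j, pauliWeight lam (Q j) : ℝ) : ℂ) • (Q.op * σ * Q.opᴴ) := by
  ext x y
  simp only [depolarizeAll, Matrix.of_apply, depolarize_single_eq, Matrix.sum_apply,
    Matrix.smul_apply, smul_eq_mul, Matrix.mul_apply, Matrix.conjTranspose_apply, Finset.sum_mul,
    Finset.mul_sum]
  rw [Finset.sum_comm, Finset.sum_comm (γ := PauliString m)]
  refine Finset.sum_congr rfl fun y' _ => ?_
  rw [Finset.sum_comm (γ := PauliString m)]
  refine Finset.sum_congr rfl fun x' _ => ?_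
  rw [Finset.prod_univ_sum, Fintype.piFinset_univ, Finset.sum_mul]
  refine Finset.sum_congr rfl fun Q _ => ?_
  simp only [PauliString.op, Matrix.of_apply, star_prod]
  rw [Finset.prod_mul_distrib, Finset.prod_mul_distrib]
  push_cast
  ring

lemma PosSemidef.depolarizeAll {lam : ℝ} (h0 : 0 ≤ lam) (h1 : lam ≤ 1) {m : ℕ} {σ : Op m}
    (h : σ.PosSemidef) : (depolarizeAll lam σ).PosSemidef := by
  rw [depolarizeAll_eq_sum]
  refine posSemidef_sum _ fun Q _ => (h.mul_mul_conjTranspose_same _).smul ?_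
  exact_mod_cast Finset.prod_nonneg fun j _ => pauliWeight_nonneg h0 h1 _

lemma depolarizeAll_add (lam : ℝ) {m : ℕ} (σ τ : Op m) :
    depolarizeAll lam (σ + τ) = depolarizeAll lam σ + depolarizeAll lam τ := by
  ext x y
  simp [depolarizeAll, mul_add, Finset.sum_add_distrib]

lemma depolarizeAll_smul (lam : ℝ) {m : ℕ} (c : ℂ) (σ : Op m) :
    depolarizeAll lam (c • σ) = c • depolarizeAll lam σ := by
  ext x y
  simp only [depolarizeAll, Matrix.of_apply, Matrix.smul_apply, smul_eq_mul, Finset.mul_sum]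
  exact Finset.sum_congr rfl fun _ _ => Finset.sum_congr rfl fun _ _ => by ring

lemma trace_depolarizeAll (lam : ℝ) {m : ℕ} (σ : Op m) :
    (depolarizeAll lam σ).trace = σ.trace := by
  have key : ∀ x' y' : Bits m,
      ∑ x : Bits m, ∏ j, depolarize lam (Matrix.single (x' j) (y' j) 1) (x j) (x j) =
        if x' = y' then 1 else 0 := by
    intro x' y'
    have := Finset.prod_univ_sum (fun _ : Fin m => (Finset.univ : Finset (Fin 2)))
      (fun j a => depolarize lam (Matrix.single (x' j) (y' j) 1) a a)
    rw [Fintype.piFinset_univ] at this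
    rw [← this]
    have h2 : ∀ a b : Fin 2, ∑ c, depolarize lam (Matrix.single a b 1) c c =
        if a = b then 1 else 0 := by
      intro a b
      fin_cases a <;> fin_cases b <;>
        simp [depolarize, Fin.sum_univ_two] <;> ring
    simp_rw [h2, Finset.prod_ite_zero, Finset.prod_const_one]
    simp [funext_iff]
  simp only [Matrix.trace, Matrix.diag_apply, depolarizeAll, Matrix.of_apply]
  rw [Finset.sum_comm]
  refine Finset.sum_congr rfl fun x' _ => ?_
  rw [Finset.sum_comm]
  simp_rw [← Finset.sum_mul, key]
  simp

lemma depolarizeAll_tensor (lam : ℝ) {n w : ℕ} (A : Op n) (B : Op w) :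
    depolarizeAll lam (tensor A B) = tensor (depolarizeAll lam A) (depolarizeAll lam B) := by
  ext x y
  simp only [depolarizeAll, tensor, Matrix.of_apply]
  rw [sum_bits_add]
  simp_rw [sum_bits_add (n := n) (w := w), Fin.prod_univ_add, Fin.append_left, Fin.append_right]
  rw [Finset.sum_mul_sum]
  refine Finset.sum_congr rfl fun a _ => Finset.sum_congr rfl fun b _ => ?_
  rw [Finset.sum_mul_sum]
  refine Finset.sum_congr rfl fun a' _ => Finset.sum_congr rfl fun b' _ => ?_
  ring

lemma depolarize_pauli (lam : ℝ) {k : Fin 4} (hk : k ≠ 0) :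
    depolarize lam (pauli k) = ((1 - lam : ℝ) : ℂ) • pauli k := by
  ext x y
  fin_cases k
  · exact absurd rfl hk
  all_goals fin_cases x <;> fin_cases y <;> simp [depolarize, pauli, Matrix.trace_fin_two]

lemma depolarize_one (lam : ℝ) : depolarize lam 1 = 1 := by
  ext x y
  fin_cases x <;> fin_cases y <;> simp [depolarize]

lemma depolarizeAll_one (lam : ℝ) {m : ℕ} : depolarizeAll lam (1 : Op m) = 1 := by
  rw [← prodOp_one, depolarizeAll_prodOp]
  simp_rw [depolarize_one]

/-- Every factor of a full-weight string is traceless, so each qubit contributes 1 - λ. This is the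
source of the exponent n in the lower bound. -/
lemma depolarizeAll_pauli (lam : ℝ) {n : ℕ} {P : PauliString n} (hP : P.FullWeight) :
    depolarizeAll lam P.op = (((1 - lam) ^ n : ℝ) : ℂ) • P.op := by
  rw [PauliString.op_eq_prodOp, depolarizeAll_prodOp]
  simp_rw [fun j => depolarize_pauli lam (hP j)]
  ext x y
  simp [prodOp, Finset.prod_mul_distrib]

/-! ### Pauli operators -/

lemma pauli_conjTranspose (k : Fin 4) : (pauli k)ᴴ = pauli k := by
  ext x y
  fin_cases k <;> fin_cases x <;> fin_cases y <;> simp [pauli]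

lemma pauli_mul_self (k : Fin 4) : pauli k * pauli k = 1 := by
  ext x y
  fin_cases k <;> fin_cases x <;> fin_cases y <;>
    simp [pauli, Matrix.mul_apply, Fin.sum_univ_two]

lemma trace_pauli (k : Fin 4) : (pauli k).trace = if k = 0 then 2 else 0 := by
  fin_cases k <;> simp [pauli, Matrix.trace_fin_two]

lemma PauliString.op_isHermitian {n : ℕ} (P : PauliString n) : P.op.IsHermitian := by
  ext x y
  simp only [PauliString.op, Matrix.conjTranspose_apply, Matrix.of_apply, star_prod]
  refine Finset.prod_congr rfl fun j _ => ?_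
  rw [← Matrix.conjTranspose_apply, pauli_conjTranspose]

lemma PauliString.op_mul_self {n : ℕ} (P : PauliString n) : P.op * P.op = 1 := by
  rw [PauliString.op_eq_prodOp, prodOp_mul]
  simp_rw [pauli_mul_self]
  exact prodOp_one

lemma PauliString.trace_op {n : ℕ} (P : PauliString n) :
    P.op.trace = if P = 0 then 2 ^ n else 0 := by
  rw [PauliString.op_eq_prodOp, trace_prodOp]
  simp_rw [trace_pauli, Finset.prod_ite_zero]
  simp [funext_iff]

lemma PauliString.op_zero {n : ℕ} : (0 : PauliString n).op = 1 := prodOp_one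

lemma isState_pauliState {n : ℕ} (s : Fin 2) {P : PauliString n} (hP : P ≠ 0) :
    IsState (pauliState s P) := by
  have h2 : (0 : ℂ) ≤ ((2 : ℂ) ^ n)⁻¹ := by simp
  constructor
  · refine PosSemidef.smul ?_ h2
    fin_cases s
    · simpa using PosSemidef.one
    -- As P is Hermitian with square 1, the operator (1 + P)(1 + P)ᴴ is 2(1 + P), so 1 + P is half a
    -- Gram matrix.
    · have h : (1 + P.op) = ((1 / 2 : ℝ) : ℂ) • ((1 + P.op) * (1 + P.op)ᴴ) := by
        rw [conjTranspose_add, conjTranspose_one, P.op_isHermitian.eq, add_mul, mul_add, mul_add,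
          P.op_mul_self, mul_one, mul_one, one_mul, add_comm P.op 1, ← two_smul ℂ (1 + P.op),
          smul_smul]
        norm_num
      simp only [Nat.cast_one, one_smul]
      rw [h]
      refine (posSemidef_self_mul_conjTranspose _).smul ?_
      exact_mod_cast (by norm_num : (0 : ℝ) ≤ 1 / 2)
  · simp [pauliState, Matrix.trace_smul, Matrix.trace_add, P.trace_op, hP]

/-- Pauli strings are orthogonal under the trace. The values 0 and 1 separate the two states in the
estimation lower bound, and they make the Bell signs of all wrong strings unbiased. -/
lemma op_mul_pauliState_trace {n : ℕ} (s : Fin 2) (P Q : PauliString n) (hQ : Q ≠ 0) :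
    (Q.op * pauliState s P).trace = if s = 1 ∧ Q = P then 1 else 0 := by
  have h4 : ∀ j k : Fin 4, (pauli j * pauli k).trace = if j = k then 2 else 0 := by
    intro j k
    fin_cases j <;> fin_cases k <;>
      simp [pauli, Matrix.trace_fin_two] <;> norm_num
  have h5 : (Q.op * P.op).trace = if Q = P then 2 ^ n else 0 := by
    rw [PauliString.op_eq_prodOp, PauliString.op_eq_prodOp, prodOp_mul, trace_prodOp]
    simp_rw [h4, Finset.prod_ite_zero]
    simp [funext_iff]
  simp only [pauliState, Matrix.mul_smul, mul_add, mul_one, Matrix.trace_smul, Matrix.trace_add,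
    Q.trace_op, if_neg hQ, h5, smul_eq_mul, zero_add]
  fin_cases s <;> simp

end NISQ
end

/-! ### The lower bound for noisy algorithms -/

noncomputable section
namespace NISQ

open Matrix
open scoped ComplexOrder

/-! ### Unitarity of depth-1 layers -/

/-- An operator that acts through the coordinates `get` and leaves the rest fixed is unitary if it
acts on these coordinates by a unitary. -/
lemma conjTranspose_mul_self_of_lens {X ι : Type*} [Fintype X] [DecidableEq X] [Fintype ι]
    [DecidableEq ι] (get : X → ι) (put : ι → X → X) (get_put : ∀ p x, get (put p x) = p)
    (put_get : ∀ x, put (get x) x = x) (put_put : ∀ p q x, put p (put q x) = put p x)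
    (U : Matrix ι ι ℂ) (hU : Uᴴ * U = 1) (V : Matrix X X ℂ)
    (hV : ∀ p x y, V (put p x) y = if put p x = put p y then U p (get y) else 0) :
    Vᴴ * V = 1 := by
  -- Each z equals `put (get z) z`, so the hypothesis on `V` determines every entry: it vanishes
  -- unless z arises from y by rewriting the coordinates.
  have hz : ∀ z y, V z y = if z = put (get z) y then U (get z) (get y) else 0 := by
    intro z y
    have := hV (get z) z y
    rwa [put_get] at this
  ext x y
  rw [Matrix.mul_apply]
  have h1 : ∑ z, Vᴴ x z * V z y = ∑ p, Vᴴ x (put p x) * V (put p x) y := by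
    symm
    refine Finset.sum_of_injOn (fun p => put p x) ?_ ?_ ?_ ?_
    · intro p _ q _ h
      simpa [get_put] using congrArg get h
    · intro p _; simp
    · intro z _ h
      have : z ≠ put (get z) x := fun e => h ⟨get z, by simp, e.symm⟩
      rw [conjTranspose_apply, hz z x, if_neg this]
      simp
    · intro p _; rfl
  rw [h1]
  -- The fibres of x and y under rewriting coincide or are disjoint, by `put_put`. In the first case
  -- the sum is an entry of Uᴴ U; in the second every term is zero.
  by_cases hxy : ∃ p, put p x = put p y
  · have hall : ∀ p, put p x = put p y := by
      obtain ⟨q, hq⟩ := hxy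
      intro p
      rw [← put_put p q x, hq, put_put]
    simp only [conjTranspose_apply, hV, hall, if_true]
    have h2 := congrFun (congrFun hU (get x)) (get y)
    simp only [Matrix.mul_apply, conjTranspose_apply] at h2
    rw [h2, Matrix.one_apply, Matrix.one_apply]
    congr 1
    refine propext ⟨fun h => ?_, fun h => by rw [h]⟩
    rw [← put_get x, ← put_get y, h, hall]
  · push Not at hxy
    rw [Matrix.one_apply, if_neg (fun e => hxy (get x) (by rw [e]))]
    refine Finset.sum_eq_zero fun p _ => ?_
    rw [hV p x y, if_neg (hxy p), mul_zero]

/-- Here `get` reads the operand qubits and `put` overwrites them; for two operands their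
distinctness makes the overwritten values readable again. -/
lemma Gate.conjTranspose_mul_self {m : ℕ} (g : Gate m) : g.opᴴ * g.op = 1 := by
  cases g with
  | one a U =>
    refine conjTranspose_mul_self_of_lens (fun x : Bits m => x a)
      (fun p x => Function.update x a p) (by simp) (by simp) (by simp) U.1 ?_ _ ?_
    · exact (Matrix.mem_unitaryGroup_iff'.1 U.2)
    · intro p x y
      simp only [Gate.op, Matrix.of_apply, Function.update_self]
      congr 1
      refine propext ⟨fun h => ?_, fun h j hj => ?_⟩
      · ext j
        by_cases hj : j = a
        · subst hj; simp
        · have := h j hj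
          rw [Function.update_of_ne hj] at this
          simp only [Function.update_of_ne hj, this]
      · simpa [hj] using congrFun h j
  | two a b hab U =>
    refine conjTranspose_mul_self_of_lens (fun x : Bits m => (x a, x b))
      (fun p x => Function.update (Function.update x a p.1) b p.2) (by simp [hab]) ?_ ?_ U.1 ?_ _ ?_
    · intro x; simp
    · intro p q x
      ext j
      by_cases hb : j = b
      · subst hb; simp
      · by_cases ha : j = a
        · subst ha; simp [hb]
        · simp [ha, hb]
    · exact (Matrix.mem_unitaryGroup_iff'.1 U.2)
    · intro p x y
      simp only [Gate.op, Matrix.of_apply, Function.update_self, Function.update_of_ne hab]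
      congr 1
      refine propext ⟨fun h => ?_, fun h j ha hb => ?_⟩
      · ext j
        by_cases hb : j = b
        · subst hb; simp
        · by_cases ha : j = a
          · subst ha; simp [hb]
          · have := h j ha hb
            rw [Function.update_of_ne hb, Function.update_of_ne ha] at this
            simp only [Function.update_of_ne hb, Function.update_of_ne ha, this]
      · simpa [ha, hb] using congrFun h j

lemma DepthOne.conjTranspose_mul_self {m : ℕ} (L : DepthOne m) : L.opᴴ * L.op = 1 := by
  unfold DepthOne.op
  induction L.gates with
  | nil => simp
  | cons g l ih =>
    rw [List.map_cons, List.prod_cons, conjTranspose_mul, Matrix.mul_assoc,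
      ← Matrix.mul_assoc _ g.op, g.conjTranspose_mul_self, Matrix.one_mul, ih]

/-! ### Circuits map states to states -/

lemma IsState.tensor {n w : ℕ} {A : Op n} {B : Op w} (hA : IsState A) (hB : IsState B) :
    IsState (tensor A B) :=
  ⟨PosSemidef.tensor hA.1 hB.1, by rw [trace_tensor, hA.2, hB.2, one_mul]⟩

lemma IsState.depolarizeAll {lam : ℝ} (h0 : 0 ≤ lam) (h1 : lam ≤ 1) {m : ℕ} {σ : Op m}
    (h : IsState σ) : IsState (depolarizeAll lam σ) :=
  ⟨PosSemidef.depolarizeAll h0 h1 h.1, by rw [trace_depolarizeAll, h.2]⟩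

lemma Layer.apply_unitary {n w : ℕ} (ρ : Op n) (U : DepthOne (n + w)) (σ : Op (n + w)) :
    (Layer.unitary U).apply ρ σ = U.op * σ * U.opᴴ := rfl

lemma Layer.apply_oracle {n w : ℕ} (ρ : Op n) (σ : Op (n + w)) :
    Layer.oracle.apply ρ σ = tensor ρ (traceState σ) := rfl

lemma IsState.layerApply {n w : ℕ} {ρ : Op n} (hρ : IsState ρ) (L : Layer n w) {σ : Op (n + w)}
    (h : IsState σ) : IsState (L.apply ρ σ) := by
  cases L with
  | unitary U =>
    rw [Layer.apply_unitary]
    refine ⟨h.1.mul_mul_conjTranspose_same _, ?_⟩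
    rw [Matrix.trace_mul_comm, ← Matrix.mul_assoc, U.conjTranspose_mul_self,
      Matrix.one_mul, h.2]
  | oracle =>
    rw [Layer.apply_oracle]
    exact hρ.tensor ⟨PosSemidef.traceState h.1, by rw [trace_traceState, h.2]⟩

lemma isState_single (m : ℕ) : IsState (Matrix.single 0 0 1 : Op m) := by
  constructor
  · have : (Matrix.single 0 0 1 : Op m) = Matrix.diagonal (Pi.single 0 1) := by
      rw [Matrix.diagonal_single]
    rw [this]
    refine PosSemidef.diagonal fun i => ?_
    by_cases h : i = 0
    · subst h; simp
    · simp [h]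
  · simp

lemma Circuit.isState_foldl {lam : ℝ} (h0 : 0 ≤ lam) (h1 : lam ≤ 1) {n w : ℕ} {ρ : Op n}
    (hρ : IsState ρ) (C : Circuit n w) (σ : Op (n + w)) (h : IsState σ) :
    IsState (C.foldl (fun σ L => NISQ.depolarizeAll lam (L.apply ρ σ)) σ) := by
  induction C generalizing σ with
  | nil => exact h
  | cons L C ih => exact ih _ ((hρ.layerApply L h).depolarizeAll h0 h1)

lemma Circuit.isState_final {lam : ℝ} (h0 : 0 ≤ lam) (h1 : lam ≤ 1) {n w : ℕ} {ρ : Op n}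
    (hρ : IsState ρ) (C : Circuit n w) : IsState (C.final lam ρ) :=
  C.isState_foldl h0 h1 hρ _ ((isState_single _).depolarizeAll h0 h1)

lemma Circuit.outProb_nonneg {lam : ℝ} (h0 : 0 ≤ lam) (h1 : lam ≤ 1) {n w : ℕ} {ρ : Op n}
    (hρ : IsState ρ) (C : Circuit n w) (s : Bits (n + w)) : 0 ≤ C.outProb lam ρ s :=
  (Complex.nonneg_iff.1 (C.isState_final h0 h1 hρ).1.diag_nonneg).1

lemma Circuit.sum_outProb {lam : ℝ} (h0 : 0 ≤ lam) (h1 : lam ≤ 1) {n w : ℕ} {ρ : Op n}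
    (hρ : IsState ρ) (C : Circuit n w) : ∑ s, C.outProb lam ρ s = 1 := by
  have := congrArg Complex.re (C.isState_final h0 h1 hρ).2
  rw [Matrix.trace, Complex.re_sum] at this
  exact this

/-! ### The two-state comparison -/

lemma tensor_add_left {n w : ℕ} (A A' : Op n) (B : Op w) :
    tensor (A + A') B = tensor A B + tensor A' B := by
  ext x y; simp [tensor, add_mul]

lemma tensor_smul_left {n w : ℕ} (c : ℂ) (A : Op n) (B : Op w) :
    tensor (c • A) B = c • tensor A B := by
  ext x y; simp [tensor, mul_assoc]

lemma Layer.apply_add {n w : ℕ} (ρ : Op n) (L : Layer n w) (σ τ : Op (n + w)) :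
    L.apply ρ (σ + τ) = L.apply ρ σ + L.apply ρ τ := by
  cases L with
  | unitary U => simp [Layer.apply, mul_add, add_mul]
  | oracle =>
    ext x y
    simp [Layer.apply, stateOracle, mul_add, Finset.sum_add_distrib]

lemma Layer.apply_smul {n w : ℕ} (ρ : Op n) (L : Layer n w) (c : ℂ) (σ : Op (n + w)) :
    L.apply ρ (c • σ) = c • L.apply ρ σ := by
  cases L with
  | unitary U => simp [Layer.apply]
  | oracle =>
    ext x y
    simp only [Layer.apply, stateOracle, Matrix.of_apply, Matrix.smul_apply, smul_eq_mul,
      ← Finset.mul_sum]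
    ring

lemma PosSemidef.layerApply {n w : ℕ} {ρ : Op n} (hρ : ρ.PosSemidef) (L : Layer n w)
    {σ : Op (n + w)} (h : σ.PosSemidef) : (L.apply ρ σ).PosSemidef := by
  cases L with
  | unitary U =>
    rw [Layer.apply_unitary]
    exact h.mul_mul_conjTranspose_same _
  | oracle =>
    rw [Layer.apply_oracle]
    exact PosSemidef.tensor hρ (PosSemidef.traceState h)

/-- The identity part of the state is untouched by the noise and P shrinks by (1 - λ)^n, so the
noisy state is a convex combination of the maximally mixed state and the noiseless state for s = 1.
-/
lemma depolarizeAll_pauliState_one (lam : ℝ) {n : ℕ} {P : PauliString n} (hP : P.FullWeight) :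
    depolarizeAll lam (pauliState 1 P) =
      ((1 - (1 - lam) ^ n : ℝ) : ℂ) • depolarizeAll lam (pauliState 0 P) +
        (((1 - lam) ^ n : ℝ) : ℂ) • pauliState 1 P := by
  simp only [pauliState, depolarizeAll_smul, depolarizeAll_add, depolarizeAll_one,
    depolarizeAll_pauli lam hP]
  ext x y
  simp
  ring

/-- The weight that one layer contributes to the comparison of the two states. -/
lemma Layer.posSemidef_sub {lam : ℝ} (h0 : 0 ≤ lam) (h1 : lam ≤ 1) {n w : ℕ} (hn : n ≠ 0)
    {P : PauliString n} (hP : P.FullWeight) (L : Layer n w) {r : ℝ} (hr : 0 ≤ r)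
    {σ τ : Op (n + w)} (hσ : σ.PosSemidef) (h : (τ - (r : ℂ) • σ).PosSemidef) :
    (depolarizeAll lam (L.apply (pauliState 1 P) τ) -
      ((r * (1 - (1 - lam) ^ n) ^ Circuit.calls [L] : ℝ) : ℂ) •
        depolarizeAll lam (L.apply (pauliState 0 P) σ)).PosSemidef := by
  have hP0 : P ≠ 0 := fun e => hP ⟨0, Nat.pos_of_ne_zero hn⟩ (by simp [e])
  -- τ is split into its positive excess and r σ. The excess stays positive under the oracle for s =
  -- 1 and the noise; the two oracles need to be compared only on r σ.
  have h3 : τ = (τ - (r : ℂ) • σ) + (r : ℂ) • σ := by simp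
  have h4 := PosSemidef.depolarizeAll h0 h1
    (PosSemidef.layerApply (isState_pauliState 1 hP0).1 L h)
  cases L with
  | unitary U =>
    rw [h3, Layer.apply_add, Layer.apply_smul, depolarizeAll_add, depolarizeAll_smul]
    simpa [Circuit.calls, Layer.apply] using h4
  | oracle =>
    rw [h3, Layer.apply_add, Layer.apply_smul, depolarizeAll_add, depolarizeAll_smul]
    -- With the same input σ the noise factors over register and workspace, and the surplus of the
    -- first oracle over 1 - e times the second is e ρ₁ ⊗ D(Tr_state σ), which is positive.
    have h5 : depolarizeAll lam (Layer.oracle.apply (pauliState 1 P) σ) -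
        ((1 - (1 - lam) ^ n : ℝ) : ℂ) • depolarizeAll lam (Layer.oracle.apply (pauliState 0 P) σ) =
        (((1 - lam) ^ n : ℝ) : ℂ) •
          tensor (pauliState 1 P) (depolarizeAll lam (traceState σ)) := by
      simp only [Layer.apply, stateOracle_eq, depolarizeAll_tensor,
        depolarizeAll_pauliState_one lam hP, tensor_add_left, tensor_smul_left]
      abel
    have h6 : (((r * (1 - lam) ^ n : ℝ) : ℂ) • tensor (pauliState 1 P)
        (depolarizeAll lam (traceState σ))).PosSemidef := by
      refine (PosSemidef.tensor (isState_pauliState 1 hP0).1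
        (PosSemidef.depolarizeAll h0 h1 (PosSemidef.traceState hσ))).smul ?_
      exact Complex.zero_le_real.mpr (mul_nonneg hr (pow_nonneg (by linarith) _))
    have h7 := h4.add h6
    rw [Complex.ofReal_mul, mul_smul, ← h5] at h7
    convert h7 using 1
    simp only [Circuit.calls, List.countP_cons, List.countP_nil, if_true, zero_add, pow_one,
      Complex.ofReal_mul, mul_smul, smul_sub]
    abel

/-- The weight r is left general so that layers can be chained: an oracle call multiplies it by 1 -
(1 - λ)^n, and a unitary layer preserves it. -/
lemma Circuit.posSemidef_sub {lam : ℝ} (h0 : 0 ≤ lam) (h1 : lam ≤ 1) {n w : ℕ} (hn : n ≠ 0)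
    {P : PauliString n} (hP : P.FullWeight) (C : Circuit n w) {r : ℝ} (hr : 0 ≤ r)
    {σ τ : Op (n + w)} (hσ : σ.PosSemidef) (h : (τ - (r : ℂ) • σ).PosSemidef) :
    (C.foldl (fun σ L => depolarizeAll lam (L.apply (pauliState 1 P) σ)) τ -
      ((r * (1 - (1 - lam) ^ n) ^ C.calls : ℝ) : ℂ) •
        C.foldl (fun σ L => depolarizeAll lam (L.apply (pauliState 0 P) σ)) σ).PosSemidef := by
  have hP0 : P ≠ 0 := fun e => hP ⟨0, Nat.pos_of_ne_zero hn⟩ (by simp [e])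
  have he : 0 ≤ 1 - (1 - lam) ^ n := by
    linarith [pow_le_one₀ (n := n) (by linarith : 0 ≤ 1 - lam) (by linarith)]
  induction C generalizing σ τ r with
  | nil => simpa [Circuit.calls] using h
  | cons L C ih =>
    have h2 := ih (mul_nonneg hr (pow_nonneg he _))
      (PosSemidef.depolarizeAll h0 h1 (PosSemidef.layerApply (isState_pauliState 0 hP0).1 L hσ))
      (L.posSemidef_sub h0 h1 hn hP hr hσ h)
    have h3 : Circuit.calls (L :: C) = Circuit.calls [L] + Circuit.calls C := by
      simp only [Circuit.calls]
      rw [← List.countP_append]; rfl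
    rw [h3, pow_add, ← mul_assoc]
    exact h2

/-- Both runs start in the same state, so the comparison begins with weight 1 and zero excess.
Diagonal entries of a positive semidefinite matrix are nonnegative. -/
lemma Circuit.le_outProb {lam : ℝ} (h0 : 0 ≤ lam) (h1 : lam ≤ 1) {n w : ℕ} (hn : n ≠ 0)
    {P : PauliString n} (hP : P.FullWeight) (C : Circuit n w) (s : Bits (n + w)) :
    (1 - (1 - lam) ^ n) ^ C.calls * C.outProb lam (pauliState 0 P) s ≤
      C.outProb lam (pauliState 1 P) s := by
  have h := C.posSemidef_sub h0 h1 hn hP zero_le_one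
    ((isState_single (n + w)).depolarizeAll h0 h1).1
    (τ := NISQ.depolarizeAll lam (Matrix.single 0 0 1)) (by simpa using PosSemidef.zero)
  have := (Complex.nonneg_iff.1 (h.diag_nonneg (i := s))).1
  rw [one_mul, Matrix.sub_apply, Matrix.smul_apply, smul_eq_mul, Complex.sub_re,
    Complex.re_ofReal_mul] at this
  exact sub_nonneg.1 this

/-! ### From single circuits to adaptive algorithms -/

namespace HybridAlg

variable {n : ℕ} {β : Type}

lemma summable_mul_of_mem_Icc {α : Type} (μ : PMF α) {f : α → ℝ} (h0 : ∀ a, 0 ≤ f a)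
    (h1 : ∀ a, f a ≤ 1) : Summable fun a => (μ a).toReal * f a := by
  refine Summable.of_nonneg_of_le (fun a => mul_nonneg ENNReal.toReal_nonneg (h0 a))
    (fun a => mul_le_of_le_one_right ENNReal.toReal_nonneg (h1 a))
    (ENNReal.summable_toReal ?_)
  rw [μ.tsum_coe]; exact ENNReal.one_ne_top

lemma tsum_toReal_pmf {α : Type} (μ : PMF α) : ∑' a, (μ a).toReal = 1 := by
  rw [← ENNReal.tsum_toReal_eq fun a => μ.apply_ne_top a, μ.tsum_coe, ENNReal.toReal_one]

lemma prob_mem_Icc {lam : ℝ} (h0 : 0 ≤ lam) (h1 : lam ≤ 1) {ρ : Op n} (hρ : IsState ρ)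
    (E : Set β) (A : HybridAlg n β) : 0 ≤ A.prob lam ρ E ∧ A.prob lam ρ E ≤ 1 := by
  induction A with
  | output b => unfold prob; split <;> simp
  | rand α μ next ih =>
    refine ⟨tsum_nonneg fun a => mul_nonneg ENNReal.toReal_nonneg (ih a).1, ?_⟩
    rw [← tsum_toReal_pmf μ]
    refine Summable.tsum_le_tsum
      (fun a => mul_le_of_le_one_right ENNReal.toReal_nonneg (ih a).2)
      (summable_mul_of_mem_Icc μ (fun a => (ih a).1) fun a => (ih a).2) ?_
    simpa using summable_mul_of_mem_Icc μ (f := fun _ => 1) (by simp) (by simp)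
  | query w C next ih =>
    refine ⟨Finset.sum_nonneg fun s _ => mul_nonneg (C.outProb_nonneg h0 h1 hρ s) (ih s).1, ?_⟩
    rw [← C.sum_outProb h0 h1 hρ]
    exact Finset.sum_le_sum fun s _ =>
      mul_le_of_le_one_right (C.outProb_nonneg h0 h1 hρ s) (ih s).2

/-- Probabilities of disjoint events add up to at most one. -/
lemma sum_prob_le_one {lam : ℝ} (h0 : 0 ≤ lam) (h1 : lam ≤ 1) {ρ : Op n} (hρ : IsState ρ)
    {ι : Type*} (S : Finset ι) (E : ι → Set β)
    (hE : ∀ i ∈ S, ∀ j ∈ S, i ≠ j → Disjoint (E i) (E j)) (A : HybridAlg n β) :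
    ∑ i ∈ S, A.prob lam ρ (E i) ≤ 1 := by
  induction A with
  | output b =>
    unfold prob
    by_cases h : ∃ i ∈ S, b ∈ E i
    · obtain ⟨i, hi, hb⟩ := h
      rw [Finset.sum_eq_single_of_mem i hi fun j hj hji => ?_]
      · split <;> simp
      · rw [if_neg]
        exact fun hbj => Set.disjoint_left.1 (hE j hj i hi hji) hbj hb
    · push Not at h
      rw [Finset.sum_eq_zero fun i hi => if_neg (h i hi)]
      exact zero_le_one
  | rand α μ next ih =>
    unfold prob
    have hs : ∀ i, Summable fun a => (μ a).toReal * (next a).prob lam ρ (E i) := fun i =>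
      summable_mul_of_mem_Icc μ (fun a => (prob_mem_Icc h0 h1 hρ _ _).1)
        fun a => (prob_mem_Icc h0 h1 hρ _ _).2
    rw [← Summable.tsum_finsetSum fun i _ => hs i, ← tsum_toReal_pmf μ]
    refine Summable.tsum_le_tsum (fun a => ?_) (summable_sum fun i _ => hs i) ?_
    · rw [← Finset.mul_sum]
      exact mul_le_of_le_one_right ENNReal.toReal_nonneg (ih a)
    · simpa using summable_mul_of_mem_Icc μ (f := fun _ => 1) (by simp) (by simp)
  | query w C next ih =>
    unfold prob
    rw [Finset.sum_comm, ← C.sum_outProb h0 h1 hρ]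
    refine Finset.sum_le_sum fun s _ => ?_
    rw [← Finset.mul_sum]
    exact mul_le_of_le_one_right (C.outProb_nonneg h0 h1 hρ s) (ih s)

lemma prob_add_prob_le_one {lam : ℝ} (h0 : 0 ≤ lam) (h1 : lam ≤ 1) {ρ : Op n} (hρ : IsState ρ)
    {E F : Set β} (hEF : Disjoint E F) (A : HybridAlg n β) :
    A.prob lam ρ E + A.prob lam ρ F ≤ 1 := by
  have := sum_prob_le_one h0 h1 hρ (Finset.univ : Finset (Fin 2)) ![E, F] (by
    intro i _ j _ hij
    fin_cases i <;> fin_cases j <;> first | exact absurd rfl hij | simpa using hEF |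
      simpa using hEF.symm) A
  simpa using this

lemma prob_add_prob_compl {lam : ℝ} (h0 : 0 ≤ lam) (h1 : lam ≤ 1) {ρ : Op n} (hρ : IsState ρ)
    (E : Set β) (A : HybridAlg n β) : A.prob lam ρ E + A.prob lam ρ Eᶜ = 1 := by
  induction A with
  | output b => unfold prob; by_cases h : b ∈ E <;> simp [h]
  | rand α μ next ih =>
    unfold prob
    have hs : ∀ F : Set β, Summable fun a => (μ a).toReal * (next a).prob lam ρ F := fun F =>
      summable_mul_of_mem_Icc μ (fun a => (prob_mem_Icc h0 h1 hρ _ _).1)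
        fun a => (prob_mem_Icc h0 h1 hρ _ _).2
    rw [← Summable.tsum_add (hs _) (hs _)]
    simp_rw [← mul_add, ih, mul_one, tsum_toReal_pmf]
  | query w C next ih =>
    unfold prob
    rw [← Finset.sum_add_distrib]
    simp_rw [← mul_add, ih, mul_one, C.sum_outProb h0 h1 hρ]

/-- With few noisy queries every event that is likely for the maximally mixed state stays likely. -/
lemma pow_mul_prob_le {lam : ℝ} (h0 : 0 ≤ lam) (h1 : lam ≤ 1) (hn : n ≠ 0)
    {P : PauliString n} (hP : P.FullWeight) (E : Set β) (A : HybridAlg n β) (N : ℕ)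
    (hA : A.QueriesAtMost N) :
    (1 - (1 - lam) ^ n) ^ N * A.prob lam (pauliState 0 P) E ≤ A.prob lam (pauliState 1 P) E := by
  have hP0 : P ≠ 0 := fun e => hP ⟨0, Nat.pos_of_ne_zero hn⟩ (by simp [e])
  have h00 := isState_pauliState 0 hP0
  have h11 := isState_pauliState 1 hP0
  have hp : (1 - lam) ^ n ≤ 1 := pow_le_one₀ (by linarith) (by linarith)
  have he : 0 ≤ 1 - (1 - lam) ^ n := by linarith
  have he1 : 1 - (1 - lam) ^ n ≤ 1 := by linarith [pow_nonneg (by linarith : 0 ≤ 1 - lam) n]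
  induction A generalizing N with
  | output b => exact mul_le_of_le_one_left (by unfold prob; split <;> simp) (pow_le_one₀ he he1)
  | rand α μ next ih =>
    unfold prob
    have hs : ∀ s, Summable fun a => (μ a).toReal * (next a).prob lam (pauliState s P) E :=
      fun s => summable_mul_of_mem_Icc μ
        (fun a => (prob_mem_Icc h0 h1 (isState_pauliState s hP0) _ _).1)
        fun a => (prob_mem_Icc h0 h1 (isState_pauliState s hP0) _ _).2
    rw [← tsum_mul_left]
    refine Summable.tsum_le_tsum (fun a => ?_) ((hs 0).mul_left _) (hs 1)
    -- The query bound is known only on the support of the coin; elsewhere both terms vanish.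
    by_cases ha : μ a = 0
    · simp [ha]
    · rw [mul_left_comm]
      exact mul_le_mul_of_nonneg_left (ih a N (hA a ((μ.mem_support_iff a).2 ha)))
        ENNReal.toReal_nonneg
  | query w C next ih =>
    unfold prob
    rw [Finset.mul_sum]
    refine Finset.sum_le_sum fun s _ => ?_
    have h2 := C.le_outProb h0 h1 hn hP s
    have h3 := ih s _ (hA.2 s)
    -- The budget splits into the calls of this circuit and the calls left for the rest of the tree.
    have h4 : (1 - (1 - lam) ^ n) ^ N =
        (1 - (1 - lam) ^ n) ^ C.calls * (1 - (1 - lam) ^ n) ^ (N - C.calls) := by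
      rw [← pow_add, Nat.add_sub_of_le hA.1]
    calc _ = ((1 - (1 - lam) ^ n) ^ C.calls * C.outProb lam (pauliState 0 P) s) *
          ((1 - (1 - lam) ^ n) ^ (N - C.calls) * (next s).prob lam (pauliState 0 P) E) := by
          rw [h4]; ring
      _ ≤ _ := mul_le_mul h2 h3 (mul_nonneg (pow_nonneg he _) (prob_mem_Icc h0 h1 h00 _ _).1)
          (C.outProb_nonneg h0 h1 h11 s)

/-- Bernoulli's inequality turns the multiplicative loss into an additive loss of (1 - λ)^n per
query. -/
lemma prob_sub_le {lam : ℝ} (h0 : 0 ≤ lam) (h1 : lam ≤ 1) (hn : n ≠ 0)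
    {P : PauliString n} (hP : P.FullWeight) (E : Set β) (A : HybridAlg n β) (N : ℕ)
    (hA : A.QueriesAtMost N) :
    A.prob lam (pauliState 0 P) E - N * (1 - lam) ^ n ≤ A.prob lam (pauliState 1 P) E := by
  have hP0 : P ≠ 0 := fun e => hP ⟨0, Nat.pos_of_ne_zero hn⟩ (by simp [e])
  refine le_trans ?_ (pow_mul_prob_le h0 h1 hn hP E A N hA)
  obtain ⟨g0, g1⟩ := prob_mem_Icc h0 h1 (isState_pauliState 0 hP0) E A
  have hp : (1 - lam) ^ n ≤ 1 := pow_le_one₀ (by linarith) (by linarith)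
  have hp0 : 0 ≤ (1 - lam) ^ n := pow_nonneg (by linarith) _
  have hb := one_add_mul_le_pow (a := -(1 - lam) ^ n) (by linarith) N
  rw [← sub_eq_add_neg] at hb
  have : (0 : ℝ) ≤ N * (1 - lam) ^ n := by positivity
  nlinarith

end HybridAlg

lemma PauliString.card_fullWeight (n : ℕ) :
    (Finset.univ.filter fun P : PauliString n => P.FullWeight).card = 3 ^ n := by
  have : (Finset.univ.filter fun P : PauliString n => P.FullWeight) =
      Fintype.piFinset fun _ : Fin n => ({1, 2, 3} : Finset (Fin 4)) := by
    ext P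
    rw [Finset.mem_filter, Fintype.mem_piFinset]
    simp only [Finset.mem_univ, true_and, PauliString.FullWeight]
    refine forall_congr' fun j => ?_
    generalize P j = k
    revert k; decide
  rw [this, Fintype.card_piFinset_const]
  rfl

/-- Noisy algorithms need exponentially many queries. -/
theorem noisy_lower_bound (η : ℝ) (hη : 0 < η) (lam : ℝ) (h0 : 0 ≤ lam) (h1 : lam ≤ 1) (n : ℕ)
    (hn : 1 ≤ n) (N : ℕ) :
    (∀ (P : PauliString n), P.FullWeight →
      ∀ (A : HybridAlg n (Fin 2)), A.QueriesAtMost N →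
        1 / 2 + η ≤ (A.prob lam (pauliState 0 P) {0} + A.prob lam (pauliState 1 P) {1}) / 2 →
        η ≤ N * (1 - lam) ^ n) ∧
    (∀ (A : HybridAlg n (PauliString n)), A.QueriesAtMost N →
        1 / 3 ^ n + η ≤
          (∑ P : PauliString n with P.FullWeight, A.prob lam (pauliState 1 P) {P}) / 3 ^ n →
        η ≤ N * (1 - lam) ^ n) ∧
    (∀ (ε : ℝ), ε < 1 / 2 →
      ∀ (A : HybridAlg n (PauliString n → ℝ)), A.QueriesAtMost N →
        (∀ ρ : Op n, IsState ρ →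
          1 / 2 + η ≤ A.prob lam ρ {f | ∀ P, |f P - ‖(P.op * ρ).trace‖| ≤ ε}) →
        η ≤ N * (1 - lam) ^ n) := by
  have hn0 : n ≠ 0 := by omega
  have ne0 : ∀ {P : PauliString n}, P.FullWeight → P ≠ 0 := fun hP e =>
    hP ⟨0, Nat.pos_of_ne_zero hn0⟩ (by simp [e])
  have hN : 0 ≤ N * (1 - lam) ^ n := mul_nonneg (Nat.cast_nonneg _) (pow_nonneg (by linarith) _)
  refine ⟨fun P hP A hA h => ?_, fun A hA h => ?_, fun ε hε A hA h => ?_⟩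
  · have h2 := HybridAlg.prob_sub_le h0 h1 hn0 hP {0} A N hA
    have h3 := HybridAlg.prob_add_prob_le_one h0 h1 (isState_pauliState 1 (ne0 hP))
      (E := {0}) (F := {1}) (by simp) A
    linarith
  -- The comparison only bounds probabilities for s = 1 from below. Applied to the complement of
  -- {P}, it bounds the chance of naming P from above.
  · have hle : ∀ P : PauliString n, P.FullWeight → A.prob lam (pauliState 1 P) {P} ≤
        A.prob lam (pauliState 0 P) {P} + N * (1 - lam) ^ n := by
      intro P hP
      have h2 := HybridAlg.prob_sub_le h0 h1 hn0 hP {P}ᶜ A N hA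
      have h3 := HybridAlg.prob_add_prob_compl h0 h1 (isState_pauliState 1 (ne0 hP)) {P} A
      have h4 := HybridAlg.prob_add_prob_compl h0 h1 (isState_pauliState 0 (ne0 hP)) {P} A
      linarith
    let P₁ : PauliString n := fun _ => 1
    have hP₁ : P₁.FullWeight := fun _ => by simp [P₁]
    -- The maximally mixed state does not depend on P. The guesses {P} are thus disjoint events
    -- under one fixed state, and their probabilities sum to at most 1.
    have hst : ∀ P : PauliString n, pauliState 0 P = pauliState 0 P₁ := by
      intro P; simp [pauliState]
    have hsum : ∑ P : PauliString n with P.FullWeight, A.prob lam (pauliState 1 P) {P} ≤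
        1 + 3 ^ n * (N * (1 - lam) ^ n) := by
      calc _ ≤ ∑ P : PauliString n with P.FullWeight,
            (A.prob lam (pauliState 0 P₁) {P} + N * (1 - lam) ^ n) := by
            refine Finset.sum_le_sum fun P hP => ?_
            rw [← hst P]
            exact hle P (Finset.mem_filter.1 hP).2
        _ ≤ _ := by
            rw [Finset.sum_add_distrib, Finset.sum_const, PauliString.card_fullWeight,
              nsmul_eq_mul]
            push_cast
            gcongr
            exact HybridAlg.sum_prob_le_one h0 h1 (isState_pauliState 0 (ne0 hP₁)) _
              (fun P => {P}) (fun i _ j _ hij => by simpa using hij) A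
    have h3 : (0 : ℝ) < 3 ^ n := by positivity
    rw [le_div_iff₀ h3, add_mul, one_div, inv_mul_cancel₀ h3.ne'] at h
    have := h.trans hsum
    have h5 : 3 ^ n * η ≤ 3 ^ n * (N * (1 - lam) ^ n) := by linarith
    exact le_of_mul_le_mul_left h5 h3
  · let P : PauliString n := fun _ => 1
    have hP : P.FullWeight := fun _ => by simp [P]
    have a0 := h _ (isState_pauliState 0 (ne0 hP))
    have a1 := h _ (isState_pauliState 1 (ne0 hP))
    have h2 := HybridAlg.prob_sub_le h0 h1 hn0 hP
      {f | ∀ Q, |f Q - ‖(Q.op * pauliState 0 P).trace‖| ≤ ε} A N hA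
    have h3 := HybridAlg.prob_add_prob_le_one h0 h1 (isState_pauliState 1 (ne0 hP))
      (E := {f | ∀ Q, |f Q - ‖(Q.op * pauliState 0 P).trace‖| ≤ ε})
      (F := {f | ∀ Q, |f Q - ‖(Q.op * pauliState 1 P).trace‖| ≤ ε}) (by
        -- The two values of |Tr(Pρ)| are 0 and 1, and no number is within ε < 1/2 of both.
        rw [Set.disjoint_left]
        intro f hf hf'
        have b0 := hf P
        have b1 := hf' P
        rw [op_mul_pauliState_trace _ _ _ (ne0 hP)] at b0 b1
        simp only [Fin.isValue, zero_ne_one, false_and, if_false, norm_zero, sub_zero, and_self,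
          if_true, norm_one] at b0 b1
        rw [abs_le] at b0 b1
        linarith [b0.1, b0.2, b1.1, b1.2]) A
    linarith

end NISQ
end

/-! ### The Bell sampling circuit and its output distribution -/

noncomputable section
namespace NISQ

open Matrix
open scoped ComplexOrder

/-! ### Operators that act on corresponding qubits of two registers -/

/-- The `j`-th qubits of both registers. -/
def pairAt {n : ℕ} (x : Bits (n + n)) (j : Fin n) : Fin 2 × Fin 2 :=
  (x (Fin.castAdd n j), x (Fin.natAdd n j))

/-- Two registers of `n` qubits as a register of `n` pairs of qubits. -/
def pairEquiv (n : ℕ) : Bits (n + n) ≃ (Fin n → Fin 2 × Fin 2) where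
  toFun := pairAt
  invFun p := Fin.append (fun j => (p j).1) fun j => (p j).2
  left_inv x := by
    ext i
    refine Fin.addCases (fun j => ?_) (fun j => ?_) i <;> simp [pairAt, -Fin.natAdd_eq_addNat]
  right_inv p := by ext j <;> simp [pairAt, -Fin.natAdd_eq_addNat]

lemma pairAt_injective {n : ℕ} : Function.Injective (pairAt (n := n)) := (pairEquiv n).injective

lemma forall_pairAt_eq_iff {n : ℕ} {x y : Bits (n + n)} :
    (∀ j, pairAt x j = pairAt y j) ↔ x = y :=
  funext_iff.symm.trans pairAt_injective.eq_iff

/-- The tensor product over `j` of operators on the `j`-th qubits of both registers. -/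
def pairOp {n : ℕ} (f : Fin n → Matrix (Fin 2 × Fin 2) (Fin 2 × Fin 2) ℂ) : Op (n + n) :=
  Matrix.of fun x y => ∏ j, f j (pairAt x j) (pairAt y j)

lemma pairOp_mul {n : ℕ} (f g : Fin n → Matrix (Fin 2 × Fin 2) (Fin 2 × Fin 2) ℂ) :
    pairOp f * pairOp g = pairOp (f * g) := by
  ext x y
  simp only [Matrix.mul_apply, pairOp, Matrix.of_apply, ← Finset.prod_mul_distrib, Pi.mul_apply]
  rw [Finset.prod_univ_sum, Fintype.piFinset_univ, ← (pairEquiv n).sum_comp]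
  rfl

lemma pairOp_one {n : ℕ} : pairOp (1 : Fin n → Matrix (Fin 2 × Fin 2) (Fin 2 × Fin 2) ℂ) = 1 := by
  ext x y
  simp only [pairOp, Matrix.of_apply, Pi.one_apply, Matrix.one_apply, Finset.prod_ite_zero,
    Finset.prod_const_one, Finset.mem_univ, true_implies, forall_pairAt_eq_iff]

lemma pairOp_conjTranspose {n : ℕ} (f : Fin n → Matrix (Fin 2 × Fin 2) (Fin 2 × Fin 2) ℂ) :
    (pairOp f)ᴴ = pairOp fun j => (f j)ᴴ := by
  ext x y
  simp [pairOp, star_prod]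

lemma pairOp_list_prod {n : ℕ} {α : Type*} (l : List α)
    (f : α → Fin n → Matrix (Fin 2 × Fin 2) (Fin 2 × Fin 2) ℂ) :
    (l.map fun a => pairOp (f a)).prod = pairOp (l.map f).prod := by
  induction l with
  | nil => simp [pairOp_one]
  | cons a l ih => simp [ih, pairOp_mul]

/-- This joins two descriptions of a local gate: a tensor product with identities on all other
pairs, and the entrywise form of `Gate.op`, which tests that all other bits agree. -/
lemma pairOp_mulSingle {n : ℕ} (j : Fin n) (U : Matrix (Fin 2 × Fin 2) (Fin 2 × Fin 2) ℂ)
    (x y : Bits (n + n)) :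
    pairOp (Pi.mulSingle j U) x y =
      if ∀ i, i ≠ Fin.castAdd n j → i ≠ Fin.natAdd n j → x i = y i then
        U (pairAt x j) (pairAt y j) else 0 := by
  have h1 : pairOp (Pi.mulSingle j U) x y = U (pairAt x j) (pairAt y j) *
      if ∀ k ∈ Finset.univ.erase j, pairAt x k = pairAt y k then 1 else 0 := by
    simp only [pairOp, Matrix.of_apply]
    rw [← Finset.mul_prod_erase _ _ (Finset.mem_univ j), Pi.mulSingle_eq_same]
    congr 1
    trans ∏ k ∈ Finset.univ.erase j, if pairAt x k = pairAt y k then (1 : ℂ) else 0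
    · refine Finset.prod_congr rfl fun k hk => ?_
      rw [Pi.mulSingle_eq_of_ne (Finset.ne_of_mem_erase hk), Matrix.one_apply]
    · rw [Finset.prod_ite_zero, Finset.prod_const_one]
      congr
  rw [h1, mul_ite, mul_one, mul_zero]
  congr 1
  refine propext ⟨fun h i => ?_, fun h k hk => ?_⟩
  · refine Fin.addCases (fun k => ?_) (fun k => ?_) i
    · intro hk _
      exact congrArg Prod.fst (h k (by simpa [eq_comm] using fun e : j = k => hk (by rw [e])))
    · intro _ hk
      exact congrArg Prod.snd (h k (by simpa [eq_comm] using fun e : j = k => hk (by rw [e])))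
  · have hkj : k ≠ j := Finset.ne_of_mem_erase hk
    have hv : (k : ℕ) ≠ j := fun e => hkj (Fin.ext e)
    have := j.2
    have := k.2
    refine Prod.ext (h _ ?_ ?_) (h _ ?_ ?_) <;>
      · intro e
        have := congrArg Fin.val e
        simp at this
        omega

/-- The gate `U` on the `j`-th qubits of both registers. -/
def pairGate {n : ℕ} (U : Matrix.unitaryGroup (Fin 2 × Fin 2) ℂ) (j : Fin n) : Gate (n + n) :=
  .two (Fin.castAdd n j) (Fin.natAdd n j)
    (fun e => by have := congrArg Fin.val e; simp at this; have := j.2; omega) U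

/-- The gate `U` on the `j`-th qubit of the first register. -/
def leftGate {n : ℕ} (U : Matrix.unitaryGroup (Fin 2) ℂ) (j : Fin n) : Gate (n + n) :=
  .one (Fin.castAdd n j) U

lemma pairGate_op {n : ℕ} (U : Matrix.unitaryGroup (Fin 2 × Fin 2) ℂ) (j : Fin n) :
    (pairGate U j).op = pairOp (Pi.mulSingle j U.1) := by
  ext x y
  rw [pairOp_mulSingle]
  rfl

/-- An operator on the first qubit of a pair. -/
def onFirst (U : Matrix (Fin 2) (Fin 2) ℂ) : Matrix (Fin 2 × Fin 2) (Fin 2 × Fin 2) ℂ :=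
  Matrix.of fun p q => if p.2 = q.2 then U p.1 q.1 else 0

lemma leftGate_op {n : ℕ} (U : Matrix.unitaryGroup (Fin 2) ℂ) (j : Fin n) :
    (leftGate U j).op = pairOp (Pi.mulSingle j (onFirst U.1)) := by
  ext x y
  rw [pairOp_mulSingle]
  simp only [leftGate, Gate.op, Matrix.of_apply, onFirst, pairAt, ← ite_and]
  congr 1
  refine propext ⟨fun h => ⟨fun i h1 _ => h i h1, h _ ?_⟩, fun h i hi => ?_⟩
  · intro e
    have := congrArg Fin.val e
    simp at this
    have := j.2
    omega
  · by_cases h2 : i = Fin.natAdd n j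
    · rw [h2]; exact h.2
    · exact h.1 i hi h2

/-- Gates with different j live on disjoint pairs {j, n + j}, so they can all be executed in a
single layer. -/
lemma pairwise_disjoint_support {n : ℕ} (f : Fin n → Gate (n + n))
    (hf : ∀ j, (f j).support ⊆ {Fin.castAdd n j, Fin.natAdd n j}) {l : List (Fin n)}
    (hl : l.Nodup) : (l.map f).Pairwise fun g h => Disjoint g.support h.support := by
  rw [List.pairwise_map]
  refine hl.imp fun {a b} hab => ?_
  refine Finset.disjoint_of_subset_left (hf a) (Finset.disjoint_of_subset_right (hf b) ?_)
  have hv : (a : ℕ) ≠ b := fun e => hab (Fin.ext e)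
  have := a.2
  have := b.2
  rw [Finset.disjoint_left]
  intro i hi hi'
  simp only [Finset.mem_insert, Finset.mem_singleton] at hi hi'
  rcases hi with rfl | rfl <;> rcases hi' with e | e <;>
    · have := congrArg Fin.val e
      simp at this
      omega

/-- The qubits of a register, last qubit first. -/
def qubitsDesc (n : ℕ) : List (Fin n) := (List.finRange n).reverse

lemma qubitsDesc_nodup (n : ℕ) : (qubitsDesc n).Nodup :=
  List.nodup_reverse.2 (List.nodup_finRange n)

/-- The same two-qubit gate on all pairs. -/
def pairLayer (n : ℕ) (U : Matrix.unitaryGroup (Fin 2 × Fin 2) ℂ) : DepthOne (n + n) :=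
  ⟨(qubitsDesc n).map (pairGate U),
    pairwise_disjoint_support _ (fun _ => subset_rfl) (qubitsDesc_nodup n)⟩

/-- The same gate on all qubits of the first register. -/
def leftLayer (n : ℕ) (U : Matrix.unitaryGroup (Fin 2) ℂ) : DepthOne (n + n) :=
  ⟨(qubitsDesc n).map (leftGate U),
    pairwise_disjoint_support _ (fun j => by simp [leftGate, Gate.support]) (qubitsDesc_nodup n)⟩

lemma list_prod_mulSingle {n : ℕ} {M : Type*} [Monoid M] (U : M) :
    ((qubitsDesc n).map fun j => (Pi.mulSingle j U : Fin n → M)).prod = fun _ => U := by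
  have h : ∀ (l : List (Fin n)), l.Nodup → ∀ j,
      (l.map fun j => (Pi.mulSingle j U : Fin n → M)).prod j = if j ∈ l then U else 1 := by
    intro l
    induction l with
    | nil => simp
    | cons a l ih =>
      intro hl j
      rw [List.map_cons, List.prod_cons, Pi.mul_apply, ih (List.nodup_cons.1 hl).2]
      by_cases hj : j = a
      · subst hj
        simp [(List.nodup_cons.1 hl).1]
      · simp [hj]
  ext j
  rw [h _ (qubitsDesc_nodup n)]
  simp [qubitsDesc]

lemma pairLayer_op (n : ℕ) (U : Matrix.unitaryGroup (Fin 2 × Fin 2) ℂ) :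
    (pairLayer n U).op = pairOp fun _ => U.1 := by
  rw [DepthOne.op, pairLayer, List.map_map]
  refine Eq.trans ?_ ((pairOp_list_prod _ _).trans (congrArg pairOp (list_prod_mulSingle U.1)))
  exact congrArg List.prod (List.map_congr_left fun j _ => pairGate_op U j)

lemma leftLayer_op (n : ℕ) (U : Matrix.unitaryGroup (Fin 2) ℂ) :
    (leftLayer n U).op = pairOp fun _ => onFirst U.1 := by
  rw [DepthOne.op, leftLayer, List.map_map]
  refine Eq.trans ?_
    ((pairOp_list_prod _ _).trans (congrArg pairOp (list_prod_mulSingle (onFirst U.1))))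
  exact congrArg List.prod (List.map_congr_left fun j _ => leftGate_op U j)

/-! ### Bell sampling -/

/-- The circuit that prepares two copies of the state and measures corresponding qubits in the Bell
basis. -/
def bellCircuit (n : ℕ) : Circuit n n :=
  [.oracle, .unitary (pairLayer n swapGate), .oracle, .unitary (pairLayer n cnotGate),
    .unitary (leftLayer n hadamard)]

lemma bellCircuit_calls (n : ℕ) : (bellCircuit n).calls = 2 := rfl

lemma bellCircuit_length (n : ℕ) : (bellCircuit n).length = 5 := rfl

lemma depolarizeAll_zero {m : ℕ} (σ : Op m) : depolarizeAll 0 σ = σ := by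
  rw [depolarizeAll_eq_sum, Finset.sum_eq_single_of_mem (0 : PauliString m) (Finset.mem_univ _)]
  · simp [pauliWeight, PauliString.op_zero]
  · intro Q _ hQ
    obtain ⟨j, hj⟩ := Function.ne_iff.1 hQ
    rw [Finset.prod_eq_zero (Finset.mem_univ j)]
    · simp
    · simpa [pauliWeight] using hj

/-- Exchange of the two registers. -/
def swapBits {n : ℕ} (x : Bits (n + n)) : Bits (n + n) :=
  Fin.append (fun j => x (Fin.natAdd n j)) fun j => x (Fin.castAdd n j)

lemma swapBits_append {n : ℕ} (a b : Bits n) : swapBits (Fin.append a b) = Fin.append b a := by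
  simp [swapBits, -Fin.natAdd_eq_addNat]

lemma pairOp_swap_apply {n : ℕ} (x y : Bits (n + n)) :
    (pairOp fun _ => swapGate.1) x y = if swapBits x = y then 1 else 0 := by
  have h : ∀ j, (pairAt x j = Equiv.prodComm _ _ (pairAt y j)) ↔
      pairAt (swapBits x) j = pairAt y j := by
    intro j
    simp [swapBits, pairAt, Prod.ext_iff, and_comm, -Fin.natAdd_eq_addNat]
  simp only [pairOp, swapGate, permGate, Matrix.of_apply, Finset.prod_ite_zero,
    Finset.prod_const_one, Finset.mem_univ, true_implies, h,
    forall_pairAt_eq_iff]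

/-- After the exchange the state register holds B, so discarding it leaves A in the workspace. In
this way the first copy of ρ survives the second oracle call. -/
lemma traceState_swap_tensor {n : ℕ} (A B : Op n) :
    traceState ((pairOp fun _ => swapGate.1) * tensor A B * (pairOp fun _ => swapGate.1)ᴴ) =
      B.trace • A := by
  have h : ∀ x y, ((pairOp fun _ => swapGate.1) * tensor A B *
      (pairOp fun _ => swapGate.1)ᴴ : Op (n + n)) x y = tensor A B (swapBits x) (swapBits y) := by
    intro x y
    simp [Matrix.mul_apply, pairOp_swap_apply, apply_ite]
  ext a b
  simp only [traceState, Matrix.of_apply, h, swapBits_append, tensor_append, ← Finset.mul_sum,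
    Matrix.smul_apply, smul_eq_mul, Matrix.trace, Matrix.diag_apply]
  rw [mul_comm]

/-- The change to the Bell basis of a pair of qubits. -/
def bellBasis : Matrix (Fin 2 × Fin 2) (Fin 2 × Fin 2) ℂ := onFirst hadamard.1 * cnotGate.1

/-- The workspace initially has trace 1, so the swap and the second call leave exactly ρ ⊗ ρ. The
last two layers compose to the Bell basis change on every pair. -/
lemma bellCircuit_final {n : ℕ} (ρ : Op n) :
    (bellCircuit n).final 0 ρ =
      (pairOp fun _ => bellBasis) * tensor ρ ρ * (pairOp fun _ => bellBasis)ᴴ := by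
  simp only [Circuit.final, bellCircuit, List.foldl_cons, List.foldl_nil, depolarizeAll_zero,
    Layer.apply_unitary, Layer.apply_oracle, pairLayer_op, leftLayer_op]
  rw [traceState_swap_tensor, trace_traceState, (isState_single _).2, one_smul]
  have : (pairOp fun _ : Fin n => bellBasis) =
      (pairOp fun _ => onFirst hadamard.1) * pairOp fun _ => cnotGate.1 := by
    rw [pairOp_mul]; rfl
  rw [this, conjTranspose_mul]
  simp only [Matrix.mul_assoc]

/-- The coefficient of a Pauli matrix at the phase bit of a Bell measurement. -/
def xBit : Fin 4 → ℕ := ![0, 1, 1, 0]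

/-- The coefficient of a Pauli matrix at the parity bit of a Bell measurement. -/
def zBit : Fin 4 → ℕ := ![0, 0, 1, 1]

/-- The eigenvalue of the square of a Pauli matrix at a Bell state. -/
def bellFactor (k : Fin 4) (p : Fin 2 × Fin 2) : ℝ :=
  (-1) ^ (xBit k * (p.1 : ℕ) + zBit k * (p.2 : ℕ) + xBit k * zBit k)

/-- Bell states are common eigenvectors of all P ⊗ P: X ⊗ X sees the phase bit and Z ⊗ Z the parity
bit. The product of the two bits in `bellFactor` accounts for Y ⊗ Y = -(X ⊗ X)(Z ⊗ Z). -/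
lemma bellBasis_conj (k : Fin 4) :
    bellBasisᴴ * Matrix.diagonal (fun p => (bellFactor k p : ℂ)) * bellBasis =
      Matrix.of fun p q => pauli k p.1 q.1 * pauli k p.2 q.2 := by
  have h : ((√2 : ℝ) : ℂ) * ((√2 : ℝ) : ℂ) = 2 := by
    rw [← Complex.ofReal_mul, Real.mul_self_sqrt (by norm_num)]; norm_num
  have h' : (((√2 : ℝ) : ℂ))⁻¹ * ((√2 : ℝ) : ℂ)⁻¹ = 1 / 2 := by
    rw [← mul_inv, h]; norm_num
  have hb : ∀ p q, bellBasis p q = ((√2 : ℝ) : ℂ)⁻¹ *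
      (if p.2 = q.2 + q.1 then (if p.1 = 1 ∧ q.1 = 1 then -1 else 1) else 0) := by
    rintro ⟨a, b⟩ ⟨c, d⟩
    simp only [bellBasis, Matrix.mul_apply, onFirst, cnotGate, permGate, hadamard, Matrix.of_apply,
      Fintype.sum_prod_type, Fin.sum_univ_two, Equiv.coe_fn_mk, Prod.mk.injEq]
    fin_cases a <;> fin_cases b <;> fin_cases c <;> fin_cases d <;> simp
  -- Combining the two factors 1/√2 removes the square root. The remaining identity is a finite
  -- check over 64 entries.
  have hc : ∀ p q, (bellBasisᴴ * Matrix.diagonal (fun p => (bellFactor k p : ℂ)) * bellBasis) p q =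
      1 / 2 * ∑ r, (bellFactor k r : ℂ) *
        ((if r.2 = p.2 + p.1 then (if r.1 = 1 ∧ p.1 = 1 then -1 else 1) else 0) *
         (if r.2 = q.2 + q.1 then (if r.1 = 1 ∧ q.1 = 1 then -1 else 1) else 0)) := by
    intro p q
    rw [Matrix.mul_apply, Finset.mul_sum]
    refine Finset.sum_congr rfl fun r _ => ?_
    rw [Matrix.mul_diagonal, conjTranspose_apply, hb, hb, ← h']
    have hs : ∀ (P Q : Prop) [Decidable P] [Decidable Q],
        star (if P then (if Q then (-1 : ℂ) else 1) else 0) =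
          if P then (if Q then (-1 : ℂ) else 1) else 0 := by
      intro P Q _ _; split_ifs <;> simp
    rw [star_mul', hs]
    simp only [star_inv₀, Complex.star_def, Complex.conj_ofReal]
    ring
  ext ⟨a, b⟩ ⟨c, d⟩
  rw [hc]
  simp only [Fintype.sum_prod_type, Fin.sum_univ_two, Matrix.of_apply]
  fin_cases k <;> fin_cases a <;> fin_cases b <;> fin_cases c <;> fin_cases d <;>
    simp [bellFactor, xBit, zBit, pauli] <;> norm_num

/-- The eigenvalue of `P ⊗ P` at the product of Bell states that is labelled by `s`. -/
def bellSign {n : ℕ} (P : PauliString n) (s : Bits (n + n)) : ℝ :=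
  ∏ j, bellFactor (P j) (pairAt s j)

lemma tensor_mul {n w : ℕ} (A A' : Op n) (B B' : Op w) :
    tensor A B * tensor A' B' = tensor (A * A') (B * B') := by
  ext x y
  simp only [Matrix.mul_apply, tensor, Matrix.of_apply]
  rw [sum_bits_add, Finset.sum_mul_sum]
  simp only [Fin.append_left, Fin.append_right]
  exact Finset.sum_congr rfl fun _ _ => Finset.sum_congr rfl fun _ _ => by ring

lemma pairOp_bellBasis_conj {n : ℕ} (P : PauliString n) :
    (pairOp fun _ => bellBasis)ᴴ * Matrix.diagonal (fun s => (bellSign P s : ℂ)) *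
      (pairOp fun _ => bellBasis) = tensor P.op P.op := by
  have h1 : Matrix.diagonal (fun s => (bellSign P s : ℂ)) =
      pairOp fun j => Matrix.diagonal fun p => (bellFactor (P j) p : ℂ) := by
    ext x y
    simp only [pairOp, Matrix.of_apply, Matrix.diagonal_apply, Finset.prod_ite_zero,
      Finset.mem_univ, true_implies, forall_pairAt_eq_iff, bellSign]
    push_cast
    rfl
  rw [h1, pairOp_conjTranspose, pairOp_mul, pairOp_mul]
  ext x y
  simp only [pairOp, Matrix.of_apply, Pi.mul_apply, bellBasis_conj, Finset.prod_mul_distrib,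
    tensor, PauliString.op, pairAt]

/-- For Hermitian ρ the trace of Pρ is real, so its square is the square of its modulus. -/
lemma PauliString.trace_mul_re {n : ℕ} (P : PauliString n) {ρ : Op n} (hρ : ρ.IsHermitian) :
    ((P.op * ρ).trace * (P.op * ρ).trace).re = ‖(P.op * ρ).trace‖ ^ 2 := by
  have h : star (P.op * ρ).trace = (P.op * ρ).trace := by
    rw [← Matrix.trace_conjTranspose, conjTranspose_mul, hρ.eq, P.op_isHermitian.eq,
      Matrix.trace_mul_comm]
  have h2 : (P.op * ρ).trace * star (P.op * ρ).trace = (‖(P.op * ρ).trace‖ ^ 2 : ℝ) := by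
    rw [Complex.star_def, Complex.mul_conj, Complex.normSq_eq_norm_sq]
  rw [h] at h2
  rw [h2, Complex.ofReal_re]

/-- Bell sampling estimates the squared expectation values of all Pauli operators. -/
theorem sum_outProb_mul_bellSign {n : ℕ} {ρ : Op n} (hρ : IsState ρ) (P : PauliString n) :
    ∑ s, (bellCircuit n).outProb 0 ρ s * bellSign P s = ‖(P.op * ρ).trace‖ ^ 2 := by
  -- The squared expectation is Tr((P ⊗ P)(ρ ⊗ ρ)). Diagonalizing P ⊗ P and cycling the trace
  -- exposes the final state of the circuit, whose diagonal is the outcome distribution.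
  rw [← P.trace_mul_re hρ.1.isHermitian, ← trace_tensor, ← tensor_mul, ← pairOp_bellBasis_conj,
    Matrix.mul_assoc, Matrix.mul_assoc, Matrix.trace_mul_comm, Matrix.mul_assoc, Matrix.mul_assoc,
    ← Matrix.mul_assoc (pairOp fun _ => bellBasis), ← bellCircuit_final ρ, Matrix.trace,
    Complex.re_sum]
  refine Finset.sum_congr rfl fun s _ => ?_
  rw [Matrix.diag_apply, Matrix.diagonal_mul, Complex.re_ofReal_mul, mul_comm]
  rfl

end NISQ
end

/-! ### Repeated sampling and concentration -/

noncomputable section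
namespace NISQ

/-! ### Independent samples -/

/-- The expectation of a function of `m` independent samples. -/
def expect {α : Type*} [Fintype α] (p : α → ℝ) : ℕ → (List α → ℝ) → ℝ
  | 0, f => f []
  | m + 1, f => ∑ s, p s * expect p m fun L => f (s :: L)

section expect

variable {α : Type*} [Fintype α] {p : α → ℝ}

lemma expect_mono (hp : ∀ s, 0 ≤ p s) (m : ℕ) {f g : List α → ℝ}
    (h : ∀ L, L.length = m → f L ≤ g L) : expect p m f ≤ expect p m g := by
  induction m generalizing f g with
  | zero => exact h [] rfl
  | succ m ih =>
    exact Finset.sum_le_sum fun s _ => mul_le_mul_of_nonneg_left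
      (ih fun L hL => h (s :: L) (by simp [hL])) (hp s)

lemma expect_sub (m : ℕ) (f g : List α → ℝ) :
    expect p m (fun L => f L - g L) = expect p m f - expect p m g := by
  induction m generalizing f g with
  | zero => rfl
  | succ m ih => simp only [expect, ih, mul_sub, Finset.sum_sub_distrib]

lemma expect_sum {ι : Type*} (S : Finset ι) (m : ℕ) (f : ι → List α → ℝ) :
    expect p m (fun L => ∑ i ∈ S, f i L) = ∑ i ∈ S, expect p m (f i) := by
  induction m generalizing f with
  | zero => rfl
  | succ m ih =>
    simp only [expect, ih, Finset.mul_sum]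
    rw [Finset.sum_comm]

/-- Independence enters here: the expectation of a product over the samples factorizes. -/
lemma expect_prod (m : ℕ) (g : α → ℝ) :
    expect p m (fun L => (L.map g).prod) = (∑ s, p s * g s) ^ m := by
  have hmul : ∀ (m : ℕ) (c : ℝ) (f : List α → ℝ),
      expect p m (fun L => c * f L) = c * expect p m f := by
    intro m c
    induction m with
    | zero => intro f; rfl
    | succ m ih =>
      intro f
      simp only [expect, ih, Finset.mul_sum]
      exact Finset.sum_congr rfl fun s _ => by ring
  induction m with
  | zero => simp [expect]
  | succ m ih =>
    simp only [expect, List.map_cons, List.prod_cons, hmul, ih, pow_succ', Finset.sum_mul,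
      mul_assoc]

/-- The union bound for events that are bounded by products over the samples. -/
lemma sub_sum_le_expect (hp : ∀ s, 0 ≤ p s) (m : ℕ) {ι : Type*} (S : Finset ι) (g₀ : α → ℝ)
    (g : ι → α → ℝ) {f : List α → ℝ}
    (h : ∀ L, L.length = m → (L.map g₀).prod - ∑ i ∈ S, (L.map (g i)).prod ≤ f L) :
    (∑ s, p s * g₀ s) ^ m - ∑ i ∈ S, (∑ s, p s * g i s) ^ m ≤ expect p m f := by
  simp only [← expect_prod, ← expect_sum, ← expect_sub]
  exact expect_mono hp m h

end expect

/-- The algorithm that runs the circuit `C` `m` times and goes on with the list of outcomes. -/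
def sampleTree {n w : ℕ} {β : Type} (C : Circuit n w) :
    ℕ → (List (Bits (n + w)) → HybridAlg n β) → HybridAlg n β
  | 0, k => k []
  | m + 1, k => .query w C fun s => sampleTree C m fun L => k (s :: L)

section sampleTree

variable {n w : ℕ} {β : Type} (C : Circuit n w)

lemma sampleTree_add (m m' : ℕ) (k : List (Bits (n + w)) → HybridAlg n β) :
    sampleTree C (m + m') k =
      sampleTree C m fun L => sampleTree C m' fun L' => k (L ++ L') := by
  induction m generalizing k with
  | zero => simp [sampleTree]
  | succ m ih => rw [Nat.succ_add]; simp only [sampleTree, ih, List.cons_append]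

lemma sampleTree_congr (m : ℕ) {k k' : List (Bits (n + w)) → HybridAlg n β}
    (h : ∀ L, L.length = m → k L = k' L) : sampleTree C m k = sampleTree C m k' := by
  induction m generalizing k k' with
  | zero => exact h [] rfl
  | succ m ih =>
    simp only [sampleTree]
    congr 1
    funext s
    exact ih fun L hL => h _ (by simp [hL])

lemma sampleTree_prob (lam : ℝ) (ρ : Op n) (E : Set β) (m : ℕ)
    (k : List (Bits (n + w)) → HybridAlg n β) :
    (sampleTree C m k).prob lam ρ E =
      expect (C.outProb lam ρ) m fun L => (k L).prob lam ρ E := by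
  induction m generalizing k with
  | zero => rfl
  | succ m ih => simp only [sampleTree, HybridAlg.prob, expect, ih]

lemma sampleTree_always (q : β → Prop) (m : ℕ) (k : List (Bits (n + w)) → HybridAlg n β)
    (h : ∀ L, L.length = m → (k L).Always q) : (sampleTree C m k).Always q := by
  induction m generalizing k with
  | zero => exact h [] rfl
  | succ m ih => exact fun s => ih _ fun L hL => h _ (by simp [hL])

lemma sampleTree_depthAtMost {d : ℕ} (hd : C.length ≤ d) (m : ℕ)
    (k : List (Bits (n + w)) → HybridAlg n β)
    (h : ∀ L, L.length = m → (k L).DepthAtMost d) : (sampleTree C m k).DepthAtMost d := by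
  induction m generalizing k with
  | zero => exact h [] rfl
  | succ m ih => exact ⟨hd, fun s => ih _ fun L hL => h _ (by simp [hL])⟩

lemma sampleTree_queriesAtMost (m : ℕ) (k : List (Bits (n + w)) → HybridAlg n β)
    (h : ∀ L, L.length = m → (k L).QueriesAtMost 0) :
    (sampleTree C m k).QueriesAtMost (m * C.calls) := by
  induction m generalizing k with
  | zero => rw [Nat.zero_mul]; exact h [] rfl
  | succ m ih =>
    refine ⟨by rw [Nat.succ_mul]; omega, fun s => ?_⟩
    rw [Nat.succ_mul, Nat.add_sub_cancel]
    exact ih _ fun L hL => h _ (by simp [hL])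

end sampleTree

/-! ### Concentration of Bell samples -/

lemma bellFactor_eq_one_or (k : Fin 4) (p : Fin 2 × Fin 2) :
    bellFactor k p = 1 ∨ bellFactor k p = -1 := neg_one_pow_eq_or ℝ _

lemma bellSign_eq_one_or {n : ℕ} (P : PauliString n) (s : Bits (n + n)) :
    bellSign P s = 1 ∨ bellSign P s = -1 := by
  unfold bellSign
  refine Finset.prod_induction _ (fun x : ℝ => x = 1 ∨ x = -1) ?_ (Or.inl rfl)
    fun j _ => bellFactor_eq_one_or _ _
  rintro a b (rfl | rfl) (rfl | rfl) <;> simp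

/-- The factor 2 · 4^n counts Pauli strings with a sign. It is at most 8^n for n ≥ 1, so it suffices
to have q^C below δ/8. -/
lemma exists_pow_bound {q δ : ℝ} (hq0 : 0 ≤ q) (hq1 : q < 1) (hδ : 0 < δ) :
    ∃ C : ℕ, 1 ≤ C ∧ ∀ n : ℕ, 1 ≤ n → 2 * 4 ^ n * q ^ (C * n) ≤ δ ^ n := by
  obtain ⟨C, hC⟩ := exists_pow_lt_of_lt_one (show 0 < δ / 8 by positivity) hq1
  -- Passing to C + 1 makes the number of samples positive, so that one can divide by it later.
  replace hC : q ^ (C + 1) < δ / 8 := (pow_le_pow_of_le_one hq0 hq1.le (Nat.le_succ C)).trans_lt hC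
  refine ⟨C + 1, by omega, fun n hn => ?_⟩
  have h2 : (2 : ℝ) * 4 ^ n ≤ 8 ^ n := by
    have : (8 : ℝ) ^ n = 2 ^ n * 4 ^ n := by rw [← mul_pow]; norm_num
    rw [this]
    gcongr
    exact le_self_pow₀ (by norm_num) (by omega)
  calc 2 * 4 ^ n * q ^ ((C + 1) * n) ≤ 8 ^ n * (q ^ (C + 1)) ^ n := by
        rw [pow_mul]
        exact mul_le_mul_of_nonneg_right h2 (by positivity)
    _ = (8 * q ^ (C + 1)) ^ n := by rw [mul_pow]
    _ ≤ δ ^ n := by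
        refine pow_le_pow_left₀ (by positivity) ?_ n
        linarith

/-- Expectation values of Pauli operators have modulus at most one. -/
lemma norm_trace_pauli_mul_le_one {n : ℕ} {ρ : Op n} (hρ : IsState ρ) (P : PauliString n) :
    ‖(P.op * ρ).trace‖ ≤ 1 := by
  have hp : ∀ s, 0 ≤ (bellCircuit n).outProb 0 ρ s :=
    (bellCircuit n).outProb_nonneg le_rfl zero_le_one hρ
  rw [← sq_le_one_iff₀ (norm_nonneg _), ← sum_outProb_mul_bellSign hρ,
    ← (bellCircuit n).sum_outProb le_rfl zero_le_one hρ]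
  refine Finset.sum_le_sum fun s _ => mul_le_of_le_one_right (hp s) ?_
  rcases bellSign_eq_one_or P s with h | h <;> rw [h]
  norm_num

lemma card_pauliString (n : ℕ) : Fintype.card (PauliString n) = 4 ^ n := by simp

/-- All empirical means of the Bell signs are accurate with high probability. -/
lemma le_expect_of_accurate {n : ℕ} {ρ : Op n} (hρ : IsState ρ) {ε : ℝ} (hε : 0 < ε) (hε1 : ε ≤ 1)
    (m : ℕ) {f : List (Bits (n + n)) → ℝ} (hf0 : ∀ L, 0 ≤ f L)
    (hf1 : ∀ L, L.length = m →
      (∀ P : PauliString n, |(L.map (bellSign P)).sum - m * ‖(P.op * ρ).trace‖ ^ 2| ≤ m * ε) →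
      1 ≤ f L) :
    1 - 2 * 4 ^ n * Real.exp (-(ε ^ 2 / 16)) ^ m ≤
      expect ((bellCircuit n).outProb 0 ρ) m f := by
  set p := (bellCircuit n).outProb 0 ρ with hpdef
  have hp : ∀ s, 0 ≤ p s := (bellCircuit n).outProb_nonneg le_rfl zero_le_one hρ
  have hp1 : ∑ s, p s = 1 := (bellCircuit n).sum_outProb le_rfl zero_le_one hρ
  set μ : PauliString n → ℝ := fun P => ‖(P.op * ρ).trace‖ ^ 2 with hμdef
  have hμ : ∀ P, ∑ s, p s * bellSign P s = μ P := fun P => sum_outProb_mul_bellSign hρ P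
  have hμ1 : ∀ P, |μ P| ≤ 1 := fun P => by
    rw [abs_of_nonneg (by positivity)]
    exact pow_le_one₀ (norm_nonneg _) (norm_trace_pauli_mul_le_one hρ P)
  -- With this choice -tε + 4t² equals -ε²/16. It also keeps t times a deviation of at most 2 within
  -- the range of the quadratic bound on exp.
  set t : ℝ := ε / 8 with ht
  have ht0 : 0 < t := by positivity
  -- The Boolean selects the direction of the deviation. The product of these factors over the
  -- samples is at least 1 whenever the deviation of the sum in that direction reaches m ε.
  let g : PauliString n × Bool → Bits (n + n) → ℝ := fun i s =>
    Real.exp (t * ((if i.2 then 1 else -1) * (bellSign i.1 s - μ i.1) - ε))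
  have hexp : ∀ x : ℝ, |x| ≤ 1 → Real.exp x ≤ 1 + x + x ^ 2 := by
    intro x hx
    have := (abs_le.1 (Real.abs_exp_sub_one_sub_id_le hx)).2
    linarith
  -- Chernoff: after the quadratic bound on exp the linear term averages to zero, and the square of
  -- a deviation is at most 4.
  have hE : ∀ i, ∑ s, p s * g i s ≤ Real.exp (-(ε ^ 2 / 16)) := by
    intro i
    set c : ℝ := if i.2 then 1 else -1 with hc
    have hc2 : c ^ 2 = 1 := by rw [hc]; split <;> norm_num
    have hc1 : |c| = 1 := by rw [hc]; split <;> norm_num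
    have h1 : ∀ s, g i s ≤ Real.exp (-(t * ε)) *
        (1 + t * c * (bellSign i.1 s - μ i.1) + 4 * t ^ 2) := by
      intro s
      have : g i s = Real.exp (-(t * ε)) * Real.exp (t * c * (bellSign i.1 s - μ i.1)) := by
        rw [← Real.exp_add]
        simp only [g, ← hc]
        congr 1
        ring
      rw [this]
      refine mul_le_mul_of_nonneg_left ?_ (Real.exp_pos _).le
      have hd : |bellSign i.1 s - μ i.1| ≤ 2 := by
        have h1 : |bellSign i.1 s| ≤ 1 := by
          rcases bellSign_eq_one_or i.1 s with h | h <;> simp [h]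
        linarith [abs_sub (bellSign i.1 s) (μ i.1), hμ1 i.1]
      refine (hexp _ ?_).trans ?_
      · rw [abs_mul, abs_mul, hc1, abs_of_pos ht0]
        nlinarith [abs_nonneg (bellSign i.1 s - μ i.1)]
      · have hd2 : (bellSign i.1 s - μ i.1) ^ 2 ≤ 4 := by
          rw [← sq_abs]; nlinarith [abs_nonneg (bellSign i.1 s - μ i.1)]
        rw [mul_pow, mul_pow, hc2]
        nlinarith [sq_nonneg t]
    calc ∑ s, p s * g i s ≤ ∑ s, p s * (Real.exp (-(t * ε)) *
          (1 + t * c * (bellSign i.1 s - μ i.1) + 4 * t ^ 2)) :=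
          Finset.sum_le_sum fun s _ => mul_le_mul_of_nonneg_left (h1 s) (hp s)
      _ = Real.exp (-(t * ε)) * ∑ s, (p s * (1 + 4 * t ^ 2 - t * c * μ i.1) +
            t * c * (p s * bellSign i.1 s)) := by
          rw [Finset.mul_sum]
          exact Finset.sum_congr rfl fun s _ => by ring
      _ = Real.exp (-(t * ε)) * (1 + 4 * t ^ 2) := by
          rw [Finset.sum_add_distrib, ← Finset.sum_mul, ← Finset.mul_sum, hp1, hμ]
          ring
      _ ≤ Real.exp (-(t * ε)) * Real.exp (4 * t ^ 2) := by
          refine mul_le_mul_of_nonneg_left ?_ (Real.exp_pos _).le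
          linarith [Real.add_one_le_exp (4 * t ^ 2)]
      _ = Real.exp (-(ε ^ 2 / 16)) := by
          rw [← Real.exp_add]
          congr 1
          rw [ht]; ring
  have hprod : ∀ (L : List (Bits (n + n))) i, (L.map (g i)).prod =
      Real.exp (t * ((if i.2 then 1 else -1) * ((L.map (bellSign i.1)).sum - L.length * μ i.1) -
        L.length * ε)) := by
    intro L i
    induction L with
    | nil => simp
    | cons s L ih =>
      rw [List.map_cons, List.prod_cons, ih, ← Real.exp_add]
      congr 1
      rw [List.map_cons, List.sum_cons, List.length_cons]
      push_cast
      ring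
  have hmain := sub_sum_le_expect (p := p) hp m Finset.univ (fun _ => 1) g (f := f) (by
    intro L hL
    simp only [List.map_const', List.prod_replicate, one_pow]
    by_cases hgood : ∀ P : PauliString n,
        |(L.map (bellSign P)).sum - m * ‖(P.op * ρ).trace‖ ^ 2| ≤ m * ε
    · refine le_trans ?_ (hf1 L hL hgood)
      have : 0 ≤ ∑ i, (L.map (g i)).prod := Finset.sum_nonneg fun i _ => by
        rw [hprod]; exact (Real.exp_pos _).le
      linarith
    · refine le_trans ?_ (hf0 L)
      push Not at hgood
      obtain ⟨P, hP⟩ := hgood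
      have key : ∃ i, 1 ≤ (L.map (g i)).prod := by
        rcases lt_abs.1 hP with h | h
        · refine ⟨(P, true), ?_⟩
          rw [hprod, Real.one_le_exp_iff, hL]
          refine mul_nonneg ht0.le ?_
          simp only [if_true, one_mul, hμdef]
          linarith
        · refine ⟨(P, false), ?_⟩
          rw [hprod, Real.one_le_exp_iff, hL]
          refine mul_nonneg ht0.le ?_
          simp only [Bool.false_eq_true, if_false, hμdef]
          linarith
      obtain ⟨i, hi⟩ := key
      have := Finset.single_le_sum (f := fun i => (L.map (g i)).prod) (s := Finset.univ)
        (fun i _ => by rw [hprod]; exact (Real.exp_pos _).le) (Finset.mem_univ i)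
      linarith)
  simp only [mul_one, hp1, one_pow] at hmain
  refine le_trans ?_ hmain
  have hsum : ∑ i, (∑ s, p s * g i s) ^ m ≤
      ∑ i : PauliString n × Bool, Real.exp (-(ε ^ 2 / 16)) ^ m :=
    Finset.sum_le_sum fun i _ => pow_le_pow_left₀
      (Finset.sum_nonneg fun s _ => mul_nonneg (hp s) (Real.exp_pos _).le) (hE i) m
  rw [Finset.sum_const, Finset.card_univ, Fintype.card_prod, card_pauliString, Fintype.card_bool,
    nsmul_eq_mul] at hsum
  push_cast at hsum
  linarith

/-- The signs of Bell samples of `pauliState s P` determine `s` and `P` with high probability. -/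
lemma le_expect_of_determined {n : ℕ} (s : Fin 2) {P : PauliString n} (hP : P ≠ 0) (m : ℕ)
    {f : List (Bits (n + n)) → ℝ} (hf0 : ∀ L, 0 ≤ f L)
    (hf1 : ∀ L, L.length = m → (s = 1 → ∀ x ∈ L, bellSign P x = 1) →
      (∀ (Q : PauliString n) (e : ℕ), (∀ x ∈ L, bellSign Q x = (-1) ^ e) →
        Even e ∧ (Q = 0 ∨ s = 1 ∧ Q = P)) → 1 ≤ f L) :
    1 - 2 * 4 ^ n * (1 / 2) ^ m ≤ expect ((bellCircuit n).outProb 0 (pauliState s P)) m f := by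
  have hρ := isState_pauliState s hP
  set p := (bellCircuit n).outProb 0 (pauliState s P) with hpdef
  have hp : ∀ x, 0 ≤ p x := (bellCircuit n).outProb_nonneg le_rfl zero_le_one hρ
  have hp1 : ∑ x, p x = 1 := (bellCircuit n).sum_outProb le_rfl zero_le_one hρ
  -- This is the indicator of one of the two signs, written as an affine function of the sign so
  -- that its mean follows from the squared expectation value.
  let g : PauliString n × Bool → Bits (n + n) → ℝ := fun i x =>
    (1 + (if i.2 then -1 else 1) * bellSign i.1 x) / 2
  have hg0 : ∀ i x, 0 ≤ g i x := by
    intro i x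
    simp only [g]
    rcases bellSign_eq_one_or i.1 x with h | h <;> rw [h] <;> split <;> norm_num
  have hg : ∀ i x, g i x = if bellSign i.1 x = (if i.2 then -1 else 1) then 1 else 0 := by
    intro i x
    simp only [g]
    rcases bellSign_eq_one_or i.1 x with h | h <;> rw [h] <;> cases i.2 <;> norm_num
  have hprod : ∀ (L : List (Bits (n + n))) i, (L.map (g i)).prod =
      if ∀ x ∈ L, bellSign i.1 x = (if i.2 then -1 else 1) then 1 else 0 := by
    intro L i
    induction L with
    | nil => simp
    | cons x L ih =>
      rw [List.map_cons, List.prod_cons, ih, hg]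
      simp only [List.mem_cons, forall_eq_or_imp, ite_and, ite_mul, one_mul, zero_mul]
  have hE : ∀ i, ∑ x, p x * g i x =
      (1 + (if i.2 then -1 else 1) * ‖(i.1.op * pauliState s P).trace‖ ^ 2) / 2 := by
    intro i
    rw [← sum_outProb_mul_bellSign hρ]
    calc ∑ x, p x * g i x = ∑ x, (p x * (1 / 2) +
          (if i.2 then -1 else 1) / 2 * (p x * bellSign i.1 x)) :=
          Finset.sum_congr rfl fun x _ => by simp only [g]; ring
      _ = _ := by
          rw [Finset.sum_add_distrib, ← Finset.sum_mul, ← Finset.mul_sum, hp1]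
          ring
  -- A string whose sign is almost surely 1: P if s = 1, and the identity otherwise. Its product of
  -- indicators has mean 1 and serves as the leading term of the union bound.
  let R : PauliString n := if s = 1 then P else 0
  have hexp : ∀ Q : PauliString n, ‖(Q.op * pauliState s P).trace‖ ^ 2 =
      if Q = 0 ∨ s = 1 ∧ Q = P then 1 else 0 := by
    intro Q
    by_cases hQ : Q = 0
    · subst hQ
      rw [PauliString.op_zero, one_mul, hρ.2]
      simp
    · rw [op_mul_pauliState_trace s P Q hQ]
      simp only [hQ, false_or]
      split <;> simp
  have hR : R = 0 ∨ s = 1 ∧ R = P := by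
    by_cases h : s = 1 <;> simp [R, h]
  -- The sign patterns that must not be constant on the samples: all except sign +1 for the identity
  -- and, if s = 1, for P. Per sample, each has probability 0 or 1/2.
  let S : Finset (PauliString n × Bool) :=
    Finset.univ.filter fun i => ¬ ((i.1 = 0 ∨ s = 1 ∧ i.1 = P) ∧ i.2 = false)
  have hmain := sub_sum_le_expect (p := p) hp m S (g (R, false)) g (f := f) (by
    intro L hL
    have hnn : ∀ i, 0 ≤ (L.map (g i)).prod := by
      intro i; rw [hprod]; split_ifs <;> norm_num
    have hS0 : 0 ≤ ∑ i ∈ S, (L.map (g i)).prod := Finset.sum_nonneg fun i _ => hnn i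
    have h1 : (L.map (g (R, false))).prod ≤ 1 := by
      rw [hprod]; split_ifs <;> norm_num
    by_cases hbad : ∃ i ∈ S, ∀ x ∈ L, bellSign i.1 x = (if i.2 then -1 else 1)
    · obtain ⟨i, hi, hx⟩ := hbad
      have h2 := Finset.single_le_sum (f := fun i => (L.map (g i)).prod) (fun i _ => hnn i) hi
      rw [hprod L i, if_pos hx] at h2
      linarith [hf0 L]
    · by_cases hRL : ∀ x ∈ L, bellSign R x = 1
      · have : 1 ≤ f L := by
          refine hf1 L hL (fun hs => by simpa [R, hs] using hRL) fun Q e hQ => ?_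
          push Not at hbad
          rcases Nat.even_or_odd e with he | he
          · refine ⟨he, ?_⟩
            by_contra hcon
            obtain ⟨x, hx, hne⟩ := hbad (Q, false) (by simp [S, hcon])
            rw [hQ x hx, he.neg_one_pow] at hne
            simp at hne
          · obtain ⟨x, hx, hne⟩ := hbad (Q, true) (by simp [S])
            rw [hQ x hx, he.neg_one_pow] at hne
            simp at hne
        linarith
      · rw [hprod L (R, false), if_neg (by simpa using hRL)]
        linarith [hf0 L])
  refine le_trans ?_ hmain
  have hlead : ∑ x, p x * g (R, false) x = 1 := by
    rw [hE, hexp, if_pos hR]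
    norm_num
  rw [hlead, one_pow]
  have hsum : ∑ i ∈ S, (∑ x, p x * g i x) ^ m ≤
      ∑ i : PauliString n × Bool, (1 / 2 : ℝ) ^ m := by
    refine (Finset.sum_le_sum (g := fun _ => (1 / 2 : ℝ) ^ m) fun i hi => ?_).trans
      (Finset.sum_le_sum_of_subset_of_nonneg (Finset.subset_univ _) fun _ _ _ => by positivity)
    refine pow_le_pow_left₀
      (Finset.sum_nonneg fun x _ => mul_nonneg (hp x) (hg0 i x)) ?_ m
    rw [hE, hexp]
    have hi' := (Finset.mem_filter.1 hi).2
    by_cases h1 : i.1 = 0 ∨ s = 1 ∧ i.1 = P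
    · have h2 : i.2 = true := by
        by_contra h; exact hi' ⟨h1, by simpa using h⟩
      rw [if_pos h1, h2]
      norm_num
    · rw [if_neg h1]
      norm_num
  rw [Finset.sum_const, Finset.card_univ, Fintype.card_prod, card_pauliString, Fintype.card_bool,
    nsmul_eq_mul] at hsum
  push_cast at hsum
  linarith

end NISQ
end

/-! ### Reasoning about programs of the machine -/

noncomputable section
namespace NISQ

/-! ### A program logic -/

/-- Started in the memory `M`, the programs `l` run without coins and circuits, take at most `b`
steps, and leave a memory that satisfies `Q`. -/
def Terminates (n : ℕ) (l : List Prog) (b : ℕ) (M : Memory) (Q : Memory → Prop) : Prop :=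
  ∀ t, b ≤ t → ∃ M' t', t ≤ t' + b ∧ Q M' ∧ ∀ K, run n t (l ++ K) M = run n t' K M'

/-- Started in the memory `M`, the programs `l` run the circuit `C` exactly `m` times and take at
most `b` steps, and then the outcomes and the memory satisfy `Q`. -/
def Samples (n : ℕ) {w : ℕ} (C : Circuit n w) (m : ℕ) (l : List Prog) (b : ℕ) (M : Memory)
    (Q : List (Bits (n + w)) → Memory → Prop) : Prop :=
  ∀ t, b ≤ t → ∀ K, ∃ k, run n t (l ++ K) M = sampleTree C m k ∧
    ∀ L, L.length = m → ∃ M' t', t ≤ t' + b ∧ Q L M' ∧ k L = run n t' K M'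

/-- `choose!` needs default values for lists of outcomes of the wrong length. -/
instance : Nonempty Memory := ⟨Memory.init 0⟩

instance {n : ℕ} : Nonempty (HybridAlg n (Option Memory)) := ⟨.output none⟩

section logic

variable {n : ℕ} {l l' K : List Prog} {b b' : ℕ} {M : Memory} {Q R : Memory → Prop}

lemma Terminates.mono (h : Terminates n l b M Q) (hb : b ≤ b') (hQ : ∀ M', Q M' → R M') :
    Terminates n l b' M R := by
  intro t ht
  obtain ⟨M', t', h1, h2, h3⟩ := h t (hb.trans ht)
  exact ⟨M', t', by omega, hQ _ h2, h3⟩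

lemma Terminates.nil (h : Q M) : Terminates n [] b M Q :=
  fun t _ => ⟨M, t, by omega, h, fun K => rfl⟩

lemma Terminates.append (h : Terminates n l b M R)
    (h' : ∀ M', R M' → Terminates n l' b' M' Q) : Terminates n (l ++ l') (b + b') M Q := by
  intro t ht
  obtain ⟨M₁, t₁, h1, h2, h3⟩ := h t (by omega)
  obtain ⟨M₂, t₂, h4, h5, h6⟩ := h' M₁ h2 t₁ (by omega)
  exact ⟨M₂, t₂, by omega, h5, fun K => by rw [List.append_assoc, h3, h6]⟩

lemma Terminates.cons {p : Prog} (h : Terminates n [p] b M R)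
    (h' : ∀ M', R M' → Terminates n l' b' M' Q) : Terminates n (p :: l') (b + b') M Q :=
  Terminates.append (l := [p]) h h'

/-- One unfolding of `run` costs one unit and replaces the head by l₁. The rules for sequencing,
branching and loops are instances of this. -/
lemma Terminates.of_run {p : Prog} {l₁ : List Prog} {M₁ : Memory}
    (hrun : ∀ t K, run n (t + 1) (p :: K) M = run n t (l₁ ++ K) M₁)
    (h : Terminates n (l₁ ++ l) b M₁ Q) : Terminates n (p :: l) (b + 1) M Q := by
  intro t ht
  obtain ⟨t, rfl⟩ : ∃ t₀, t = t₀ + 1 := ⟨t - 1, by omega⟩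
  obtain ⟨M', t', h1, h2, h3⟩ := h t (by omega)
  refine ⟨M', t', by omega, h2, fun K => ?_⟩
  rw [List.cons_append, hrun, ← List.append_assoc, h3]

lemma Terminates.seq {p q : Prog} (h : Terminates n (p :: q :: l) b M Q) :
    Terminates n (.seq p q :: l) (b + 1) M Q :=
  Terminates.of_run (l₁ := [p, q]) (fun t K => by rw [run]; rfl) h

/-- The invariant `I i` holds after `i` rounds of a loop that is controlled by the variable `x`. -/
lemma Terminates.loop {x : ℕ} {p : Prog} (k : ℕ) (I : ℕ → Memory → Prop) (h0 : I 0 M)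
    (hx : ∀ i M', I i M' → M'.var x = k - i)
    (hp : ∀ i M', i < k → I i M' → Terminates n [p] b M' (I (i + 1))) :
    Terminates n [.while x p] (k * (b + 1) + 1) M (I k) := by
  -- The induction is on the number j of remaining rounds, while the invariant counts the rounds
  -- already done.
  have h : ∀ j i M', i + j = k → I i M' →
      Terminates n [.while x p] (j * (b + 1) + 1) M' (I k) := by
    intro j
    induction j with
    | zero =>
      intro i M' hij hI
      rw [Nat.zero_mul]
      refine Terminates.of_run (l₁ := []) (M₁ := M') (fun t K => ?_) (Terminates.nil ?_)
      · rw [run, if_neg (by rw [hx i M' hI]; omega)]; rfl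
      · rwa [← hij, Nat.add_zero]
    | succ j ih =>
      intro i M' hij hI
      refine Terminates.of_run (l₁ := [p, .while x p]) (M₁ := M') (fun t K => ?_) ?_
      · rw [run, if_pos (by rw [hx i M' hI]; omega)]; rfl
      · refine Terminates.mono (Terminates.cons (hp i M' (by omega) hI) fun M'' h'' =>
          ih (i + 1) M'' (by omega) h'') ?_ fun _ h => h
        rw [Nat.succ_mul]; omega
  exact h k 0 M (Nat.zero_add k) h0

/-- The effect of programs without loops, coins, circuits. -/
def Prog.eval : Prog → Memory → Memory
  | .const x c, M => M.setVar x c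
  | .add x y z, M => M.setVar x (M.var y + M.var z)
  | .sub x y z, M => M.setVar x (M.var y - M.var z)
  | .load x A y, M => M.setVar x (M.arr A (M.var y))
  | .store A y x, M => M.setArr A (Function.update (M.arr A) (M.var y) (M.var x))
  | .newLayer, M => { M with tape := .gates [] :: M.tape }
  | .oracleLayer, M => { M with tape := .oracle :: M.tape }
  | .gateH y, M => M.addGate (.H (M.var y))
  | .gateT y, M => M.addGate (.T (M.var y))
  | .gateCNOT y z, M => M.addGate (.CNOT (M.var y) (M.var z))
  | .gateSWAP y z, M => M.addGate (.SWAP (M.var y) (M.var z))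
  | .seq p q, M => q.eval (p.eval M)
  | .ite x p q, M => if M.var x ≠ 0 then p.eval M else q.eval M
  | _, M => M

/-- Programs without loops, coins, circuits. -/
def Prog.IsStraight : Prog → Prop
  | .coin _ => False
  | .runCircuit _ _ => False
  | .while _ _ => False
  | .seq p q => p.IsStraight ∧ q.IsStraight
  | .ite _ p q => p.IsStraight ∧ q.IsStraight
  | _ => True

/-- A bound on the running time of a program without loops. -/
def Prog.cost : Prog → ℕ
  | .seq p q => p.cost + q.cost + 1
  | .ite _ p q => p.cost + q.cost + 1
  | _ => 1

lemma Terminates.eval {p : Prog} (hp : p.IsStraight) (M : Memory) :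
    Terminates n [p] p.cost M fun M' => M' = p.eval M := by
  induction p generalizing M with
  | seq p q ihp ihq =>
    exact Terminates.seq (Terminates.cons (ihp hp.1 M) fun M' h => h ▸ ihq hp.2 M')
  | ite x p q ihp ihq =>
    refine Terminates.of_run (l₁ := [if M.var x ≠ 0 then p else q]) (M₁ := M)
      (fun t K => by rw [run]; rfl) ?_
    by_cases hx : M.var x ≠ 0
    · rw [if_pos hx]
      refine (ihp hp.1 M).mono (Nat.le_add_right _ _) fun M' h => ?_
      rw [h, Prog.eval, if_pos hx]
    · rw [if_neg hx]
      refine (ihq hp.2 M).mono (Nat.le_add_left _ _) fun M' h => ?_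
      rw [h, Prog.eval, if_neg hx]
  | coin => exact hp.elim
  | runCircuit => exact hp.elim
  | _ =>
    first | exact hp.elim |
    exact Terminates.of_run (b := 0) (l₁ := []) (fun t K => by rw [run]; rfl) (Terminates.nil rfl)

lemma Terminates.straight {p : Prog} (hp : p.IsStraight) (h : Q (p.eval M)) :
    Terminates n [p] p.cost M Q :=
  (Terminates.eval hp M).mono le_rfl fun _ e => e ▸ h

lemma Terminates.straight_cons {p : Prog} (hp : p.IsStraight)
    (h : Terminates n l b (p.eval M) Q) : Terminates n (p :: l) (p.cost + b) M Q :=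
  (Terminates.eval hp M).cons fun _ e => e ▸ h

lemma Terminates.exists_run_eq (h : Terminates n l b M Q) {t : ℕ} (ht : b ≤ t) :
    ∃ M', run n t l M = .output (some M') ∧ Q M' := by
  obtain ⟨M', t', _, h2, h3⟩ := h t ht
  refine ⟨M', ?_, h2⟩
  have := h3 []
  rw [List.append_nil] at this
  rw [this, run]

variable {w : ℕ} {C : Circuit n w} {m m' : ℕ} {S T : List (Bits (n + w)) → Memory → Prop}

lemma Samples.mono (h : Samples n C m l b M S) (hb : b ≤ b')
    (hS : ∀ L M', L.length = m → S L M' → T L M') : Samples n C m l b' M T := by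
  intro t ht K
  obtain ⟨k, h1, h2⟩ := h t (hb.trans ht) K
  refine ⟨k, h1, fun L hL => ?_⟩
  obtain ⟨M', t', h3, h4, h5⟩ := h2 L hL
  exact ⟨M', t', by omega, hS _ _ hL h4, h5⟩

lemma Terminates.samples (h : Terminates n l b M (S [])) : Samples n C 0 l b M S := by
  intro t ht K
  obtain ⟨M', t', h1, h2, h3⟩ := h t ht
  refine ⟨fun _ => run n t (l ++ K) M, rfl, fun L hL => ⟨M', t', h1, ?_, h3 K⟩⟩
  rwa [List.length_eq_zero_iff.1 hL]

/-- Memory and remaining time after the first part depend on its outcomes, so a continuation has to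
be chosen for each list of outcomes. -/
lemma Samples.append (h : Samples n C m l b M T)
    (h' : ∀ L M', L.length = m → T L M' → Samples n C m' l' b' M' fun L' => S (L ++ L')) :
    Samples n C (m + m') (l ++ l') (b + b') M S := by
  intro t ht K
  obtain ⟨k, h1, h2⟩ := h t (by omega) (l' ++ K)
  choose! M₁ t₁ h3 h4 h5 using h2
  have h6 : ∀ L, L.length = m → ∃ k', k L = sampleTree C m' k' ∧ ∀ L', L'.length = m' →
      ∃ M' t', t ≤ t' + (b + b') ∧ S (L ++ L') M' ∧ k' L' = run n t' K M' := by
    intro L hL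
    have h7 := h3 L hL
    obtain ⟨k', h8, h9⟩ := h' L _ hL (h4 L hL) (t₁ L) (by omega) K
    refine ⟨k', by rw [h5 L hL, h8], fun L' hL' => ?_⟩
    obtain ⟨M', t', h10, h11, h12⟩ := h9 L' hL'
    exact ⟨M', t', by omega, h11, h12⟩
  choose! k' h7 h8 using h6
  -- The outcomes of the two parts are recovered from the joint list by cutting it after m entries.
  refine ⟨fun L => k' (L.take m) (L.drop m), ?_, fun L hL => ?_⟩
  · rw [List.append_assoc, h1, sampleTree_add]
    refine sampleTree_congr C m fun L hL => ?_
    rw [h7 L hL]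
    exact sampleTree_congr C m' fun L' _ => by simp [← hL]
  · obtain ⟨M', t', h9, h10, h11⟩ :=
      h8 (L.take m) (by simp [hL]) (L.drop m) (by simp [hL])
    exact ⟨M', t', h9, by rwa [List.take_append_drop] at h10, h11⟩

lemma Samples.cons {p : Prog} (h : Samples n C m [p] b M T)
    (h' : ∀ L M', L.length = m → T L M' → Samples n C m' l' b' M' fun L' => S (L ++ L')) :
    Samples n C (m + m') (p :: l') (b + b') M S :=
  Samples.append (l := [p]) h h'

lemma Terminates.append_samples (h : Terminates n l b M Q)
    (h' : ∀ M', Q M' → Samples n C m l' b' M' S) : Samples n C m (l ++ l') (b + b') M S := by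
  have := Samples.append (C := C) (m := 0) (T := fun _ => Q) (S := S) h.samples
    fun L M' hL hM => by
      rw [List.length_eq_zero_iff.1 hL]
      exact h' M' hM
  rwa [Nat.zero_add] at this

lemma Samples.append_terminates (h : Samples n C m l b M T)
    (h' : ∀ L M', L.length = m → T L M' → Terminates n l' b' M' (S L)) :
    Samples n C m (l ++ l') (b + b') M S :=
  Samples.append (m' := 0) h fun L M' hL hM =>
    Terminates.samples (by simpa using h' L M' hL hM)

lemma Samples.of_run {p : Prog} {l₁ : List Prog} {M₁ : Memory}
    (hrun : ∀ t K, run n (t + 1) (p :: K) M = run n t (l₁ ++ K) M₁)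
    (h : Samples n C m (l₁ ++ l) b M₁ S) : Samples n C m (p :: l) (b + 1) M S := by
  intro t ht K
  obtain ⟨t, rfl⟩ : ∃ t₀, t = t₀ + 1 := ⟨t - 1, by omega⟩
  obtain ⟨k, h1, h2⟩ := h t (by omega) K
  refine ⟨k, ?_, fun L hL => ?_⟩
  · rw [List.cons_append, hrun, ← List.append_assoc, h1]
  · obtain ⟨M', t', h3, h4⟩ := h2 L hL
    exact ⟨M', t', by omega, h4⟩

lemma Samples.seq {p q : Prog} (h : Samples n C m (p :: q :: l) b M S) :
    Samples n C m (.seq p q :: l) (b + 1) M S :=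
  Samples.of_run (l₁ := [p, q]) (fun t K => by rw [run]; rfl) h

/-- A loop with one sample in each round. -/
lemma Samples.loop {x : ℕ} {p : Prog} (k : ℕ)
    (I : List (Bits (n + w)) → Memory → Prop) (h0 : I [] M)
    (hx : ∀ L M', I L M' → M'.var x = k - L.length)
    (hp : ∀ L M', L.length < k → I L M' → Samples n C 1 [p] b M' fun L' => I (L ++ L')) :
    Samples n C k [.while x p] (k * (b + 1) + 1) M I := by
  have h : ∀ j L M', L.length + j = k → I L M' →
      Samples n C j [.while x p] (j * (b + 1) + 1) M' fun L' => I (L ++ L') := by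
    intro j
    induction j with
    | zero =>
      intro L M' hj hI
      rw [Nat.zero_mul]
      refine Samples.of_run (l₁ := []) (M₁ := M') (fun t K => ?_)
        (Terminates.samples (Terminates.nil (by rwa [List.append_nil])))
      rw [run, if_neg (by rw [hx L M' hI]; omega)]; rfl
    | succ j ih =>
      intro L M' hj hI
      refine Samples.of_run (l₁ := [p, .while x p]) (M₁ := M') (fun t K => ?_) ?_
      · rw [run, if_pos (by rw [hx L M' hI]; omega)]; rfl
      · rw [Nat.add_comm j 1]
        refine Samples.mono (Samples.cons (hp L M' (by omega) hI) fun L₁ M'' hL₁ h'' => ?_)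
          (le_refl (b + (j * (b + 1) + 1)) |>.trans ?_) fun _ _ _ h => h
        · refine (ih (L ++ L₁) M'' ?_ h'').mono le_rfl fun L₂ _ _ h => ?_
          · rw [List.length_append, hL₁]; omega
          · rwa [List.append_assoc] at h
        · rw [Nat.add_mul]; omega
  exact h k [] M (Nat.zero_add k) h0

lemma Samples.runCircuit {y A : ℕ} (hw : M.var y = w)
    (hC : M.tape.reverse.mapM (RawLayer.decode n w) = some C) :
    Samples n C 1 [.runCircuit y A] ((n + w) * (C.length + 1) + 1) M
      fun L M' => ∀ s, L = [s] → M' = { M.setArr A (padZero s) with tape := [] } := by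
  intro t ht K
  obtain ⟨t, rfl⟩ : ∃ t₀, t = t₀ + 1 := ⟨t - 1, by omega⟩
  subst hw
  -- The default output belongs to the empty list and is never reached, since exactly one sample is
  -- taken.
  refine ⟨fun L => L.head?.elim (.output none) fun s => run n (t - (n + M.var y) * (C.length + 1))
    K { M.setArr A (padZero s) with tape := [] }, ?_, fun L hL => ?_⟩
  · rw [List.singleton_append, run]
    simp only [hC]
    rw [if_pos (by omega)]
    rfl
  · obtain ⟨s, rfl⟩ := List.length_eq_one_iff.1 hL
    exact ⟨_, t - (n + M.var y) * (C.length + 1), by omega,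
      fun s' hs' => by rw [List.singleton_inj.1 hs'], rfl⟩

/-- A program that samples and then behaves deterministically, as an algorithm. -/
lemma Samples.exists_run_eq (h : Samples n C m l b M S) {t : ℕ} (ht : b ≤ t) :
    ∃ k : List (Bits (n + w)) → Memory,
      run n t l M = sampleTree C m (fun L => .output (some (k L))) ∧
        ∀ L, L.length = m → S L (k L) := by
  obtain ⟨k, h1, h2⟩ := h t ht []
  choose! M' t' h3 h4 h5 using h2
  refine ⟨M', ?_, h4⟩
  rw [← List.append_nil l, h1]
  refine sampleTree_congr C m fun L hL => ?_
  rw [h5 L hL, run]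

end logic

/-! ### Polynomial bounds -/

/-- Functions that are bounded by a polynomial. -/
def PolyBounded (f : ℕ → ℕ) : Prop := ∃ p : Polynomial ℕ, ∀ n, f n ≤ p.eval n

lemma PolyBounded.const (c : ℕ) : PolyBounded fun _ => c := ⟨Polynomial.C c, by simp⟩

lemma PolyBounded.id : PolyBounded fun n => n := ⟨Polynomial.X, by simp⟩

lemma PolyBounded.add {f g : ℕ → ℕ} (hf : PolyBounded f) (hg : PolyBounded g) :
    PolyBounded fun n => f n + g n := by
  obtain ⟨p, hp⟩ := hf
  obtain ⟨q, hq⟩ := hg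
  exact ⟨p + q, fun n => by rw [Polynomial.eval_add]; exact Nat.add_le_add (hp n) (hq n)⟩

lemma PolyBounded.mul {f g : ℕ → ℕ} (hf : PolyBounded f) (hg : PolyBounded g) :
    PolyBounded fun n => f n * g n := by
  obtain ⟨p, hp⟩ := hf
  obtain ⟨q, hq⟩ := hg
  exact ⟨p * q, fun n => by rw [Polynomial.eval_mul]; exact Nat.mul_le_mul (hp n) (hq n)⟩

/-! ### The query tape of the Bell sampling circuit -/

lemma mapM_decode_map {m : ℕ} {α : Type} (r : α → RawGate) (g : α → Gate m) (l : List α)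
    (h : ∀ a ∈ l, (r a).decode m = some (g a)) :
    (l.map r).mapM (RawGate.decode m) = some (l.map g) := by
  induction l with
  | nil => rfl
  | cons a l ih =>
    rw [List.map_cons, List.mapM_cons, h a (by simp), ih fun a ha => h a (by simp [ha])]
    rfl

lemma qubitsDesc_map_val (n : ℕ) : (qubitsDesc n).map Fin.val = (List.range n).reverse := by
  rw [qubitsDesc, List.map_reverse, List.map_coe_finRange_eq_range]

/-- The qubits appear in descending order because `Memory.addGate` puts each new gate at the front
of the layer. -/
lemma decode_gates {n : ℕ} (r : ℕ → RawGate) (L : DepthOne (n + n)) (g : Fin n → Gate (n + n))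
    (hL : L.gates = (qubitsDesc n).map g) (h : ∀ j : Fin n, (r j).decode (n + n) = some (g j)) :
    (RawLayer.gates ((List.range n).reverse.map r)).decode n n = some (.unitary L) := by
  have h1 : ((List.range n).reverse.map r).mapM (RawGate.decode (n + n)) = some L.gates := by
    rw [← qubitsDesc_map_val, List.map_map, hL]
    exact mapM_decode_map (fun j : Fin n => r j) g _ fun j _ => h j
  rw [RawLayer.decode, h1, Option.bind_some, dif_pos L.disjoint]

/-- The query tape that describes the Bell sampling circuit. -/
def bellTape (n : ℕ) : List RawLayer :=
  [.gates ((List.range n).reverse.map .H),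
    .gates ((List.range n).reverse.map fun j => .CNOT j (n + j)), .oracle,
    .gates ((List.range n).reverse.map fun j => .SWAP j (n + j)), .oracle]

lemma decode_bellTape (n : ℕ) :
    (bellTape n).reverse.mapM (RawLayer.decode n n) = some (bellCircuit n) := by
  have h1 : (RawLayer.gates ((List.range n).reverse.map fun j => .SWAP j (n + j))).decode n n =
      some (.unitary (pairLayer n swapGate)) := by
    refine decode_gates (fun j => .SWAP j (n + j)) _ (pairGate swapGate) rfl fun j => ?_
    have := j.2
    rw [RawGate.decode, dif_pos ⟨by omega, by omega, by omega⟩]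
    rfl
  have h2 : (RawLayer.gates ((List.range n).reverse.map fun j => .CNOT j (n + j))).decode n n =
      some (.unitary (pairLayer n cnotGate)) := by
    refine decode_gates (fun j => .CNOT j (n + j)) _ (pairGate cnotGate) rfl fun j => ?_
    have := j.2
    rw [RawGate.decode, dif_pos ⟨by omega, by omega, by omega⟩]
    rfl
  have h3 : (RawLayer.gates ((List.range n).reverse.map .H)).decode n n =
      some (.unitary (leftLayer n hadamard)) := by
    refine decode_gates .H _ (leftGate hadamard) rfl fun j => ?_
    have := j.2
    rw [RawGate.decode, dif_pos (by omega)]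
    rfl
  simp only [bellTape, List.reverse_cons, List.reverse_nil, List.nil_append, List.cons_append,
    List.mapM_cons, List.mapM_nil, h1, h2, h3]
  rfl

end NISQ
end

/-! ### The program that collects Bell samples -/

noncomputable section
namespace NISQ

infixr:67 " ⨾ " => Prog.seq

/-! ### Composition and counted loops -/

section composition

variable {n : ℕ} {p q : Prog} {b b' : ℕ} {M : Memory} {Q R : Memory → Prop}

lemma Terminates.comp (h : Terminates n [p] b M R)
    (h' : ∀ M', R M' → Terminates n [q] b' M' Q) : Terminates n [p ⨾ q] (b + b' + 1) M Q :=
  Terminates.seq (Terminates.cons h h')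

lemma Terminates.straight_comp (hp : p.IsStraight) (h : Terminates n [q] b (p.eval M) Q) :
    Terminates n [p ⨾ q] (p.cost + b + 1) M Q :=
  Terminates.seq (Terminates.straight_cons hp h)

lemma Terminates.loop_straight {x : ℕ} (k : ℕ) (I : ℕ → Memory → Prop) (hp : p.IsStraight)
    (h0 : I 0 M) (hx : ∀ i M', I i M' → M'.var x = k - i)
    (step : ∀ i M', i < k → I i M' → I (i + 1) (p.eval M')) :
    Terminates n [.while x p] (k * (p.cost + 1) + 1) M (I k) :=
  Terminates.loop k I h0 hx fun i M' hi hI => Terminates.straight hp (step i M' hi hI)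

variable {w m : ℕ} {C : Circuit n w} {S T : List (Bits (n + w)) → Memory → Prop}

lemma Samples.comp (h : Samples n C m [p] b M T)
    (h' : ∀ L M', L.length = m → T L M' → Terminates n [q] b' M' (S L)) :
    Samples n C m [p ⨾ q] (b + b' + 1) M S :=
  Samples.seq (Samples.append_terminates (l := [p]) h h')

lemma Terminates.comp_samples (h : Terminates n [p] b M Q)
    (h' : ∀ M', Q M' → Samples n C m [q] b' M' S) : Samples n C m [p ⨾ q] (b + b' + 1) M S :=
  Samples.seq (Terminates.append_samples (l := [p]) h h')

end composition

lemma Memory.setVar_var (M : Memory) (x v y : ℕ) :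
    (M.setVar x v).var y = if y = x then v else M.var y := by
  simp [Memory.setVar, Function.update_apply]

lemma Memory.setVar_arr (M : Memory) (x v : ℕ) : (M.setVar x v).arr = M.arr := rfl

lemma Memory.setVar_tape (M : Memory) (x v : ℕ) : (M.setVar x v).tape = M.tape := rfl

lemma Memory.setArr_var (M : Memory) (A : ℕ) (f : ℕ → ℕ) : (M.setArr A f).var = M.var := rfl

lemma Memory.setArr_arr (M : Memory) (A B : ℕ) (f : ℕ → ℕ) :
    (M.setArr A f).arr B = if B = A then f else M.arr B := by
  simp [Memory.setArr, Function.update_apply]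

lemma Memory.setArr_tape (M : Memory) (A : ℕ) (f : ℕ → ℕ) : (M.setArr A f).tape = M.tape := rfl

lemma Memory.addGate_var (M : Memory) (g : RawGate) : (M.addGate g).var = M.var := rfl

lemma Memory.addGate_arr (M : Memory) (g : RawGate) : (M.addGate g).arr = M.arr := rfl

/-- `x := c * y` -/
def mulConst (x y : ℕ) : ℕ → Prog
  | 0 => .const x 0
  | c + 1 => mulConst x y c ⨾ .add x x y

lemma mulConst_isStraight (x y c : ℕ) : (mulConst x y c).IsStraight := by
  induction c with
  | zero => trivial
  | succ c ih => exact ⟨ih, trivial⟩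

lemma mulConst_eval {x y : ℕ} (hxy : y ≠ x) (c : ℕ) (M : Memory) :
    (mulConst x y c).eval M = M.setVar x (c * M.var y) := by
  induction c with
  | zero => simp [mulConst, Prog.eval]
  | succ c ih =>
    simp only [mulConst, Prog.eval, ih, Memory.setVar_var, if_neg hxy, if_true]
    simp [Memory.setVar, Nat.succ_mul]

/-! ### Bell sampling as a program

Variable `0` holds `n`, variable `1` holds one, variable `10` holds zero. -/

/-- Write a layer that consists of the gate `g` at all qubits `j` of the state register, where
variable `3` holds `j` and variable `4` holds `n + j`. -/
def writeLayer (g : Prog) : Prog :=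
  (.newLayer ⨾ .add 2 0 10 ⨾ .const 3 0 ⨾ .add 4 0 10) ⨾
    .while 2 (g ⨾ .add 3 3 1 ⨾ .add 4 4 1 ⨾ .sub 2 2 1)

/-- The running time of `writeLayer`. -/
def writeLayerCost (g : Prog) (n : ℕ) : ℕ :=
  (Prog.newLayer ⨾ .add 2 0 10 ⨾ .const 3 0 ⨾ .add 4 0 10).cost +
    (n * ((g ⨾ .add 3 3 1 ⨾ .add 4 4 1 ⨾ .sub 2 2 1).cost + 1) + 1) + 1

lemma terminates_writeLayer {n : ℕ} {g : Prog} {r : ℕ → RawGate} (hg : g.IsStraight)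
    (hr : ∀ M : Memory, M.var 4 = n + M.var 3 → g.eval M = M.addGate (r (M.var 3)))
    {M : Memory} (h0 : M.var 0 = n) (h1 : M.var 1 = 1) (h10 : M.var 10 = 0) :
    Terminates n [writeLayer g] (writeLayerCost g n) M fun M' =>
      M'.tape = .gates ((List.range n).reverse.map r) :: M.tape ∧ M'.arr = M.arr ∧
        ∀ x, x ≠ 2 → x ≠ 3 → x ≠ 4 → M'.var x = M.var x := by
  refine Terminates.straight_comp (by simp [Prog.IsStraight]) ?_
  refine (Terminates.loop_straight n (fun i M' => M'.var 2 = n - i ∧ M'.var 3 = i ∧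
    M'.var 4 = n + i ∧ M'.tape = .gates ((List.range i).reverse.map r) :: M.tape ∧
    M'.arr = M.arr ∧ ∀ x, x ≠ 2 → x ≠ 3 → x ≠ 4 → M'.var x = M.var x)
    (by exact ⟨hg, trivial, trivial, trivial⟩) ?_ (fun i M' h => h.1) ?_).mono le_rfl
      fun M' h => h.2.2.2
  · simp only [Prog.eval, Memory.setVar_var, Memory.setVar_arr, Memory.setVar_tape]
    simp +contextual [h0, h10]
  · rintro i M' hi ⟨h2, h3, h4, ht, ha, hv⟩
    have h1' : M'.var 1 = 1 := by rw [hv 1 (by decide) (by decide) (by decide), h1]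
    simp only [Prog.eval, hr M' (by rw [h3, h4]), Memory.setVar_var, Memory.setVar_arr,
      Memory.setVar_tape, Memory.addGate_var, Memory.addGate_arr]
    simp +contextual [h2, h3, h4, h1', ha, hv, Memory.addGate, ht, List.range_succ]
    omega

/-- Write the Bell sampling circuit on the query tape. -/
def writeBell : Prog :=
  .oracleLayer ⨾ writeLayer (.gateSWAP 3 4) ⨾ .oracleLayer ⨾ writeLayer (.gateCNOT 3 4) ⨾
    writeLayer (.gateH 3)

/-- The running time of `writeBell`. -/
def writeBellCost (n : ℕ) : ℕ :=
  1 + (writeLayerCost (.gateSWAP 3 4) n + (1 + (writeLayerCost (.gateCNOT 3 4) n +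
    writeLayerCost (.gateH 3) n + 1) + 1) + 1) + 1

lemma terminates_writeBell {n : ℕ} {M : Memory} (h0 : M.var 0 = n) (h1 : M.var 1 = 1)
    (h10 : M.var 10 = 0) (ht : M.tape = []) :
    Terminates n [writeBell] (writeBellCost n) M fun M' =>
      M'.tape = bellTape n ∧ M'.arr = M.arr ∧
        ∀ x, x ≠ 2 → x ≠ 3 → x ≠ 4 → M'.var x = M.var x := by
  refine Terminates.straight_comp trivial ?_
  refine (terminates_writeLayer (g := (.gateSWAP 3 4)) (r := fun j => .SWAP j (n + j))
    (M := Prog.oracleLayer.eval M) trivial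
    (fun M h => by rw [Prog.eval, h]) h0 h1 h10).comp ?_
  rintro M₁ ⟨t1, a1, v1⟩
  refine Terminates.straight_comp trivial ?_
  have w0 : M₁.var 0 = n := by rw [v1 0 (by decide) (by decide) (by decide)]; exact h0
  have w1 : M₁.var 1 = 1 := by rw [v1 1 (by decide) (by decide) (by decide)]; exact h1
  have w10 : M₁.var 10 = 0 := by rw [v1 10 (by decide) (by decide) (by decide)]; exact h10
  refine (terminates_writeLayer (g := (.gateCNOT 3 4)) (r := fun j => .CNOT j (n + j))
    (M := Prog.oracleLayer.eval M₁) trivial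
    (fun M h => by rw [Prog.eval, h]) w0 w1 w10).comp ?_
  rintro M₂ ⟨t2, a2, v2⟩
  refine (terminates_writeLayer (g := (.gateH 3)) (r := fun j => .H j) trivial
    (fun M h => by rw [Prog.eval]) (by rw [v2 0 (by decide) (by decide) (by decide)]; exact w0)
    (by rw [v2 1 (by decide) (by decide) (by decide)]; exact w1)
    (by rw [v2 10 (by decide) (by decide) (by decide)]; exact w10)).mono le_rfl ?_
  rintro M₃ ⟨t3, a3, v3⟩
  refine ⟨?_, ?_, fun x x2 x3 x4 => ?_⟩
  · rw [t3, t2]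
    simp [Prog.eval, t1, ht, bellTape]
  · rw [a3, a2]
    exact a1
  · rw [v3 x x2 x3 x4, v2 x x2 x3 x4]
    exact v1 x x2 x3 x4

/-- The bits that are stored for one Bell sample, followed by a one. -/
def sampleRow {n : ℕ} (s : Bits (n + n)) (k : ℕ) : ℕ := if k = n + n then 1 else padZero s k

/-- The sample that has been measured into array `1` is appended to array `2` at the position that
variable `6` holds. -/
def storeSample : Prog :=
  (.add 2 0 0 ⨾ .const 3 0) ⨾
    .while 2 (.load 7 1 3 ⨾ .store 2 6 7 ⨾ .add 3 3 1 ⨾ .add 6 6 1 ⨾ .sub 2 2 1) ⨾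
    (.store 2 6 1 ⨾ .add 6 6 1 ⨾ .sub 5 5 1)

/-- The running time of `storeSample`. -/
def storeSampleCost (n : ℕ) : ℕ :=
  (Prog.add 2 0 0 ⨾ .const 3 0).cost + ((n + n) * ((Prog.load 7 1 3 ⨾ .store 2 6 7 ⨾ .add 3 3 1 ⨾
    .add 6 6 1 ⨾ .sub 2 2 1).cost + 1) + 1 +
    (Prog.store 2 6 1 ⨾ .add 6 6 1 ⨾ .sub 5 5 1).cost + 1) + 1

lemma terminates_storeSample {n : ℕ} {M : Memory} (h0 : M.var 0 = n) (h1 : M.var 1 = 1)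
    (s : Bits (n + n)) (hs : M.arr 1 = padZero s) :
    Terminates n [storeSample] (storeSampleCost n) M fun M' =>
      M'.tape = M.tape ∧ (∀ A, A ≠ 2 → M'.arr A = M.arr A) ∧
        (∀ x, x ≠ 2 → x ≠ 3 → x ≠ 5 → x ≠ 6 → x ≠ 7 → M'.var x = M.var x) ∧
        M'.var 5 = M.var 5 - 1 ∧ M'.var 6 = M.var 6 + (n + n + 1) ∧
        (∀ i < M.var 6, M'.arr 2 i = M.arr 2 i) ∧
        ∀ k < n + n + 1, M'.arr 2 (M.var 6 + k) = sampleRow s k := by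
  refine Terminates.straight_comp (by simp [Prog.IsStraight]) ?_
  refine Terminates.comp (Terminates.loop_straight (n + n) (fun i M' => M'.var 2 = n + n - i ∧
    M'.var 3 = i ∧ M'.var 6 = M.var 6 + i ∧ M'.tape = M.tape ∧
    (∀ A, A ≠ 2 → M'.arr A = M.arr A) ∧
    (∀ x, x ≠ 2 → x ≠ 3 → x ≠ 6 → x ≠ 7 → M'.var x = M.var x) ∧
    (∀ i < M.var 6, M'.arr 2 i = M.arr 2 i) ∧ ∀ k < i, M'.arr 2 (M.var 6 + k) = padZero s k)
    (by simp [Prog.IsStraight]) ?_ (fun i M' h => h.1) ?_) ?_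
  · simp only [Prog.eval, Memory.setVar_var, Memory.setVar_arr, Memory.setVar_tape]
    simp +contextual [h0]
  · rintro i M' hi ⟨h2, h3, h6, ht, ha, hv, hl, hd⟩
    have h1' : M'.var 1 = 1 := by
      rw [hv 1 (by decide) (by decide) (by decide) (by decide), h1]
    have ha1 : M'.arr 1 = padZero s := by rw [ha 1 (by decide), hs]
    simp only [Prog.eval, Memory.setVar_var, Memory.setVar_arr, Memory.setVar_tape,
      Memory.setArr_var, Memory.setArr_arr, Memory.setArr_tape]
    simp only [Nat.reduceEqDiff, if_true, if_false, h2, h3, h6, h1', ha1, ht,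
      Function.update_apply]
    refine ⟨by omega, trivial, by omega, trivial, fun A hA => by simp [hA, ha],
      fun x x2 x3 x6 x7 => by simp [x2, x3, x6, x7, hv], fun k hk => ?_, fun k hk => ?_⟩
    · rw [if_neg (by omega), hl k hk]
    · by_cases hki : k = i
      · subst hki; simp
      · rw [if_neg (by omega), hd k (by omega)]
  · rintro M' ⟨h2, h3, h6, ht, ha, hv, hl, hd⟩
    have h1' : M'.var 1 = 1 := by
      rw [hv 1 (by decide) (by decide) (by decide) (by decide), h1]
    have h5 : M'.var 5 = M.var 5 := hv 5 (by decide) (by decide) (by decide) (by decide)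
    refine Terminates.straight (by simp [Prog.IsStraight]) ?_
    simp only [Prog.eval, Memory.setVar_var, Memory.setVar_arr, Memory.setVar_tape,
      Memory.setArr_var, Memory.setArr_arr, Memory.setArr_tape]
    simp only [Nat.reduceEqDiff, if_true, if_false, h5, h6, h1', ht,
      Function.update_apply]
    refine ⟨trivial, fun A hA => by simp [hA, ha],
      fun x x2 x3 x5 x6 x7 => by simp [x5, x2, x3, x6, x7, hv], trivial, by omega,
      fun k hk => ?_, fun k hk => ?_⟩
    · rw [if_neg (by omega), hl k hk]
    · by_cases hki : k = n + n
      · subst hki; simp [sampleRow]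
      · rw [if_neg (by omega), hd k (by omega), sampleRow, if_neg hki]

/-- The memory after the outcomes `L` out of `m` samples have been stored. -/
structure Collected (n m : ℕ) (L : List (Bits (n + n))) (M : Memory) : Prop where
  var0 : M.var 0 = n
  var1 : M.var 1 = 1
  var10 : M.var 10 = 0
  var9 : M.var 9 = m
  rest : M.var 5 = m - L.length
  ptr : M.var 6 = L.length * (n + n + 1)
  tape : M.tape = []
  data : ∀ i (h : i < L.length), ∀ k < n + n + 1, M.arr 2 (i * (n + n + 1) + k) = sampleRow L[i] k
  fresh : ∀ A, A ≠ 1 → A ≠ 2 → M.arr A = fun _ => 0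

/-- Take and store one Bell sample. -/
def takeSample : Prog := writeBell ⨾ .runCircuit 0 1 ⨾ storeSample

/-- The running time of `takeSample`. -/
def takeSampleCost (n : ℕ) : ℕ :=
  writeBellCost n + ((n + n) * (5 + 1) + 1 + storeSampleCost n + 1) + 1

lemma samples_takeSample {n m : ℕ} {L : List (Bits (n + n))} {M : Memory}
    (h : Collected n m L M) :
    Samples n (bellCircuit n) 1 [takeSample] (takeSampleCost n) M
      fun L' M' => Collected n m (L ++ L') M' := by
  refine (terminates_writeBell h.var0 h.var1 h.var10 h.tape).comp_samples ?_
  rintro M₁ ⟨t1, a1, v1⟩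
  have w0 : M₁.var 0 = n := by rw [v1 0 (by decide) (by decide) (by decide), h.var0]
  refine Samples.comp (Samples.runCircuit w0 (by rw [t1]; exact decode_bellTape n)) ?_
  intro L' M₂ hL' hM₂
  obtain ⟨s, rfl⟩ := List.length_eq_one_iff.1 hL'
  have hM₂ := hM₂ s rfl
  have v2 : ∀ x, x ≠ 2 → x ≠ 3 → x ≠ 4 → M₂.var x = M.var x := by
    intro x x2 x3 x4
    rw [hM₂]
    exact v1 x x2 x3 x4
  have a2 : ∀ A, A ≠ 1 → M₂.arr A = M.arr A := by
    intro A hA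
    rw [hM₂]
    simp [Memory.setArr_arr, hA, a1]
  have w6 : M₂.var 6 = L.length * (n + n + 1) := by
    rw [v2 6 (by decide) (by decide) (by decide), h.ptr]
  refine (terminates_storeSample (by rw [v2 0 (by decide) (by decide) (by decide), h.var0])
    (by rw [v2 1 (by decide) (by decide) (by decide), h.var1]) s
    (by rw [hM₂]; simp [Memory.setArr_arr])).mono le_rfl ?_
  rintro M₃ ⟨t3, a3, v3, v5, v6, d1, d2⟩
  have w : ∀ x, x ≠ 2 → x ≠ 3 → x ≠ 4 → x ≠ 5 → x ≠ 6 → x ≠ 7 → M₃.var x = M.var x := by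
    intro x x2 x3 x4 x5 x6 x7
    rw [v3 x x2 x3 x5 x6 x7, v2 x x2 x3 x4]
  constructor
  · rw [w 0 (by decide) (by decide) (by decide) (by decide) (by decide) (by decide), h.var0]
  · rw [w 1 (by decide) (by decide) (by decide) (by decide) (by decide) (by decide), h.var1]
  · rw [w 10 (by decide) (by decide) (by decide) (by decide) (by decide) (by decide), h.var10]
  · rw [w 9 (by decide) (by decide) (by decide) (by decide) (by decide) (by decide), h.var9]
  · rw [v5, v2 5 (by decide) (by decide) (by decide), h.rest, List.length_append,
      List.length_singleton]
    omega
  · rw [v6, w6, List.length_append, List.length_singleton, Nat.add_mul, Nat.one_mul]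
  · rw [t3, hM₂]
  · intro i hi k hk
    rw [List.length_append, List.length_singleton] at hi
    rcases Nat.lt_succ_iff_lt_or_eq.1 hi with hlt | rfl
    -- Earlier rows lie entirely below the write pointer, so storing the new sample does not touch
    -- them.
    · have : i * (n + n + 1) + k < M₂.var 6 := by
        rw [w6]
        calc i * (n + n + 1) + k < (i + 1) * (n + n + 1) := by rw [Nat.succ_mul]; omega
          _ ≤ _ := Nat.mul_le_mul_right _ hlt
      rw [d1 _ this, a2 2 (by decide), h.data i hlt k hk, List.getElem_append_left hlt]
    · rw [← w6, d2 k hk]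
      simp
  · intro A hA1 hA2
    rw [a3 A hA2, a2 A hA1, h.fresh A hA1 hA2]

/-- Take and store `c * n` Bell samples. -/
def collect (c : ℕ) : Prog :=
  (.const 1 1 ⨾ mulConst 9 0 c ⨾ .add 5 9 10) ⨾ .while 5 takeSample

/-- The running time of `collect`. -/
def collectCost (c n : ℕ) : ℕ :=
  (Prog.const 1 1 ⨾ mulConst 9 0 c ⨾ .add 5 9 10).cost +
    (c * n * (takeSampleCost n + 1) + 1) + 1

lemma samples_collect (c n : ℕ) :
    Samples n (bellCircuit n) (c * n) [collect c] (collectCost c n) (Memory.init n)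
      (Collected n (c * n)) := by
  refine (Terminates.eval ?_ _).comp_samples ?_
  · exact ⟨trivial, mulConst_isStraight _ _ _, trivial⟩
  · rintro M rfl
    refine Samples.loop (c * n) _ ?_ (fun L M' h => h.rest) fun L M' _ h => samples_takeSample h
    simp only [Prog.eval, mulConst_eval (show 0 ≠ 9 by decide)]
    constructor <;>
      simp [Memory.setVar_var, Memory.setVar_arr, Memory.setVar_tape, Memory.init]

lemma polyBounded_writeLayerCost (g : Prog) : PolyBounded (writeLayerCost g) :=
  ((PolyBounded.const _).add ((PolyBounded.id.mul (.const _)).add (.const _))).add (.const _)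

lemma polyBounded_collectCost (c : ℕ) : PolyBounded (collectCost c) := by
  have h1 : PolyBounded writeBellCost :=
    (((PolyBounded.const _).add (((polyBounded_writeLayerCost _).add ((((PolyBounded.const _).add
      (((polyBounded_writeLayerCost _).add (polyBounded_writeLayerCost _)).add
        (.const _))).add (.const _)))).add (.const _))).add (.const _))
  have h2 : PolyBounded storeSampleCost :=
    ((PolyBounded.const _).add (((((PolyBounded.id.add .id).mul (.const _)).add (.const _)).add
      (.const _)).add (.const _))).add (.const _)
  have h3 : PolyBounded takeSampleCost :=
    (h1.add (((((PolyBounded.id.add .id).mul (.const _)).add (.const _)).add h2).add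
      (.const _))).add (.const _)
  exact ((PolyBounded.const _).add ((((PolyBounded.const c).mul .id).mul
    (h3.add (.const _))).add (.const _))).add (.const _)

end NISQ
end

/-! ### Bell signs as binary linear forms, and the estimation program -/

noncomputable section
namespace NISQ

/-! ### Binary arithmetic -/

/-- The machine has only addition and truncated subtraction. On bits, x - (1 - y) is the
conjunction, and (x - y) + (y - x) in the next lemma is the exclusive or. -/
lemma val_mul_zmod_two (x y : ZMod 2) : x.val - (1 - y.val) = (x * y).val := by
  revert x y; decide

lemma val_add_zmod_two (x y : ZMod 2) : x.val - y.val + (y.val - x.val) = (x + y).val := by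
  revert x y; decide

lemma val_natCast_zmod_two {k : ℕ} (hk : k ≤ 1) : (k : ZMod 2).val = k := by
  interval_cases k <;> rfl

lemma neg_one_pow_congr_zmod_two {a b : ℕ} (h : (a : ZMod 2) = b) : (-1 : ℝ) ^ a = (-1) ^ b := by
  rw [neg_one_pow_eq_pow_mod_two, (ZMod.natCast_eq_natCast_iff' a b 2).1 h,
    ← neg_one_pow_eq_pow_mod_two]

/-- Variable `33` becomes the inner product modulo two of the bits of the arrays `A` and `B` that
start at the positions in the variables `31` and `32`; variable `17` holds their number. -/
def dotProg (A B : ℕ) : Prog :=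
  (.const 33 0 ⨾ .add 30 17 10) ⨾
    .while 30 (.load 34 A 31 ⨾ .load 35 B 32 ⨾ .sub 36 1 35 ⨾ .sub 36 34 36 ⨾ .sub 37 33 36 ⨾
      .sub 36 36 33 ⨾ .add 33 37 36 ⨾ .add 31 31 1 ⨾ .add 32 32 1 ⨾ .sub 30 30 1)

/-- The running time of `dotProg`. -/
def dotCost (D : ℕ) : ℕ :=
  (Prog.const 33 0 ⨾ .add 30 17 10).cost + (D * ((Prog.load 34 0 31 ⨾ .load 35 0 32 ⨾
    .sub 36 1 35 ⨾ .sub 36 34 36 ⨾ .sub 37 33 36 ⨾ .sub 36 36 33 ⨾ .add 33 37 36 ⨾ .add 31 31 1 ⨾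
    .add 32 32 1 ⨾ .sub 30 30 1).cost + 1) + 1) + 1

lemma terminates_dotProg {n D A B : ℕ} {M : Memory} (h1 : M.var 1 = 1) (h10 : M.var 10 = 0)
    (h17 : M.var 17 = D) (a v : ℕ → ZMod 2) (ha : ∀ k < D, M.arr A (M.var 31 + k) = (a k).val)
    (hv : ∀ k < D, M.arr B (M.var 32 + k) = (v k).val) :
    Terminates n [dotProg A B] (dotCost D) M fun M' =>
      M'.arr = M.arr ∧ (∀ x < 30, M'.var x = M.var x) ∧ M'.var 31 = M.var 31 + D ∧
        M'.var 32 = M.var 32 + D ∧ M'.var 33 = (∑ k ∈ Finset.range D, a k * v k).val := by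
  refine Terminates.straight_comp (by simp [Prog.IsStraight]) ?_
  refine (Terminates.loop_straight D (fun i M' => M'.var 30 = D - i ∧ M'.arr = M.arr ∧
    (∀ x < 30, M'.var x = M.var x) ∧ M'.var 31 = M.var 31 + i ∧ M'.var 32 = M.var 32 + i ∧
    M'.var 33 = (∑ k ∈ Finset.range i, a k * v k).val)
    (by simp [Prog.IsStraight]) ?_ (fun i M' h => h.1) ?_).mono le_rfl fun M' h => h.2
  · simp only [Prog.eval, Memory.setVar_var, Memory.setVar_arr]
    simp only [Nat.reduceEqDiff, if_true, if_false, h10, h17, true_and]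
    refine ⟨rfl, fun x hx => ?_, rfl, rfl, by simp⟩
    rw [if_neg (by omega), if_neg (by omega)]
  · rintro i M' hi ⟨h30, harr, hx, h31, h32, h33⟩
    have h1' : M'.var 1 = 1 := by rw [hx 1 (by decide), h1]
    simp only [Prog.eval, Memory.setVar_var, Memory.setVar_arr]
    simp only [Nat.reduceEqDiff, if_true, if_false, h30, h31, h32, h33, h1', harr,
      ha i hi, hv i hi, val_mul_zmod_two, val_add_zmod_two, Finset.sum_range_succ, true_and]
    refine ⟨by omega, fun x hxx => ?_, by omega, by omega, by trivial⟩
    simp only [hx x hxx]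
    repeat rw [if_neg (by omega)]

/-! ### Pauli operators as binary vectors -/

/-- The tensor factor of `P` at qubit `j`, and the identity if there is no such qubit. -/
def pauliAt {n : ℕ} (P : PauliString n) (j : ℕ) : Fin 4 := if h : j < n then P ⟨j, h⟩ else 0

lemma pauliAt_val {n : ℕ} (P : PauliString n) (j : Fin n) : pauliAt P j = P j := by
  simp [pauliAt]

lemma padZero_pauli {n : ℕ} (P : PauliString n) (j : ℕ) : padZero P j = (pauliAt P j : ℕ) := by
  unfold padZero pauliAt; split <;> rfl

/-- The number of tensor factors `Y`, modulo two. -/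
def yParity {n : ℕ} (P : PauliString n) (m : ℕ) : ZMod 2 :=
  ∑ j ∈ Finset.range m, ((xBit (pauliAt P j) * zBit (pauliAt P j) : ℕ) : ZMod 2)

/-- The coefficients of the outcome bits in the exponent of the Bell sign of `P`, followed by the
constant coefficient. -/
def pauliVec {n : ℕ} (P : PauliString n) (k : ℕ) : ZMod 2 :=
  if k < n then (xBit (pauliAt P k) : ZMod 2)
  else if k < n + n then (zBit (pauliAt P (k - n)) : ZMod 2) else yParity P n

lemma xBit_le (k : Fin 4) : xBit k ≤ 1 := by revert k; decide

lemma zBit_le (k : Fin 4) : zBit k ≤ 1 := by revert k; decide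

lemma sampleRow_le {n : ℕ} (s : Bits (n + n)) (k : ℕ) : sampleRow s k ≤ 1 := by
  unfold sampleRow padZero
  split
  · exact le_rfl
  · split
    · omega
    · exact zero_le_one

/-- The inner product of a sample with a vector. -/
def sampleDot {n : ℕ} (s : Bits (n + n)) (v : ℕ → ZMod 2) : ZMod 2 :=
  ∑ k ∈ Finset.range (n + n + 1), (sampleRow s k : ZMod 2) * v k

/-- The exponent of the sign is affine in the outcome bits, and its constant term is the parity of
the number of Y factors. The last entry of v is left free: it enters through the final one of the
sample row and again through the correction term, and cancels in characteristic two. -/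
lemma bellSign_eq {n : ℕ} (P : PauliString n) (s : Bits (n + n)) (v : ℕ → ZMod 2)
    (hx : ∀ k < n, v k = xBit (pauliAt P k)) (hz : ∀ k < n, v (n + k) = zBit (pauliAt P k)) :
    bellSign P s = (-1) ^ (sampleDot s v + (v (n + n) + yParity P n)).val := by
  have h1 : bellSign P s = (-1) ^ ∑ j, (xBit (P j) * ((pairAt s j).1 : ℕ) +
      zBit (P j) * ((pairAt s j).2 : ℕ) + xBit (P j) * zBit (P j)) := by
    simp only [bellSign, bellFactor]
    rw [Finset.prod_pow_eq_pow_sum]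
  rw [h1]
  apply neg_one_pow_congr_zmod_two
  rw [ZMod.natCast_val, ZMod.cast_id]
  have h2 : sampleDot s v = ∑ j : Fin n, ((xBit (P j) : ZMod 2) * ((pairAt s j).1 : ℕ)) +
      ∑ j : Fin n, ((zBit (P j) : ZMod 2) * ((pairAt s j).2 : ℕ)) + v (n + n) := by
    rw [sampleDot, Finset.sum_range_succ, Finset.sum_range_add]
    congr 1
    · congr 1
      · rw [Finset.sum_range]
        refine Finset.sum_congr rfl fun j _ => ?_
        have := j.2
        rw [hx j this, pauliAt_val, sampleRow, if_neg (by omega), padZero, dif_pos (by omega),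
          mul_comm]
        rfl
      · rw [Finset.sum_range]
        refine Finset.sum_congr rfl fun j _ => ?_
        have := j.2
        rw [hz j this, pauliAt_val, sampleRow, if_neg (by omega), padZero, dif_pos (by omega),
          mul_comm]
        rfl
    · simp [sampleRow]
  have h3 : yParity P n = ∑ j : Fin n, ((xBit (P j) : ZMod 2) * (zBit (P j) : ZMod 2)) := by
    rw [yParity, Finset.sum_range]
    exact Finset.sum_congr rfl fun j _ => by rw [pauliAt_val, Nat.cast_mul]
  rw [h2, h3]
  push_cast
  rw [Finset.sum_add_distrib, Finset.sum_add_distrib]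
  have h4 : v (n + n) + v (n + n) = 0 := CharTwo.add_self_eq_zero _
  linear_combination -h4

lemma pauliVec_left {n : ℕ} (P : PauliString n) {k : ℕ} (hk : k < n) :
    pauliVec P k = xBit (pauliAt P k) := if_pos hk

lemma pauliVec_right {n : ℕ} (P : PauliString n) {k : ℕ} (hk : k < n) :
    pauliVec P (n + k) = zBit (pauliAt P k) := by
  rw [pauliVec, if_neg (by omega), if_pos (by omega), Nat.add_sub_cancel_left]

lemma pauliVec_last {n : ℕ} (P : PauliString n) : pauliVec P (n + n) = yParity P n := by
  rw [pauliVec, if_neg (by omega), if_neg (by omega)]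

/-- Choosing the last entry as the Y parity removes the correction, so the affine form becomes a
linear one. -/
lemma bellSign_eq_sampleDot {n : ℕ} (P : PauliString n) (s : Bits (n + n)) :
    bellSign P s = (-1) ^ (sampleDot s (pauliVec P)).val := by
  rw [bellSign_eq P s (pauliVec P) (fun k hk => pauliVec_left P hk)
    (fun k hk => pauliVec_right P hk), pauliVec_last, CharTwo.add_self_eq_zero, add_zero]

/-! ### Estimation of the expectation value of a given Pauli operator -/

/-- Write the binary vector of the Pauli operator in array `0` into array `5`. -/
def writePauliVec : Prog :=
  (.add 2 0 10 ⨾ .const 3 0 ⨾ .add 4 0 10 ⨾ .const 18 0) ⨾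
    .while 2 (.load 7 0 3 ⨾ .sub 12 7 1 ⨾ .sub 13 12 1 ⨾ .sub 8 1 12 ⨾ .sub 8 1 8 ⨾ .sub 11 1 7 ⨾
      .sub 11 1 11 ⨾ .sub 13 1 13 ⨾ .sub 13 1 13 ⨾ .sub 11 11 13 ⨾ .store 5 3 11 ⨾ .store 5 4 8 ⨾
      .sub 13 1 8 ⨾ .sub 13 11 13 ⨾ .sub 12 18 13 ⨾ .sub 13 13 18 ⨾ .add 18 12 13 ⨾ .add 3 3 1 ⨾
      .add 4 4 1 ⨾ .sub 2 2 1) ⨾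
    .store 5 4 18

/-- The running time of `writePauliVec`. -/
def writePauliVecCost (n : ℕ) : ℕ :=
  (Prog.add 2 0 10 ⨾ .const 3 0 ⨾ .add 4 0 10 ⨾ .const 18 0).cost +
    (n * ((Prog.load 7 0 3 ⨾ .sub 12 7 1 ⨾ .sub 13 12 1 ⨾ .sub 8 1 12 ⨾ .sub 8 1 8 ⨾ .sub 11 1 7 ⨾
      .sub 11 1 11 ⨾ .sub 13 1 13 ⨾ .sub 13 1 13 ⨾ .sub 11 11 13 ⨾ .store 5 3 11 ⨾ .store 5 4 8 ⨾
      .sub 13 1 8 ⨾ .sub 13 11 13 ⨾ .sub 12 18 13 ⨾ .sub 13 13 18 ⨾ .add 18 12 13 ⨾ .add 3 3 1 ⨾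
      .add 4 4 1 ⨾ .sub 2 2 1).cost + 1) + 1 + (Prog.store 5 4 18).cost + 1) + 1

/-- 1 - (1 - a) tests a > 0. Thus the phase coefficient is the test k > 0 minus the test k > 2, and
the parity coefficient below is the test k > 1. -/
lemma xBit_eq (k : Fin 4) :
    1 - (1 - (k : ℕ)) - (1 - (1 - ((k : ℕ) - 1 - 1))) = xBit k := by
  revert k; decide

lemma zBit_eq (k : Fin 4) : 1 - (1 - ((k : ℕ) - 1)) = zBit k := by revert k; decide

lemma xBit_sub_eq (k : Fin 4) :
    xBit k - (1 - zBit k) = ((xBit k * zBit k : ℕ) : ZMod 2).val := by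
  revert k; decide

lemma terminates_writePauliVec {n : ℕ} {M : Memory} (h0 : M.var 0 = n) (h1 : M.var 1 = 1)
    (h10 : M.var 10 = 0) (P : PauliString n) (hP : M.arr 0 = padZero P) :
    Terminates n [writePauliVec] (writePauliVecCost n) M fun M' =>
      (∀ A, A ≠ 5 → M'.arr A = M.arr A) ∧
        (∀ x, x = 0 ∨ x = 1 ∨ x = 9 ∨ x = 10 → M'.var x = M.var x) ∧
        ∀ k < n + n + 1, M'.arr 5 k = (pauliVec P k).val := by
  refine Terminates.straight_comp (by simp [Prog.IsStraight]) ?_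
  refine Terminates.comp (Terminates.loop_straight n (fun i M' => M'.var 2 = n - i ∧
    M'.var 3 = i ∧ M'.var 4 = n + i ∧ M'.var 18 = (yParity P i).val ∧
    (∀ A, A ≠ 5 → M'.arr A = M.arr A) ∧
    (∀ x, x = 0 ∨ x = 1 ∨ x = 9 ∨ x = 10 → M'.var x = M.var x) ∧
    (∀ k < i, M'.arr 5 k = xBit (pauliAt P k)) ∧ ∀ k < i, M'.arr 5 (n + k) = zBit (pauliAt P k))
    (by simp [Prog.IsStraight]) ?_ (fun i M' h => h.1) ?_) ?_
  · simp only [Prog.eval, Memory.setVar_var, Memory.setVar_arr]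
    simp only [Nat.reduceEqDiff, if_true, if_false, h0, h10,
      OfNat.zero_ne_ofNat]
    refine ⟨by trivial, by trivial, by trivial, by simp [yParity], fun _ _ => trivial, ?_,
      by simp, by simp⟩
    rintro x (rfl | rfl | rfl | rfl) <;> simp
  · rintro i M' hi ⟨h2, h3, h4, h18, ha, hx, hl, hr⟩
    have h1' : M'.var 1 = 1 := by rw [hx 1 (by simp), h1]
    have ha0 : M'.arr 0 = padZero P := by rw [ha 0 (by decide), hP]
    simp only [Prog.eval, Memory.setVar_var, Memory.setVar_arr, Memory.setArr_var,
      Memory.setArr_arr]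
    simp only [Nat.reduceEqDiff, if_true, if_false, h2, h3, h4, h1', h18, ha0, padZero_pauli,
      xBit_eq, zBit_eq, xBit_sub_eq, val_add_zmod_two, Function.update_apply]
    refine ⟨by omega, trivial, by omega, ?_, fun A hA => by simp [hA, ha], ?_, fun k hk => ?_,
      fun k hk => ?_⟩
    · rw [yParity, yParity, Finset.sum_range_succ]
    · rintro x (rfl | rfl | rfl | rfl) <;> simp [hx]
    · rw [if_neg (by omega)]
      by_cases hki : k = i
      · rw [if_pos hki, hki]
      · rw [if_neg hki, hl k (by omega)]
    · by_cases hki : k = i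
      · rw [if_pos (by omega), hki]
      · rw [if_neg (by omega), if_neg (by omega), hr k (by omega)]
  · rintro M' ⟨h2, h3, h4, h18, ha, hx, hl, hr⟩
    refine Terminates.straight trivial ?_
    simp only [Prog.eval, Memory.setArr_var, Memory.setArr_arr, Function.update_apply, if_true, h4,
      h18]
    refine ⟨fun A hA => by simp [hA, ha], hx, fun k hk => ?_⟩
    by_cases hk1 : k < n
    · rw [if_neg (by omega), hl k hk1, pauliVec_left P hk1, val_natCast_zmod_two (xBit_le _)]
    · by_cases hk2 : k < n + n
      · obtain ⟨j, rfl⟩ := Nat.exists_eq_add_of_le (not_lt.1 hk1)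
        rw [if_neg (by omega), hr j (by omega), pauliVec_right P (by omega),
          val_natCast_zmod_two (zBit_le _)]
      · obtain rfl : k = n + n := by omega
        rw [if_pos rfl, pauliVec_last]

/-- Count the samples with Bell sign `1` in variable `19` and the others in variable `20`. -/
def countSigns : Prog :=
  (.add 17 0 0 ⨾ .add 17 17 1 ⨾ .add 5 9 10 ⨾ .const 31 0 ⨾ .const 19 0 ⨾ .const 20 0) ⨾
    .while 5 (.const 32 0 ⨾ dotProg 2 5 ⨾ .ite 33 (.add 20 20 1) (.add 19 19 1) ⨾ .sub 5 5 1)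

/-- The running time of `countSigns` for `m` samples. -/
def countSignsCost (n m : ℕ) : ℕ :=
  (Prog.add 17 0 0 ⨾ .add 17 17 1 ⨾ .add 5 9 10 ⨾ .const 31 0 ⨾ .const 19 0 ⨾ .const 20 0).cost +
    (m * (1 + (dotCost (n + n + 1) +
      (Prog.ite 33 (.add 20 20 1) (.add 19 19 1) ⨾ .sub 5 5 1).cost + 1) + 1 + 1) + 1) + 1

lemma terminates_countSigns {n m : ℕ} {M : Memory} (h0 : M.var 0 = n) (h1 : M.var 1 = 1)
    (h9 : M.var 9 = m) (h10 : M.var 10 = 0) (P : PauliString n)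
    (hP : ∀ k < n + n + 1, M.arr 5 k = (pauliVec P k).val) {L : List (Bits (n + n))}
    (hL : L.length = m) (hdata : ∀ i (h : i < L.length), ∀ k < n + n + 1,
      M.arr 2 (i * (n + n + 1) + k) = sampleRow L[i] k) :
    Terminates n [countSigns] (countSignsCost n m) M fun M' =>
      (∀ x, x = 1 ∨ x = 9 ∨ x = 10 → M'.var x = M.var x) ∧
        (M'.var 19 : ℝ) - M'.var 20 = (L.map (bellSign P)).sum := by
  refine Terminates.straight_comp (by simp [Prog.IsStraight]) ?_
  refine (Terminates.loop m (fun i M' => M'.var 5 = m - i ∧ M'.var 31 = i * (n + n + 1) ∧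
    M'.var 17 = n + n + 1 ∧ M'.arr = M.arr ∧
    (∀ x, x = 1 ∨ x = 9 ∨ x = 10 → M'.var x = M.var x) ∧
    (M'.var 19 : ℝ) - M'.var 20 = ((L.take i).map (bellSign P)).sum)
    ?_ (fun i M' h => h.1) ?_).mono le_rfl ?_
  · simp only [Prog.eval, Memory.setVar_var, Memory.setVar_arr]
    simp only [Nat.reduceEqDiff, if_true, if_false, h0, h1, h9, h10]
    refine ⟨rfl, by simp, trivial, trivial, ?_, by simp⟩
    rintro x (rfl | rfl | rfl) <;> simp [h1, h9, h10]
  · rintro i M' hi ⟨h5, h31, h17, ha, hx, hs⟩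
    have hiL : i < L.length := by omega
    refine Terminates.straight_comp trivial ?_
    refine (terminates_dotProg (M := Prog.eval (.const 32 0) M') (D := n + n + 1)
      (by simpa [Prog.eval, Memory.setVar_var, h1] using hx 1 (by simp))
      (by simpa [Prog.eval, Memory.setVar_var, h10] using hx 10 (by simp))
      (by simpa [Prog.eval, Memory.setVar_var] using h17)
      (fun k => (sampleRow L[i] k : ZMod 2)) (pauliVec P) ?_ ?_).comp ?_
    · intro k hk
      simp only [Prog.eval, Memory.setVar_var, Memory.setVar_arr, Nat.reduceEqDiff, if_false, h31,
        ha]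
      rw [hdata i hiL k hk, val_natCast_zmod_two (sampleRow_le _ _)]
    · intro k hk
      simp only [Prog.eval, Memory.setVar_var, Memory.setVar_arr, if_true, ha, Nat.zero_add]
      exact hP k hk
    · rintro M₂ ⟨b1, b2, b3, b4, b5⟩
      refine Terminates.straight (by simp [Prog.IsStraight]) ?_
      simp only [Prog.eval, Memory.setVar_var, Memory.setVar_arr] at b1 b2 b3
      have e1 : M₂.var 1 = 1 := by rw [b2 1 (by decide), if_neg (by decide), hx 1 (by simp), h1]
      have e5 : M₂.var 5 = m - i := by rw [b2 5 (by decide), if_neg (by decide), h5]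
      have e19 : M₂.var 19 = M'.var 19 := by rw [b2 19 (by decide), if_neg (by decide)]
      have e20 : M₂.var 20 = M'.var 20 := by rw [b2 20 (by decide), if_neg (by decide)]
      have e17 : M₂.var 17 = n + n + 1 := by rw [b2 17 (by decide), if_neg (by decide), h17]
      have e31 : M₂.var 31 = (i + 1) * (n + n + 1) := by
        rw [b3, if_neg (by decide), h31, Nat.add_mul, Nat.one_mul]
      have hx' : ∀ x, x = 1 ∨ x = 9 ∨ x = 10 → M₂.var x = M.var x := by
        intro x hxx
        rw [b2 x (by omega), if_neg (by omega), hx x hxx]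
      have hsum : ((L.take (i + 1)).map (bellSign P)).sum =
          ((L.take i).map (bellSign P)).sum + bellSign P L[i] := by
        rw [List.take_succ_eq_append_getElem hiL, List.map_append, List.sum_append]
        simp
      have hsign : bellSign P L[i] = (-1) ^ M₂.var 33 := by
        rw [bellSign_eq_sampleDot, b5]
        rfl
      have hlt : M₂.var 33 < 2 := by rw [b5]; exact ZMod.val_lt _
      by_cases h33 : M₂.var 33 = 0
      · simp only [Prog.eval, h33, ne_eq, not_true_eq_false, if_false, Memory.setVar_var,
          Memory.setVar_arr, Nat.reduceEqDiff, if_true, e5, e1, e17, e19, e20, e31]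
        refine ⟨by omega, trivial, trivial, b1.trans ha, ?_, ?_⟩
        · rintro x (rfl | rfl | rfl) <;> simp [hx']
        · rw [hsum, hsign, h33, ← hs]
          push_cast; ring
      · have h33' : M₂.var 33 = 1 := by omega
        simp only [Prog.eval, h33', ne_eq, one_ne_zero, not_false_eq_true, if_false,
          Memory.setVar_var, Memory.setVar_arr, Nat.reduceEqDiff, if_true, e5, e1, e17, e19, e20,
          e31]
        refine ⟨by omega, trivial, trivial, b1.trans ha, ?_, ?_⟩
        · rintro x (rfl | rfl | rfl) <;> simp [hx']
        · rw [hsum, hsign, h33', ← hs]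
          push_cast; ring
  · rintro M' ⟨_, _, _, _, hx, hs⟩
    refine ⟨hx, ?_⟩
    rw [hs, ← hL, List.take_length]

/-- The number of `i` with `1 ≤ i ≤ k` and `i ^ 2 * m ≤ V`. -/
def gridCount (m V : ℕ) : ℕ → ℕ
  | 0 => 0
  | k + 1 => gridCount m V k + if (k + 1) ^ 2 * m ≤ V then 1 else 0

/-- When an index passes the test, the count is at most that index, and every passing index is
bounded by Y. -/
lemma gridCount_le {m V : ℕ} {Y : ℝ} (hY : 0 ≤ Y)
    (h : ∀ i : ℕ, 1 ≤ i → i ^ 2 * m ≤ V → (i : ℝ) ≤ Y) (k : ℕ) : (gridCount m V k : ℝ) ≤ Y := by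
  have hk : ∀ k, gridCount m V k ≤ k := by
    intro k
    induction k with
    | zero => exact le_rfl
    | succ k ih => rw [gridCount]; split <;> omega
  induction k with
  | zero => simpa [gridCount] using hY
  | succ k ih =>
    rw [gridCount]
    split
    · rename_i hV
      refine le_trans ?_ (h (k + 1) (by omega) hV)
      exact_mod_cast Nat.add_le_add_right (hk k) 1
    · simpa using ih

/-- The count grows with k while the tests succeed. A failure at k + 1 shows X < k + 1, and then the
count so far is already at least X - 1; this loss of 1 is the rounding error. -/
lemma le_gridCount {m V : ℕ} {X : ℝ} (h : ∀ i : ℕ, (i : ℝ) ≤ X → i ^ 2 * m ≤ V) (k : ℕ) :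
    min (k : ℝ) (X - 1) ≤ gridCount m V k := by
  induction k with
  | zero => simp [gridCount]
  | succ k ih =>
    rw [gridCount]
    split
    · push_cast
      rcases min_le_iff.1 ih with h1 | h1
      · exact (min_le_left _ _).trans (by linarith)
      · exact (min_le_right _ _).trans (by linarith)
    · rename_i hV
      have hX : X < k + 1 := by
        by_contra hcon
        exact hV (h (k + 1) (by push_cast; linarith))
      rw [min_eq_right (by linarith)] at ih
      rw [Nat.add_zero]
      exact (min_le_right _ _).trans ih

/-- Variable `22` becomes `gridCount m V k`, where the variables `9` and `23` hold `m` and `V`. -/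
def gridProg : ℕ → Prog
  | 0 => .const 22 0
  | k + 1 => gridProg k ⨾ mulConst 24 9 ((k + 1) ^ 2) ⨾ .sub 24 24 23 ⨾
      .ite 24 (.const 24 0) (.add 22 22 1)

lemma gridProg_isStraight (k : ℕ) : (gridProg k).IsStraight := by
  induction k with
  | zero => trivial
  | succ k ih => exact ⟨ih, mulConst_isStraight _ _ _, trivial, trivial, trivial⟩

lemma gridProg_eval (k : ℕ) {M : Memory} (h1 : M.var 1 = 1) :
    ((gridProg k).eval M).var 22 = gridCount (M.var 9) (M.var 23) k ∧
      ∀ x, x ≠ 22 → x ≠ 24 → ((gridProg k).eval M).var x = M.var x := by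
  induction k with
  | zero => simp +contextual [gridProg, gridCount, Prog.eval, Memory.setVar_var]
  | succ k ih =>
    obtain ⟨i1, i2⟩ := ih
    have e1 := i2 1 (by decide) (by decide)
    have e9 := i2 9 (by decide) (by decide)
    have e23 := i2 23 (by decide) (by decide)
    simp only [gridProg, Prog.eval, mulConst_eval (show 9 ≠ 24 by decide), Memory.setVar_var,
      if_true, Nat.reduceEqDiff, if_false, e1, e9, e23, h1, gridCount]
    by_cases hV : (k + 1) ^ 2 * M.var 9 ≤ M.var 23
    · rw [if_neg (by omega), if_pos hV]
      simp +contextual [Memory.setVar_var, i1, i2]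
    · rw [if_pos (by omega), if_neg hV]
      simp +contextual [Memory.setVar_var, i1, i2]

/-- Compute the estimate for the Pauli operator in array `0` from the collected samples. -/
def estimate (k : ℕ) : Prog :=
  writePauliVec ⨾ countSigns ⨾
    .sub 21 19 20 ⨾ mulConst 23 21 (k ^ 2) ⨾ gridProg k ⨾ .add 0 22 10 ⨾ .const 1 k

/-- The running time of `estimate k` for `m` samples. -/
def estimateCost (k n m : ℕ) : ℕ :=
  writePauliVecCost n + (countSignsCost n m + (Prog.sub 21 19 20 ⨾ mulConst 23 21 (k ^ 2) ⨾
    gridProg k ⨾ .add 0 22 10 ⨾ .const 1 k).cost + 1) + 1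

lemma terminates_estimate (k : ℕ) {n m : ℕ} {L : List (Bits (n + n))} (hL : L.length = m)
    {M : Memory} (hM : Collected n m L M) (P : PauliString n) :
    Terminates n [estimate k] (estimateCost k n m) (M.withPauli P) fun M' =>
      M'.var 1 = k ∧ ∃ V : ℕ, (V : ℝ) = max ((L.map (bellSign P)).sum) 0 ∧
        M'.var 0 = gridCount m (k ^ 2 * V) k := by
  refine (terminates_writePauliVec (M := M.withPauli P) hM.var0 hM.var1 hM.var10 P
    (by simp [Memory.withPauli, Memory.setArr_arr])).comp ?_
  rintro M₁ ⟨a1, x1, p1⟩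
  have w0 : M₁.var 0 = n := (x1 0 (by simp)).trans hM.var0
  have w1 : M₁.var 1 = 1 := (x1 1 (by simp)).trans hM.var1
  have w9 : M₁.var 9 = m := (x1 9 (by simp)).trans hM.var9
  have w10 : M₁.var 10 = 0 := (x1 10 (by simp)).trans hM.var10
  refine (terminates_countSigns w0 w1 w9 w10 P p1 hL ?_).comp ?_
  · intro i hi j hj
    rw [a1 2 (by decide)]
    exact hM.data i hi j hj
  · rintro M₂ ⟨x2, s2⟩
    refine Terminates.straight
      ⟨trivial, mulConst_isStraight _ _ _, gridProg_isStraight k, trivial, trivial⟩ ?_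
    set M₃ := (mulConst 23 21 (k ^ 2)).eval ((Prog.sub 21 19 20).eval M₂) with hM₃
    rw [mulConst_eval (show 21 ≠ 23 by decide)] at hM₃
    have e1 : M₃.var 1 = 1 := by
      simp [hM₃, Prog.eval, Memory.setVar_var, x2, w1]
    have e9 : M₃.var 9 = m := by
      simp [hM₃, Prog.eval, Memory.setVar_var, x2, w9]
    have e10 : M₃.var 10 = 0 := by
      simp [hM₃, Prog.eval, Memory.setVar_var, x2, w10]
    have e23 : M₃.var 23 = k ^ 2 * (M₂.var 19 - M₂.var 20) := by
      simp [hM₃, Prog.eval, Memory.setVar_var]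
    obtain ⟨g1, g2⟩ := gridProg_eval k e1
    have ev : (Prog.sub 21 19 20 ⨾ mulConst 23 21 (k ^ 2) ⨾ gridProg k ⨾ .add 0 22 10 ⨾
        .const 1 k).eval M₂ = (((gridProg k).eval M₃).setVar 0
          (((gridProg k).eval M₃).var 22 + ((gridProg k).eval M₃).var 10)).setVar 1 k := rfl
    rw [ev]
    refine ⟨by simp [Memory.setVar_var], M₂.var 19 - M₂.var 20, ?_, ?_⟩
    -- Truncated subtraction clips a negative sum of signs to zero, which is what the maximum
    -- records.
    · rw [← s2]
      rcases le_total (M₂.var 20) (M₂.var 19) with h | h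
      · rw [Nat.cast_sub h, max_eq_left (sub_nonneg.2 (Nat.cast_le.2 h))]
      · rw [Nat.sub_eq_zero_of_le h, max_eq_right (sub_nonpos.2 (Nat.cast_le.2 h)), Nat.cast_zero]
    · simp [Memory.setVar_var, g1, g2, e9, e10, e23]

/-- The test i² m ≤ k² V says (i/k)² ≤ V/m, so the estimate is the square root of the clipped
empirical mean, rounded down to the grid and capped at 1. Accuracy e² for squares gives accuracy e
for roots, because τ² + e² ≤ (τ + e)², and (τ - e)² ≤ τ² - e² when e ≤ τ; rounding costs 1/k. -/
lemma gridCount_accurate {τ S e : ℝ} {m V k : ℕ} (hτ0 : 0 ≤ τ) (hτ1 : τ ≤ 1) (he : 0 < e)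
    (hm : 0 < m) (hk : 0 < k) (hV : (V : ℝ) = max S 0) (hS : |S - m * τ ^ 2| ≤ m * e ^ 2) :
    |(gridCount m (k ^ 2 * V) k : ℝ) / k - τ| ≤ e + 1 / k := by
  have hmR : (0 : ℝ) < m := Nat.cast_pos.2 hm
  have hkR : (0 : ℝ) < k := Nat.cast_pos.2 hk
  obtain ⟨hS1, hS2⟩ := abs_le.1 hS
  have hV1 : (V : ℝ) ≤ m * (τ ^ 2 + e ^ 2) := by
    rw [hV]; exact max_le (by linarith) (by positivity)
  have hV2 : m * (τ ^ 2 - e ^ 2) ≤ (V : ℝ) := by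
    rw [hV]; exact le_trans (by linarith) (le_max_left _ _)
  have upper := gridCount_le (m := m) (V := k ^ 2 * V) (Y := k * (τ + e)) (by positivity) (by
    intro i _ hi
    have hi' : (i : ℝ) ^ 2 * m ≤ k ^ 2 * V := by exact_mod_cast hi
    have h2 : (i : ℝ) ^ 2 * m ≤ (k * (τ + e)) ^ 2 * m := by
      calc (i : ℝ) ^ 2 * m ≤ k ^ 2 * (m * (τ ^ 2 + e ^ 2)) :=
            hi'.trans (mul_le_mul_of_nonneg_left hV1 (by positivity))
        _ ≤ k ^ 2 * (m * (τ + e) ^ 2) := by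
            gcongr
            nlinarith [mul_nonneg hτ0 he.le]
        _ = _ := by ring
    exact le_of_sq_le_sq (le_of_mul_le_mul_right h2 hmR) (by positivity)) k
  have lower := le_gridCount (m := m) (V := k ^ 2 * V) (X := k * (τ - e)) (by
    intro i hi
    have hi0 : (0 : ℝ) ≤ i := Nat.cast_nonneg i
    have hte : 0 ≤ τ - e := nonneg_of_mul_nonneg_right (hi0.trans hi) hkR
    have h2 : (i : ℝ) ^ 2 * m ≤ k ^ 2 * V := by
      calc (i : ℝ) ^ 2 * m ≤ (k * (τ - e)) ^ 2 * m := by gcongr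
        _ = k ^ 2 * (m * (τ - e) ^ 2) := by ring
        _ ≤ k ^ 2 * (m * (τ ^ 2 - e ^ 2)) := by
            gcongr
            nlinarith
        _ ≤ k ^ 2 * V := mul_le_mul_of_nonneg_left hV2 (by positivity)
    exact_mod_cast h2) k
  -- Since τ ≤ 1, the end of the grid at k does not limit the lower bound.
  rw [min_eq_right (by nlinarith)] at lower
  rw [abs_le]
  constructor
  · rw [le_sub_iff_add_le, le_div_iff₀ hkR]
    have : 1 / (k : ℝ) * k = 1 := by field_simp
    nlinarith
  · rw [sub_le_iff_le_add, div_le_iff₀ hkR]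
    have : 1 / (k : ℝ) * k = 1 := by field_simp
    nlinarith

end NISQ
end

/-! ### Identification of the Pauli operator by elimination modulo two -/

noncomputable section
namespace NISQ

/-! ### Null spaces of samples -/

/-- The first `2 n + 1` rows of `V` span the space of the vectors that are orthogonal to all samples
in `L`. -/
def IsNullBasis {n : ℕ} (V : ℕ → ℕ → ZMod 2) (L : List (Bits (n + n))) : Prop :=
  ∀ v : ℕ → ZMod 2,
    (∃ l : ℕ → ZMod 2, ∀ k < n + n + 1, v k = ∑ i ∈ Finset.range (n + n + 1), l i * V i k) ↔
      ∀ s ∈ L, sampleDot s v = 0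

lemma sampleDot_sum {n : ℕ} (s : Bits (n + n)) (V : ℕ → ℕ → ZMod 2) (l v : ℕ → ZMod 2)
    (h : ∀ k < n + n + 1, v k = ∑ i ∈ Finset.range (n + n + 1), l i * V i k) :
    sampleDot s v = ∑ i ∈ Finset.range (n + n + 1), l i * sampleDot s (V i) := by
  simp only [sampleDot, Finset.mul_sum]
  rw [Finset.sum_comm]
  refine Finset.sum_congr rfl fun k hk => ?_
  rw [h k (Finset.mem_range.1 hk), Finset.mul_sum]
  exact Finset.sum_congr rfl fun i _ => by ring

lemma isNullBasis_nil (n : ℕ) :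
    IsNullBasis (n := n) (fun i k => if i = k then 1 else 0) [] := by
  intro v
  refine ⟨fun _ s hs => by simp at hs, fun _ => ⟨v, fun k hk => ?_⟩⟩
  rw [Finset.sum_eq_single_of_mem k (Finset.mem_range.2 hk)]
  · simp
  · intro i _ hi
    simp [hi]

/-- A pivot row with inner product 1 with s is added to every row that is not orthogonal to s. All
rows become orthogonal to s, and the pivot itself becomes zero, so the number of rows stays fixed
and no independence is demanded. Conversely, if a combination of the old rows is orthogonal to s,
the total coefficient of the added pivot is zero, and the same coefficients represent it in the new
rows. -/
lemma IsNullBasis.step {n : ℕ} {V V' : ℕ → ℕ → ZMod 2} {L : List (Bits (n + n))}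
    (h : IsNullBasis V L) (s : Bits (n + n)) (W : ℕ → ZMod 2)
    (hV : ∀ i < n + n + 1, ∀ k < n + n + 1, V' i k = V i k + sampleDot s (V i) * W k)
    (hW : (∀ i < n + n + 1, sampleDot s (V i) = 0) ∨
      ∃ i < n + n + 1, sampleDot s (V i) = 1 ∧ W = V i) :
    IsNullBasis V' (L ++ [s]) := by
  have hsplit : ∀ (l : ℕ → ZMod 2), ∀ k < n + n + 1,
      ∑ i ∈ Finset.range (n + n + 1), l i * V' i k =
        ∑ i ∈ Finset.range (n + n + 1), l i * V i k +
          (∑ i ∈ Finset.range (n + n + 1), l i * sampleDot s (V i)) * W k := by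
    intro l k hk
    rw [Finset.sum_mul, ← Finset.sum_add_distrib]
    refine Finset.sum_congr rfl fun i hi => ?_
    rw [hV i (Finset.mem_range.1 hi) k hk]
    ring
  intro v
  constructor
  · rintro ⟨l, hl⟩ x hx
    set c := ∑ i ∈ Finset.range (n + n + 1), l i * sampleDot s (V i) with hc
    obtain ⟨l', hl', hs⟩ : ∃ l' : ℕ → ZMod 2, (∀ k < n + n + 1,
        v k = ∑ i ∈ Finset.range (n + n + 1), l' i * V i k) ∧ sampleDot s v = 0 := by
      rcases hW with h0 | ⟨i₀, hi₀, h1, rfl⟩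
      · have hc0 : c = 0 := Finset.sum_eq_zero fun i hi => by
          rw [h0 i (Finset.mem_range.1 hi), mul_zero]
        have hv : ∀ k < n + n + 1, v k = ∑ i ∈ Finset.range (n + n + 1), l i * V i k := by
          intro k hk
          rw [hl k hk, hsplit l k hk, ← hc, hc0, zero_mul, add_zero]
        exact ⟨l, hv, by rw [sampleDot_sum s V l v hv, ← hc, hc0]⟩
      -- In terms of the old rows, the coefficient of the pivot grows by c. As the pivot has inner
      -- product 1 with s, this cancels the inner product c of the rest.
      · have hv : ∀ k < n + n + 1, v k = ∑ i ∈ Finset.range (n + n + 1),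
            (l i + if i = i₀ then c else 0) * V i k := by
          intro k hk
          rw [hl k hk, hsplit l k hk, ← hc]
          simp only [add_mul, Finset.sum_add_distrib, ite_mul, zero_mul]
          rw [Finset.sum_ite_eq' (Finset.range (n + n + 1)) i₀, if_pos (Finset.mem_range.2 hi₀)]
        refine ⟨_, hv, ?_⟩
        rw [sampleDot_sum s V _ v hv]
        simp only [add_mul, Finset.sum_add_distrib, ite_mul, zero_mul]
        rw [Finset.sum_ite_eq' (Finset.range (n + n + 1)) i₀, if_pos (Finset.mem_range.2 hi₀), h1,
          mul_one, ← hc, CharTwo.add_self_eq_zero]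
    rcases List.mem_append.1 hx with hx | hx
    · exact (h v).1 ⟨l', hl'⟩ x hx
    · rw [List.mem_singleton.1 hx, hs]
  · intro hv
    obtain ⟨l, hl⟩ := (h v).2 fun x hx => hv x (List.mem_append_left _ hx)
    refine ⟨l, fun k hk => ?_⟩
    rw [hsplit l k hk, ← sampleDot_sum s V l v hl, hv s (by simp), zero_mul, add_zero, hl k hk]

/-- If the null space of the samples consists of the vectors of `R` and of the identity, then every
vector of the basis is one of these two, and the vector of `R` occurs. -/
lemma IsNullBasis.sup_eq {n : ℕ} {V : ℕ → ℕ → ZMod 2} {L : List (Bits (n + n))}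
    (h : IsNullBasis V L) (R : PauliString n) (hR : ∀ x ∈ L, bellSign R x = 1)
    (hdet : ∀ (Q : PauliString n) (e : ℕ), (∀ x ∈ L, bellSign Q x = (-1) ^ e) →
      Even e ∧ (Q = 0 ∨ Q = R)) {k : ℕ} (hk : k < n + n + 1) :
    (Finset.range (n + n + 1)).sup (fun i => (V i k).val) = (pauliVec R k).val := by
  have hzero : ∀ k, pauliVec (0 : PauliString n) k = 0 := by
    intro k
    have h0 : ∀ j, pauliAt (0 : PauliString n) j = 0 := fun j => by simp [pauliAt]
    simp [pauliVec, h0, yParity, xBit, zBit]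
  have hRnull : ∀ x ∈ L, sampleDot x (pauliVec R) = 0 := by
    intro x hx
    have h1 := hR x hx
    rw [bellSign_eq_sampleDot] at h1
    generalize sampleDot x (pauliVec R) = y at h1 ⊢
    fin_cases y
    · rfl
    · norm_num [ZMod.val] at h1
  -- A vector on 2n + 1 coordinates encodes a Pauli string with a sign: the first 2n bits give the
  -- factors, and the last bit plus the Y parity gives the exponent of the sign. A null vector is
  -- thus a string of constant sign on the samples, to which `hdet` applies.
  have hrow : ∀ v : ℕ → ZMod 2, (∀ x ∈ L, sampleDot x v = 0) →
      (∀ k < n + n + 1, v k = 0) ∨ ∀ k < n + n + 1, v k = pauliVec R k := by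
    intro v hv
    have hcode : ∀ x z : ZMod 2, ∃ p : Fin 4, (xBit p : ZMod 2) = x ∧ (zBit p : ZMod 2) = z := by
      decide
    choose code hcx hcz using hcode
    let Q : PauliString n := fun j => code (v j) (v (n + j))
    have hQ : ∀ j (hj : j < n), pauliAt Q j = code (v j) (v (n + j)) := fun j hj => by
      simp [pauliAt, hj, Q]
    have hx : ∀ k < n, v k = xBit (pauliAt Q k) := fun k hk => by rw [hQ k hk, hcx]
    have hz : ∀ k < n, v (n + k) = zBit (pauliAt Q k) := fun k hk => by rw [hQ k hk, hcz]
    obtain ⟨he, hQR⟩ := hdet Q (v (n + n) + yParity Q n).val (by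
      intro x hxL
      rw [bellSign_eq Q x v hx hz, hv x hxL, zero_add])
    -- The exponent is even, so the last bit agrees with the Y parity of the decoded string.
    have hlast : v (n + n) = yParity Q n := by
      generalize v (n + n) = a at he
      generalize yParity Q n = b at he
      revert a b; decide
    have hvQ : ∀ k < n + n + 1, v k = pauliVec Q k := by
      intro k hk
      by_cases hk1 : k < n
      · rw [hx k hk1, pauliVec_left Q hk1]
      · by_cases hk2 : k < n + n
        · obtain ⟨j, rfl⟩ := Nat.exists_eq_add_of_le (not_lt.1 hk1)
          rw [hz j (by omega), pauliVec_right Q (by omega)]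
        · obtain rfl : k = n + n := by omega
          rw [hlast, pauliVec_last]
    rcases hQR with h0 | h0
    · left; intro k hk; rw [hvQ k hk, h0, hzero]
    · right; intro k hk; rw [hvQ k hk, h0]
  have hVi : ∀ i < n + n + 1,
      (∀ k < n + n + 1, V i k = 0) ∨ ∀ k < n + n + 1, V i k = pauliVec R k := by
    intro i hi
    refine hrow (V i) ((h (V i)).1 ⟨fun j => if j = i then 1 else 0, fun k hk => ?_⟩)
    simp only [ite_mul, one_mul, zero_mul]
    rw [Finset.sum_ite_eq' (Finset.range (n + n + 1)) i, if_pos (Finset.mem_range.2 hi)]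
  refine le_antisymm (Finset.sup_le fun i hi => ?_) ?_
  · rcases hVi i (Finset.mem_range.1 hi) with h0 | h0
    · rw [h0 k hk]; simp
    · rw [h0 k hk]
  · by_cases hRk : pauliVec R k = 0
    · rw [hRk]; simp
    · obtain ⟨l, hl⟩ := (h (pauliVec R)).2 hRnull
      -- The rows span the vector of R, so some row is nonzero wherever that vector is.
      have : ∃ i ∈ Finset.range (n + n + 1), l i * V i k ≠ 0 := by
        by_contra hcon
        push Not at hcon
        exact hRk (by rw [hl k hk, Finset.sum_eq_zero hcon])
      obtain ⟨i, hi, hne⟩ := this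
      have hVk : V i k = pauliVec R k := by
        rcases hVi i (Finset.mem_range.1 hi) with h0 | h0
        · exact absurd (h0 k hk) (right_ne_zero_of_mul hne)
        · exact h0 k hk
      rw [← hVk]
      exact Finset.le_sup (f := fun i => (V i k).val) hi

/-! ### Elimination as a program -/

/-- The matrix `V` is stored row by row in array `3`. -/
def StoresRows (D : ℕ) (V : ℕ → ℕ → ZMod 2) (M : Memory) : Prop :=
  ∀ i < D, ∀ k < D, M.arr 3 (i * D + k) = (V i k).val

lemma mul_add_inj {D i j k l : ℕ} (hk : k < D) (hl : l < D) (h : i * D + k = j * D + l) :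
    i = j ∧ k = l := by
  have hD : 0 < D := by omega
  have h1 := congrArg (· / D) h
  have h2 := congrArg (· % D) h
  simp only [Nat.mul_comm _ D, Nat.mul_add_div hD, Nat.mul_add_mod, Nat.div_eq_of_lt hk,
    Nat.div_eq_of_lt hl, Nat.mod_eq_of_lt hk, Nat.mod_eq_of_lt hl, Nat.add_zero] at h1 h2
  exact ⟨h1, h2⟩

/-- Store the identity matrix in array `3`. -/
def initRows : Prog :=
  (.add 17 0 0 ⨾ .add 17 17 1 ⨾ .add 21 17 1 ⨾ .add 2 17 10 ⨾ .const 3 0) ⨾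
    .while 2 (.store 3 3 1 ⨾ .add 3 3 21 ⨾ .sub 2 2 1)

/-- The running time of `initRows`. -/
def initRowsCost (n : ℕ) : ℕ :=
  (Prog.add 17 0 0 ⨾ .add 17 17 1 ⨾ .add 21 17 1 ⨾ .add 2 17 10 ⨾ .const 3 0).cost +
    ((n + n + 1) * ((Prog.store 3 3 1 ⨾ .add 3 3 21 ⨾ .sub 2 2 1).cost + 1) + 1) + 1

/-- The array starts with zeros, so only the diagonal has to be written. Its consecutive positions
are 2n + 2 apart, the stride held in variable 21. -/
lemma terminates_initRows {n : ℕ} {M : Memory} (h0 : M.var 0 = n) (h1 : M.var 1 = 1)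
    (h10 : M.var 10 = 0) (h3 : M.arr 3 = fun _ => 0) :
    Terminates n [initRows] (initRowsCost n) M fun M' =>
      StoresRows (n + n + 1) (fun i k => if i = k then 1 else 0) M' ∧ M'.var 17 = n + n + 1 ∧
        (∀ A, A ≠ 3 → M'.arr A = M.arr A) ∧
        ∀ x, x = 0 ∨ x = 1 ∨ x = 9 ∨ x = 10 → M'.var x = M.var x := by
  refine Terminates.straight_comp (by simp [Prog.IsStraight]) ?_
  refine (Terminates.loop_straight (n + n + 1) (fun i M' => M'.var 2 = n + n + 1 - i ∧
    M'.var 3 = i * (n + n + 1) + i ∧ M'.var 21 = n + n + 1 + 1 ∧ M'.var 17 = n + n + 1 ∧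
    (∀ A, A ≠ 3 → M'.arr A = M.arr A) ∧
    (∀ x, x = 0 ∨ x = 1 ∨ x = 9 ∨ x = 10 → M'.var x = M.var x) ∧
    ∀ i' < n + n + 1, ∀ k < n + n + 1, M'.arr 3 (i' * (n + n + 1) + k) =
      if i' = k ∧ i' < i then 1 else 0)
    (by simp [Prog.IsStraight]) ?_ (fun i M' h => h.1) ?_).mono le_rfl ?_
  · simp only [Prog.eval, Memory.setVar_var, Memory.setVar_arr]
    simp only [Nat.reduceEqDiff, if_true, if_false, h0, h1, h10, h3]
    refine ⟨by trivial, by simp, by trivial, by trivial, fun _ _ => by trivial, ?_, by simp⟩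
    rintro x (rfl | rfl | rfl | rfl) <;> simp [h0, h1, h10]
  · rintro i M' hi ⟨e2, e3, e21, e17, ha, hx, hd⟩
    have e1 : M'.var 1 = 1 := by rw [hx 1 (by simp), h1]
    simp only [Prog.eval, Memory.setVar_var, Memory.setVar_arr, Memory.setArr_var,
      Memory.setArr_arr]
    simp only [Nat.reduceEqDiff, if_true, if_false, e1, e2, e3, e17, e21, Function.update_apply]
    refine ⟨by omega, by rw [Nat.succ_mul]; omega, by trivial, by trivial,
      fun A hA => by simp [hA, ha], ?_, fun i' hi' k hk => ?_⟩
    · rintro x (rfl | rfl | rfl | rfl) <;> simp [hx]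
    · by_cases heq : i' * (n + n + 1) + k = i * (n + n + 1) + i
      · obtain ⟨rfl, rfl⟩ := mul_add_inj hk hi heq
        simp
      · rw [if_neg heq, hd i' hi' k hk]
        have : ¬ (i' = k ∧ i' = i) := by
          rintro ⟨rfl, rfl⟩; exact heq rfl
        congr 1
        refine propext ⟨fun h => ⟨h.1, by omega⟩, fun h => ⟨h.1, ?_⟩⟩
        rcases Nat.lt_succ_iff_lt_or_eq.1 h.2 with hlt | he
        · exact hlt
        · exact absurd ⟨h.1, he⟩ this
  · rintro M' ⟨_, _, _, e17, ha, hx, hd⟩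
    refine ⟨fun i hi k hk => ?_, e17, ha, hx⟩
    rw [hd i hi k hk]
    beta_reduce
    by_cases hik : i = k
    · rw [if_pos ⟨hik, hi⟩, if_pos hik]; rfl
    · rw [if_neg (fun h => hik h.1), if_neg hik]; rfl

/-- Add the pivot row in array `4` to the row of array `3` that starts at the position in variable
`28`; if variable `26` says that there is no pivot row yet, this row becomes the pivot row first. -/
def addPivot : Prog :=
  (.add 2 17 10 ⨾ .const 3 0 ⨾ .add 22 28 10) ⨾
    .while 2 (.load 7 3 22 ⨾ .ite 26 (.const 8 0) (.store 4 3 7) ⨾ .load 8 4 3 ⨾ .sub 12 7 8 ⨾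
      .sub 13 8 7 ⨾ .add 7 12 13 ⨾ .store 3 22 7 ⨾ .add 3 3 1 ⨾ .add 22 22 1 ⨾ .sub 2 2 1) ⨾
    .const 26 1

/-- The running time of `addPivot`. -/
def addPivotCost (D : ℕ) : ℕ :=
  (Prog.add 2 17 10 ⨾ .const 3 0 ⨾ .add 22 28 10).cost +
    (D * ((Prog.load 7 3 22 ⨾ .ite 26 (.const 8 0) (.store 4 3 7) ⨾ .load 8 4 3 ⨾ .sub 12 7 8 ⨾
      .sub 13 8 7 ⨾ .add 7 12 13 ⨾ .store 3 22 7 ⨾ .add 3 3 1 ⨾ .add 22 22 1 ⨾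
      .sub 2 2 1).cost + 1) + 1 + (Prog.const 26 1).cost + 1) + 1

/-- The variables that `addPivot` leaves alone. -/
def IsKept (x : ℕ) : Prop :=
  x ≠ 2 ∧ x ≠ 3 ∧ x ≠ 7 ∧ x ≠ 8 ∧ x ≠ 12 ∧ x ≠ 13 ∧ x ≠ 22 ∧ x ≠ 26

/-- Here u is the current row and W the pivot. If no pivot exists, each entry of the row is copied
to array 4 just before the addition, so the row is added to itself and vanishes. -/
lemma terminates_addPivot {n D : ℕ} {M : Memory} (h1 : M.var 1 = 1) (h10 : M.var 10 = 0)
    (h17 : M.var 17 = D) (u W : ℕ → ZMod 2)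
    (hu : ∀ k < D, M.arr 3 (M.var 28 + k) = (u k).val)
    (hW : (M.var 26 = 0 ∧ W = u) ∨ (M.var 26 ≠ 0 ∧ ∀ k < D, M.arr 4 k = (W k).val)) :
    Terminates n [addPivot] (addPivotCost D) M fun M' =>
      M'.var 26 = 1 ∧ (∀ A, A ≠ 3 → A ≠ 4 → M'.arr A = M.arr A) ∧
        (∀ x, IsKept x → M'.var x = M.var x) ∧ (∀ k < D, M'.arr 4 k = (W k).val) ∧
        (∀ k < D, M'.arr 3 (M.var 28 + k) = (u k + W k).val) ∧
        ∀ i, i < M.var 28 ∨ M.var 28 + D ≤ i → M'.arr 3 i = M.arr 3 i := by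
  refine Terminates.straight_comp (by simp [Prog.IsStraight]) ?_
  refine Terminates.comp (Terminates.loop_straight D (fun i M' => M'.var 2 = D - i ∧
    M'.var 3 = i ∧ M'.var 22 = M.var 28 + i ∧ M'.var 26 = M.var 26 ∧
    (∀ A, A ≠ 3 → A ≠ 4 → M'.arr A = M.arr A) ∧
    (∀ x, IsKept x → M'.var x = M.var x) ∧ (∀ k < i, M'.arr 4 k = (W k).val) ∧
    (M.var 26 ≠ 0 → M'.arr 4 = M.arr 4) ∧
    (∀ k < i, M'.arr 3 (M.var 28 + k) = (u k + W k).val) ∧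
    ∀ j, j < M.var 28 ∨ M.var 28 + i ≤ j → M'.arr 3 j = M.arr 3 j)
    (by simp [Prog.IsStraight]) ?_ (fun i M' h => h.1) ?_) ?_
  · simp only [Prog.eval, Memory.setVar_var, Memory.setVar_arr]
    simp only [Nat.reduceEqDiff, if_true, if_false, h10, h17]
    refine ⟨by trivial, by trivial, by trivial, by trivial, fun _ _ _ => by trivial, ?_, by simp,
      fun _ => by trivial, by simp, fun _ _ => by trivial⟩
    rintro x ⟨x2, x3, x7, x8, x12, x13, x22, x26⟩
    simp [x2, x3, x22]
  · rintro i M' hi ⟨e2, e3, e22, e26, ha, hx, h4, h4', h3, h3'⟩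
    have e1 : M'.var 1 = 1 := by rw [hx 1 (by simp [IsKept]), h1]
    have er : M'.arr 3 (M.var 28 + i) = (u i).val := by rw [h3' _ (by omega), hu i hi]
    have hxx : ∀ x, IsKept x → x ≠ 2 ∧ x ≠ 3 ∧ x ≠ 7 ∧ x ≠ 8 ∧ x ≠ 12 ∧ x ≠ 13 ∧ x ≠ 22 :=
      fun x h => ⟨h.1, h.2.1, h.2.2.1, h.2.2.2.1, h.2.2.2.2.1, h.2.2.2.2.2.1, h.2.2.2.2.2.2.1⟩
    have arith : ∀ j, (j < M.var 28 ∨ M.var 28 + (i + 1) ≤ j) →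
        j ≠ M.var 28 + i ∧ (j < M.var 28 ∨ M.var 28 + i ≤ j) := fun j hj => by omega
    rcases hW with ⟨z26, rfl⟩ | ⟨z26, hW⟩
    · simp only [Prog.eval, Memory.setVar_var, Memory.setVar_arr, Memory.setArr_var,
        Memory.setArr_arr, e26, z26, ne_eq, not_true_eq_false, if_false, Nat.reduceEqDiff, if_true,
        e1, e2, e3, e22, er, val_add_zmod_two, Function.update_apply]
      refine ⟨by omega, by trivial, by omega, by trivial,
        fun A hA3 hA4 => by simp [hA3, hA4, ha], fun x hxk => ?_, fun k hk => ?_,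
        fun h => by simp at h, fun k hk => ?_, fun j hj => ?_⟩
      · obtain ⟨x2, x3, x7, x8, x12, x13, x22⟩ := hxx x hxk
        simp [x2, x3, x7, x8, x12, x13, x22, hx x hxk]
      · by_cases hki : k = i
        · rw [if_pos hki, hki]
        · rw [if_neg hki, h4 k (by omega)]
      · by_cases hki : k = i
        · rw [if_pos (by omega), hki]
        · rw [if_neg (by omega), h3 k (by omega)]
      · obtain ⟨hj1, hj2⟩ := arith j hj
        rw [if_neg hj1, h3' j hj2]
    · have ew : M'.arr 4 i = (W i).val := by rw [h4' z26, hW i hi]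
      simp only [Prog.eval, Memory.setVar_var, Memory.setVar_arr, Memory.setArr_var,
        Memory.setArr_arr, e26, z26, ne_eq, not_false_eq_true, if_false, Nat.reduceEqDiff, if_true,
        e1, e2, e3, e22, er, ew, val_add_zmod_two, Function.update_apply]
      refine ⟨by omega, by trivial, by omega, by trivial,
        fun A hA3 hA4 => by simp [hA3, ha A hA3 hA4], fun x hxk => ?_, fun k hk => ?_,
        fun h => h4' z26, fun k hk => ?_, fun j hj => ?_⟩
      · obtain ⟨x2, x3, x7, x8, x12, x13, x22⟩ := hxx x hxk
        simp [x2, x3, x7, x8, x12, x13, x22, hx x hxk]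
      · rw [h4' z26, hW k (by omega)]
      · by_cases hki : k = i
        · rw [if_pos (by omega), hki]
        · rw [if_neg (by omega), h3 k (by omega)]
      · obtain ⟨hj1, hj2⟩ := arith j hj
        rw [if_neg hj1, h3' j hj2]
  · rintro M' ⟨e2, e3, e22, e26, ha, hx, h4, h4', h3, h3'⟩
    refine Terminates.straight trivial ?_
    simp only [Prog.eval, Memory.setVar_var, Memory.setVar_arr, if_true]
    refine ⟨by trivial, ha, fun x hxk => ?_, h4, h3, h3'⟩
    rw [if_neg hxk.2.2.2.2.2.2.2, hx x hxk]

lemma Terminates.ite {n x : ℕ} {p q : Prog} {b b' : ℕ} {M : Memory} {Q : Memory → Prop}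
    (hp : M.var x ≠ 0 → Terminates n [p] b M Q) (hq : M.var x = 0 → Terminates n [q] b' M Q) :
    Terminates n [.ite x p q] (b + b' + 1) M Q := by
  refine Terminates.of_run (l₁ := [if M.var x ≠ 0 then p else q]) (M₁ := M)
    (fun t K => by rw [run]; rfl) ?_
  by_cases hx : M.var x = 0
  · rw [if_neg (by simpa using hx)]
    exact (hq hx).mono (Nat.le_add_left _ _) fun _ h => h
  · rw [if_pos hx]
    exact (hp hx).mono (Nat.le_add_right _ _) fun _ h => h

/-- Make the row at the position in variable `32` orthogonal to the sample at the position in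
variable `25`. -/
def reduceRow : Prog :=
  (.add 31 25 10 ⨾ .add 28 32 10) ⨾ dotProg 2 3 ⨾ .ite 33 addPivot (.const 2 0) ⨾ .sub 27 27 1

/-- The running time of `reduceRow`. -/
def reduceRowCost (D : ℕ) : ℕ :=
  (Prog.add 31 25 10 ⨾ .add 28 32 10).cost + (dotCost D +
    (addPivotCost D + (Prog.const 2 0).cost + 1 + (Prog.sub 27 27 1).cost + 1) + 1) + 1

/-- The state of the elimination with the sample `s` after `i` rows. -/
structure Reducing {n : ℕ} (M₀ : Memory) (V : ℕ → ℕ → ZMod 2) (s : Bits (n + n)) (i : ℕ)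
    (M : Memory) : Prop where
  count : M.var 27 = n + n + 1 - i
  ptr : M.var 32 = i * (n + n + 1)
  kept : ∀ x, x = 0 ∨ x = 1 ∨ x = 5 ∨ x = 9 ∨ x = 10 ∨ x = 17 ∨ x = 25 → M.var x = M₀.var x
  arr : ∀ A, A ≠ 3 → A ≠ 4 → M.arr A = M₀.arr A
  rows : ∃ W : ℕ → ZMod 2, StoresRows (n + n + 1)
      (fun i' k => if i' < i then V i' k + sampleDot s (V i') * W k else V i' k) M ∧
    ((M.var 26 = 0 ∧ ∀ i' < i, sampleDot s (V i') = 0) ∨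
      (M.var 26 = 1 ∧ (∀ k < n + n + 1, M.arr 4 k = (W k).val) ∧
        ∃ i₀ < i, sampleDot s (V i₀) = 1 ∧ W = V i₀))

/-- Before a pivot is found, all rows seen are orthogonal to s, so the vector W in the invariant has
only zero coefficients and may be arbitrary. -/
lemma terminates_reduceRow {n : ℕ} {M₀ M : Memory} {V : ℕ → ℕ → ZMod 2} {s : Bits (n + n)} {i : ℕ}
    (h1 : M₀.var 1 = 1) (h10 : M₀.var 10 = 0) (h17 : M₀.var 17 = n + n + 1)
    (hs : ∀ k < n + n + 1, M₀.arr 2 (M₀.var 25 + k) = sampleRow s k) (hi : i < n + n + 1)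
    (h : Reducing M₀ V s i M) :
    Terminates n [reduceRow] (reduceRowCost (n + n + 1)) M (Reducing M₀ V s (i + 1)) := by
  obtain ⟨hc, hp, hx, ha, W, hrows, hW⟩ := h
  refine Terminates.straight_comp (by simp [Prog.IsStraight]) ?_
  have e10 : M.var 10 = 0 := by rw [hx 10 (by simp), h10]
  have e25 : M.var 25 = M₀.var 25 := hx 25 (by simp)
  set M₁ := (Prog.add 31 25 10 ⨾ .add 28 32 10).eval M with hM₁
  have hv1 : ∀ x, x ≠ 28 → x ≠ 31 → M₁.var x = M.var x := by
    intro x x28 x31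
    simp [hM₁, Prog.eval, Memory.setVar_var, x28, x31]
  have f31 : M₁.var 31 = M₀.var 25 := by
    simp [hM₁, Prog.eval, Memory.setVar_var, e10, e25]
  have f28 : M₁.var 28 = i * (n + n + 1) := by
    simp [hM₁, Prog.eval, Memory.setVar_var, e10, hp]
  have f32 : M₁.var 32 = i * (n + n + 1) := by rw [hv1 32 (by decide) (by decide), hp]
  have fa : M₁.arr = M.arr := rfl
  have hrow : ∀ k < n + n + 1, M.arr 3 (i * (n + n + 1) + k) = (V i k).val := by
    intro k hk
    rw [hrows i hi k hk]
    beta_reduce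
    rw [if_neg (lt_irrefl i)]
  refine (terminates_dotProg (A := 2) (B := 3) (D := n + n + 1)
    (by rw [hv1 1 (by decide) (by decide), hx 1 (by simp), h1])
    (by rw [hv1 10 (by decide) (by decide), e10])
    (by rw [hv1 17 (by decide) (by decide), hx 17 (by simp), h17])
    (fun k => (sampleRow s k : ZMod 2)) (V i) ?_ ?_).comp ?_
  · intro k hk
    rw [f31, fa, ha 2 (by decide) (by decide), hs k hk, val_natCast_zmod_two (sampleRow_le _ _)]
  · intro k hk
    rw [f32, fa, hrow k hk]
  rintro M₂ ⟨b1, b2, b3, b4, b5⟩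
  have b5 : M₂.var 33 = (sampleDot s (V i)).val := b5
  have g28 : M₂.var 28 = i * (n + n + 1) := by rw [b2 28 (by decide), f28]
  have g32 : M₂.var 32 = (i + 1) * (n + n + 1) := by
    rw [b4, f32, Nat.add_mul, Nat.one_mul]
  have gx : ∀ x, x = 0 ∨ x = 1 ∨ x = 5 ∨ x = 9 ∨ x = 10 ∨ x = 17 ∨ x = 25 →
      M₂.var x = M₀.var x := by
    intro x hxx
    rw [b2 x (by omega), hv1 x (by omega) (by omega), hx x hxx]
  have g26 : M₂.var 26 = M.var 26 := by rw [b2 26 (by decide), hv1 26 (by decide) (by decide)]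
  have g27 : M₂.var 27 = n + n + 1 - i := by
    rw [b2 27 (by decide), hv1 27 (by decide) (by decide), hc]
  have ga : M₂.arr = M.arr := by rw [b1, fa]
  refine Terminates.comp (R := fun M₃ => M₃.var 27 = n + n + 1 - i ∧
    M₃.var 32 = (i + 1) * (n + n + 1) ∧
    (∀ x, x = 0 ∨ x = 1 ∨ x = 5 ∨ x = 9 ∨ x = 10 ∨ x = 17 ∨ x = 25 → M₃.var x = M₀.var x) ∧
    (∀ A, A ≠ 3 → A ≠ 4 → M₃.arr A = M₀.arr A) ∧
    ∃ W : ℕ → ZMod 2, StoresRows (n + n + 1)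
      (fun i' k => if i' < i + 1 then V i' k + sampleDot s (V i') * W k else V i' k) M₃ ∧
    ((M₃.var 26 = 0 ∧ ∀ i' < i + 1, sampleDot s (V i') = 0) ∨
      (M₃.var 26 = 1 ∧ (∀ k < n + n + 1, M₃.arr 4 k = (W k).val) ∧
        ∃ i₀ < i + 1, sampleDot s (V i₀) = 1 ∧ W = V i₀))) (Terminates.ite ?_ ?_) ?_
  · intro h33
    have hdot : sampleDot s (V i) = 1 := by
      rw [b5] at h33
      generalize sampleDot s (V i) = y at h33
      fin_cases y
      · exact absurd rfl h33
      · rfl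
    -- The first row that is not orthogonal to s becomes the pivot. Replacing the arbitrary W by it
    -- changes nothing in the earlier rows.
    obtain ⟨W', hW', hW0, i₀, hi₀, hd₀, hWi⟩ : ∃ W' : ℕ → ZMod 2,
        ((M₂.var 26 = 0 ∧ W' = V i) ∨
          (M₂.var 26 ≠ 0 ∧ ∀ k < n + n + 1, M₂.arr 4 k = (W' k).val)) ∧
        (∀ i' < i, ∀ k, sampleDot s (V i') * W' k = sampleDot s (V i') * W k) ∧
        ∃ i₀ < i + 1, sampleDot s (V i₀) = 1 ∧ W' = V i₀ := by
      rw [g26, ga]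
      rcases hW with ⟨h26, h0⟩ | ⟨h26, h4, i₀, hi₀, hd₀, hWi⟩
      · exact ⟨V i, Or.inl ⟨h26, rfl⟩, fun i' hi' k => by rw [h0 i' hi', zero_mul, zero_mul],
          i, by omega, hdot, rfl⟩
      · exact ⟨W, Or.inr ⟨by omega, h4⟩, fun _ _ _ => rfl, i₀, by omega, hd₀, hWi⟩
    refine (terminates_addPivot (by rw [gx 1 (by simp), h1]) (by rw [gx 10 (by simp), h10])
      (by rw [gx 17 (by simp), h17]) (V i) W' ?_ hW').mono le_rfl ?_
    · intro k hk
      rw [g28, ga, hrow k hk]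
    · rintro M₃ ⟨c26, ca, cx, c4, c3, c3'⟩
      refine ⟨by rw [cx 27 (by simp [IsKept]), g27], by rw [cx 32 (by simp [IsKept]), g32],
        fun x hxx => ?_, fun A hA3 hA4 => by rw [ca A hA3 hA4, ga, ha A hA3 hA4], W', ?_,
        Or.inr ⟨c26, c4, i₀, hi₀, hd₀, hWi⟩⟩
      · rw [cx x (by unfold IsKept; omega), gx x hxx]
      · intro i' hi' k hk
        by_cases hii : i' = i
        · subst hii
          beta_reduce
          rw [if_pos (by omega), hdot, one_mul, ← c3 k hk, g28]
        · have hne : i' * (n + n + 1) + k < M₂.var 28 ∨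
              M₂.var 28 + (n + n + 1) ≤ i' * (n + n + 1) + k := by
            rw [g28]
            rcases lt_or_gt_of_ne hii with hlt | hgt
            · left
              calc _ < (i' + 1) * (n + n + 1) := by rw [Nat.succ_mul]; omega
                _ ≤ _ := Nat.mul_le_mul_right _ hlt
            · right
              calc _ = (i + 1) * (n + n + 1) := by rw [Nat.succ_mul]
                _ ≤ i' * (n + n + 1) := Nat.mul_le_mul_right _ hgt
                _ ≤ _ := Nat.le_add_right _ _
          rw [c3' _ hne, ga, hrows i' hi' k hk]
          beta_reduce
          by_cases hlt : i' < i
          · rw [if_pos hlt, if_pos (by omega), hW0 i' hlt k]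
          · rw [if_neg hlt, if_neg (by omega)]
  · intro h33
    have hdot : sampleDot s (V i) = 0 := by
      rw [b5] at h33
      exact (ZMod.val_eq_zero _).1 h33
    refine Terminates.straight trivial ?_
    simp only [Prog.eval, Memory.setVar_var, Memory.setVar_arr]
    refine ⟨by rw [if_neg (by decide), g27], by rw [if_neg (by decide), g32],
      fun x hxx => by rw [if_neg (by omega), gx x hxx],
      fun A hA3 hA4 => by rw [ga, ha A hA3 hA4], W, ?_, ?_⟩
    · intro i' hi' k hk
      rw [Memory.setVar_arr, ga, hrows i' hi' k hk]
      beta_reduce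
      by_cases hii : i' = i
      · subst hii
        rw [if_neg (lt_irrefl _), if_pos (by omega), hdot, zero_mul, add_zero]
      · by_cases hlt : i' < i
        · rw [if_pos hlt, if_pos (by omega)]
        · rw [if_neg hlt, if_neg (by omega)]
    · rw [if_neg (by decide), g26, ga]
      rcases hW with ⟨h26, h0⟩ | ⟨h26, h4, i₀, hi₀, hd₀, hWi⟩
      · refine Or.inl ⟨h26, fun i' hi' => ?_⟩
        rcases Nat.lt_succ_iff_lt_or_eq.1 hi' with hlt | rfl
        · exact h0 i' hlt
        · exact hdot
      · exact Or.inr ⟨h26, h4, i₀, by omega, hd₀, hWi⟩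
  · rintro M₃ ⟨d27, d32, dx, da, W', hrows', hW'⟩
    refine Terminates.straight trivial ?_
    have d1 : M₃.var 1 = 1 := by rw [dx 1 (by simp), h1]
    have hv : ∀ x, x ≠ 27 → (Prog.eval (.sub 27 27 1) M₃).var x = M₃.var x := by
      intro x hx27
      simp [Prog.eval, Memory.setVar_var, hx27]
    refine ⟨?_, by rw [hv 32 (by decide), d32], fun x hxx => by rw [hv x (by omega), dx x hxx],
      da, W', hrows', by rw [hv 26 (by decide)]; exact hW'⟩
    simp only [Prog.eval, Memory.setVar_var, if_true, d27, d1]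
    omega

/-- Eliminate with all samples. -/
def eliminate : Prog :=
  (.add 5 9 10 ⨾ .const 25 0) ⨾
    .while 5 ((.const 26 0 ⨾ .const 32 0 ⨾ .add 27 17 10) ⨾ .while 27 reduceRow ⨾
      (.add 25 25 17 ⨾ .sub 5 5 1))

/-- The running time of `eliminate` for `m` samples. -/
def eliminateCost (n m : ℕ) : ℕ :=
  (Prog.add 5 9 10 ⨾ .const 25 0).cost +
    (m * ((Prog.const 26 0 ⨾ .const 32 0 ⨾ .add 27 17 10).cost +
      ((n + n + 1) * (reduceRowCost (n + n + 1) + 1) + 1 +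
        (Prog.add 25 25 17 ⨾ .sub 5 5 1).cost + 1) + 1 + 1) + 1) + 1

lemma terminates_eliminate {n m : ℕ} {M : Memory} (h1 : M.var 1 = 1) (h9 : M.var 9 = m)
    (h10 : M.var 10 = 0) (h17 : M.var 17 = n + n + 1)
    (hrows : StoresRows (n + n + 1) (fun i k => if i = k then 1 else 0) M)
    {L : List (Bits (n + n))} (hL : L.length = m)
    (hdata : ∀ i (h : i < L.length), ∀ k < n + n + 1,
      M.arr 2 (i * (n + n + 1) + k) = sampleRow L[i] k) :
    Terminates n [eliminate] (eliminateCost n m) M fun M' =>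
      (∃ V, StoresRows (n + n + 1) V M' ∧ IsNullBasis V L) ∧
        (∀ A, A ≠ 3 → A ≠ 4 → M'.arr A = M.arr A) ∧
        ∀ x, x = 0 ∨ x = 1 ∨ x = 10 ∨ x = 17 → M'.var x = M.var x := by
  refine Terminates.straight_comp (by simp [Prog.IsStraight]) ?_
  refine (Terminates.loop m (fun i M' => M'.var 5 = m - i ∧ M'.var 25 = i * (n + n + 1) ∧
    (∀ x, x = 0 ∨ x = 1 ∨ x = 10 ∨ x = 17 → M'.var x = M.var x) ∧
    (∀ A, A ≠ 3 → A ≠ 4 → M'.arr A = M.arr A) ∧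
    ∃ V, StoresRows (n + n + 1) V M' ∧ IsNullBasis V (L.take i)) ?_ (fun i M' h => h.1)
    ?_).mono le_rfl ?_
  · refine ⟨by simp [Prog.eval, Memory.setVar_var, h9, h10],
      by simp [Prog.eval, Memory.setVar_var], ?_, fun _ _ _ => rfl, _, hrows, isNullBasis_nil n⟩
    rintro x (rfl | rfl | rfl | rfl) <;> simp [Prog.eval, Memory.setVar_var]
  · rintro i M' hi ⟨e5, e25, hx, ha, V, hV, hnull⟩
    have hiL : i < L.length := by omega
    refine Terminates.straight_comp (by simp [Prog.IsStraight]) ?_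
    set M₁ := (Prog.const 26 0 ⨾ .const 32 0 ⨾ .add 27 17 10).eval M' with hM₁
    have hv1 : ∀ x, x ≠ 26 → x ≠ 27 → x ≠ 32 → M₁.var x = M'.var x := by
      intro x x26 x27 x32
      simp [hM₁, Prog.eval, Memory.setVar_var, x26, x27, x32]
    have fa : M₁.arr = M'.arr := rfl
    have f1 : M₁.var 1 = 1 := by
      rw [hv1 1 (by decide) (by decide) (by decide), hx 1 (by simp), h1]
    have f10 : M₁.var 10 = 0 := by
      rw [hv1 10 (by decide) (by decide) (by decide), hx 10 (by simp), h10]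
    have f17 : M₁.var 17 = n + n + 1 := by
      rw [hv1 17 (by decide) (by decide) (by decide), hx 17 (by simp), h17]
    have f25 : M₁.var 25 = i * (n + n + 1) := by
      rw [hv1 25 (by decide) (by decide) (by decide), e25]
    have f5 : M₁.var 5 = m - i := by rw [hv1 5 (by decide) (by decide) (by decide), e5]
    refine (Terminates.loop (n + n + 1) (Reducing M₁ V L[i]) ?_ (fun j M₂ h => h.count)
      fun j M₂ hj hR => terminates_reduceRow f1 f10 f17 ?_ hj hR).comp ?_
    · refine ⟨?_, ?_, fun _ _ => rfl, fun _ _ _ => rfl, 0, ?_, Or.inl ⟨?_, by simp⟩⟩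
      · simp [hM₁, Prog.eval, Memory.setVar_var, hx 17, hx 10, h17, h10]
      · simp [hM₁, Prog.eval, Memory.setVar_var]
      · intro i' hi' k hk
        rw [fa, hV i' hi' k hk]
        beta_reduce
        rw [if_neg (by omega)]
      · simp [hM₁, Prog.eval, Memory.setVar_var]
    · intro k hk
      rw [f25, fa, ha 2 (by decide) (by decide), hdata i hiL k hk]
    · rintro M₂ ⟨_, _, gx, ga, W, gr, gW⟩
      refine Terminates.straight (by simp [Prog.IsStraight]) ?_
      have hv2 : ∀ x, x ≠ 5 → x ≠ 25 →
          (Prog.eval (.add 25 25 17 ⨾ .sub 5 5 1) M₂).var x = M₂.var x := by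
        intro x x5 x25
        simp [Prog.eval, Memory.setVar_var, x5, x25]
      refine ⟨?_, ?_, fun x hxx => ?_, fun A hA3 hA4 => ?_, _, gr, ?_⟩
      · simp only [Prog.eval, Memory.setVar_var, Nat.reduceEqDiff, if_true, if_false]
        rw [gx 5 (by simp), gx 1 (by simp), f5, f1]
        omega
      · simp only [Prog.eval, Memory.setVar_var, Nat.reduceEqDiff, if_true, if_false]
        rw [gx 25 (by simp), gx 17 (by simp), f25, f17, Nat.add_mul, Nat.one_mul]
      · rw [hv2 x (by omega) (by omega), gx x (by omega), hv1 x (by omega) (by omega) (by omega),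
          hx x hxx]
      · exact (ga A hA3 hA4).trans (ha A hA3 hA4)
      · rw [List.take_succ_eq_append_getElem hiL]
        refine hnull.step L[i] W (fun i' hi' k hk => by rw [if_pos hi']) ?_
        rcases gW with ⟨_, h0⟩ | ⟨_, _, i₀, hi₀, hd, rfl⟩
        · exact Or.inl h0
        · exact Or.inr ⟨i₀, hi₀, hd, rfl⟩
  · rintro M' ⟨_, _, hx, ha, V, hV, hnull⟩
    rw [← hL, List.take_length] at hnull
    exact ⟨⟨V, hV, hnull⟩, ha, hx⟩

/-- Write the supremum of the rows of array `3` into array `5`. -/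
def supRows : Prog :=
  (.add 27 17 10 ⨾ .const 32 0) ⨾
    .while 27 ((.add 2 17 10 ⨾ .const 3 0) ⨾
      .while 2 (.load 7 3 32 ⨾ .load 8 5 3 ⨾ .sub 8 8 7 ⨾ .add 8 8 7 ⨾ .store 5 3 8 ⨾
        .add 32 32 1 ⨾ .add 3 3 1 ⨾ .sub 2 2 1) ⨾
      .sub 27 27 1)

/-- The running time of `supRows`. -/
def supRowsCost (D : ℕ) : ℕ :=
  (Prog.add 27 17 10 ⨾ .const 32 0).cost +
    (D * ((Prog.add 2 17 10 ⨾ .const 3 0).cost +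
      (D * ((Prog.load 7 3 32 ⨾ .load 8 5 3 ⨾ .sub 8 8 7 ⨾ .add 8 8 7 ⨾ .store 5 3 8 ⨾
        .add 32 32 1 ⨾ .add 3 3 1 ⨾ .sub 2 2 1).cost + 1) + 1 + (Prog.sub 27 27 1).cost + 1) +
          1 + 1) + 1) + 1

lemma terminates_supRows {n D : ℕ} {M : Memory} (h1 : M.var 1 = 1) (h10 : M.var 10 = 0)
    (h17 : M.var 17 = D) {V : ℕ → ℕ → ZMod 2} (hV : StoresRows D V M)
    (h5 : M.arr 5 = fun _ => 0) :
    Terminates n [supRows] (supRowsCost D) M fun M' =>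
      (∀ k < D, M'.arr 5 k = (Finset.range D).sup fun i => (V i k).val) ∧
        ∀ x, x = 0 ∨ x = 1 ∨ x = 10 → M'.var x = M.var x := by
  refine Terminates.straight_comp (by simp [Prog.IsStraight]) ?_
  refine (Terminates.loop D (fun i M' => M'.var 27 = D - i ∧ M'.var 32 = i * D ∧
    (∀ x, x = 0 ∨ x = 1 ∨ x = 10 ∨ x = 17 → M'.var x = M.var x) ∧ M'.arr 3 = M.arr 3 ∧
    ∀ k < D, M'.arr 5 k = (Finset.range i).sup fun i => (V i k).val) ?_ (fun i M' h => h.1)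
    ?_).mono le_rfl ?_
  · refine ⟨by simp [Prog.eval, Memory.setVar_var, h17, h10],
      by simp [Prog.eval, Memory.setVar_var], ?_, rfl, fun k _ => ?_⟩
    · rintro x (rfl | rfl | rfl | rfl) <;> simp [Prog.eval, Memory.setVar_var]
    · simp [Prog.eval, Memory.setVar_arr, h5]
  · rintro i M' hi ⟨e27, e32, hx, ha, hd⟩
    refine Terminates.straight_comp (by simp [Prog.IsStraight]) ?_
    refine (Terminates.loop_straight D (fun j M₁ => M₁.var 2 = D - j ∧ M₁.var 3 = j ∧
      M₁.var 32 = i * D + j ∧ M₁.var 27 = D - i ∧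
      (∀ x, x = 0 ∨ x = 1 ∨ x = 10 ∨ x = 17 → M₁.var x = M.var x) ∧ M₁.arr 3 = M.arr 3 ∧
      (∀ k < j, M₁.arr 5 k = (Finset.range (i + 1)).sup fun i => (V i k).val) ∧
      ∀ k < D, j ≤ k → M₁.arr 5 k = (Finset.range i).sup fun i => (V i k).val)
      (by simp [Prog.IsStraight]) ?_ (fun j M₁ h => h.1) ?_).comp ?_
    · refine ⟨by simp [Prog.eval, Memory.setVar_var, hx, h17, h10],
        by simp [Prog.eval, Memory.setVar_var], by simp [Prog.eval, Memory.setVar_var, e32],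
        by simp [Prog.eval, Memory.setVar_var, e27], ?_, ha, by simp, fun k hk _ => hd k hk⟩
      rintro x (rfl | rfl | rfl | rfl) <;> simp [Prog.eval, Memory.setVar_var, hx]
    · rintro j M₁ hj ⟨f2, f3, f32, f27, fx, fa, fl, fr⟩
      have f1 : M₁.var 1 = 1 := by rw [fx 1 (by simp), h1]
      have fV : M₁.arr 3 (i * D + j) = (V i j).val := by rw [fa, hV i hi j hj]
      simp only [Prog.eval, Memory.setVar_var, Memory.setVar_arr, Memory.setArr_var,
        Memory.setArr_arr]
      simp only [Nat.reduceEqDiff, if_true, if_false, f1, f2, f3, f27, f32, fV, fr j hj le_rfl,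
        Function.update_apply]
      refine ⟨by omega, by trivial, by omega, by trivial, ?_, fa, fun k hk => ?_,
        fun k hk hjk => ?_⟩
      · rintro x (rfl | rfl | rfl | rfl) <;> simp [fx]
      · by_cases hkj : k = j
        · rw [if_pos hkj, hkj, Finset.range_add_one, Finset.sup_insert]
          have hmax : ∀ a b : ℕ, b - a + a = a ⊔ b := fun a b => by
            rw [Nat.sub_add_eq_max, max_comm]
          exact hmax _ _
        · rw [if_neg hkj, fl k (by omega)]
      · rw [if_neg (by omega), fr k hk (by omega)]
    · rintro M₁ ⟨_, _, f32, f27, fx, fa, fl, _⟩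
      refine Terminates.straight trivial ?_
      have f1 : M₁.var 1 = 1 := by rw [fx 1 (by simp), h1]
      refine ⟨?_, ?_, ?_, fa, fl⟩
      · simp only [Prog.eval, Memory.setVar_var, if_true, f27, f1]
        omega
      · simp [Prog.eval, Memory.setVar_var, f32, Nat.add_mul]
      · rintro x (rfl | rfl | rfl | rfl) <;> simp [Prog.eval, Memory.setVar_var, fx]
  · rintro M' ⟨_, _, hx, _, hd⟩
    exact ⟨hd, fun x hxx => hx x (by omega)⟩

/-- Translate the binary vector in array `5` into a Pauli string in array `0`, and store in variable
`0` whether it differs from the identity. -/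
def writeOutput : Prog :=
  (.add 2 0 10 ⨾ .const 3 0 ⨾ .add 4 0 10 ⨾ .const 18 0) ⨾
    .while 2 (.load 7 5 3 ⨾ .load 8 5 4 ⨾ .sub 12 7 8 ⨾ .sub 13 8 7 ⨾ .add 12 12 13 ⨾
      .add 12 12 8 ⨾ .add 12 12 8 ⨾ .store 0 3 12 ⨾ .add 18 18 12 ⨾ .sub 18 1 18 ⨾ .sub 18 1 18 ⨾
      .add 3 3 1 ⨾ .add 4 4 1 ⨾ .sub 2 2 1) ⨾
    .add 0 18 10

/-- The running time of `writeOutput`. -/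
def writeOutputCost (n : ℕ) : ℕ :=
  (Prog.add 2 0 10 ⨾ .const 3 0 ⨾ .add 4 0 10 ⨾ .const 18 0).cost +
    (n * ((Prog.load 7 5 3 ⨾ .load 8 5 4 ⨾ .sub 12 7 8 ⨾ .sub 13 8 7 ⨾ .add 12 12 13 ⨾
      .add 12 12 8 ⨾ .add 12 12 8 ⨾ .store 0 3 12 ⨾ .add 18 18 12 ⨾ .sub 18 1 18 ⨾ .sub 18 1 18 ⨾
      .add 3 3 1 ⨾ .add 4 4 1 ⨾ .sub 2 2 1).cost + 1) + 1 + (Prog.add 0 18 10).cost + 1) + 1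

/-- The number of the Pauli matrix with given bits. -/
def pauliCode (x z : ℕ) : ℕ := x - z + (z - x) + z + z

lemma terminates_writeOutput {n : ℕ} {M : Memory} (h0 : M.var 0 = n) (h1 : M.var 1 = 1)
    (h10 : M.var 10 = 0) :
    Terminates n [writeOutput] (writeOutputCost n) M fun M' =>
      (∀ j < n, M'.arr 0 j = pauliCode (M.arr 5 j) (M.arr 5 (n + j))) ∧
        M'.var 0 = if ∃ j < n, pauliCode (M.arr 5 j) (M.arr 5 (n + j)) ≠ 0 then 1 else 0 := by
  classical
  refine Terminates.straight_comp (by simp [Prog.IsStraight]) ?_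
  refine Terminates.comp (Terminates.loop_straight n (fun i M' => M'.var 2 = n - i ∧
    M'.var 3 = i ∧ M'.var 4 = n + i ∧ M'.var 1 = 1 ∧ M'.var 10 = 0 ∧ M'.arr 5 = M.arr 5 ∧
    (∀ j < i, M'.arr 0 j = pauliCode (M.arr 5 j) (M.arr 5 (n + j))) ∧
    M'.var 18 = if ∃ j < i, pauliCode (M.arr 5 j) (M.arr 5 (n + j)) ≠ 0 then 1 else 0)
    (by simp [Prog.IsStraight]) ?_ (fun i M' h => h.1) ?_) ?_
  · simp [Prog.eval, Memory.setVar_var, Memory.setVar_arr, h0, h1, h10]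
  · rintro i M' hi ⟨e2, e3, e4, e1, e10, ha, hd, e18⟩
    simp only [Prog.eval, Memory.setVar_var, Memory.setVar_arr, Memory.setArr_var,
      Memory.setArr_arr]
    simp only [Nat.reduceEqDiff, if_true, if_false, e1, e2, e3, e4, e10, e18, ha,
      OfNat.ofNat_ne_zero, Function.update_apply]
    refine ⟨by omega, by trivial, by omega, by trivial, by trivial, by trivial, fun j hj => ?_, ?_⟩
    · by_cases hji : j = i
      · rw [if_pos hji, hji, pauliCode]
      · rw [if_neg hji, hd j (by omega)]
    -- Truncated subtraction reduces the accumulated sum to a bit that records whether any factor so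
    -- far is nontrivial.
    · change 1 - (1 - (_ + pauliCode (M.arr 5 i) (M.arr 5 (n + i)))) = _
      by_cases hold : ∃ j < i, pauliCode (M.arr 5 j) (M.arr 5 (n + j)) ≠ 0
      · obtain ⟨j, hj, hne⟩ := hold
        rw [if_pos ⟨j, hj, hne⟩, if_pos ⟨j, by omega, hne⟩]
        omega
      · rw [if_neg hold]
        by_cases hnew : pauliCode (M.arr 5 i) (M.arr 5 (n + i)) = 0
        · rw [hnew, if_neg]
          rintro ⟨j, hj, hne⟩
          rcases Nat.lt_succ_iff_lt_or_eq.1 hj with hlt | rfl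
          · exact hold ⟨j, hlt, hne⟩
          · exact hne hnew
        · rw [if_pos ⟨i, by omega, hnew⟩]
          omega
  · rintro M' ⟨_, _, _, _, e10, _, hd, e18⟩
    refine Terminates.straight trivial ⟨hd, ?_⟩
    simp only [Prog.eval, Memory.setVar_var, if_true, e10, e18, Nat.add_zero]

/-- Find the Pauli operator from the collected samples. -/
def findPauli : Prog := initRows ⨾ eliminate ⨾ supRows ⨾ writeOutput

/-- The running time of `findPauli` for `m` samples. -/
def findPauliCost (n m : ℕ) : ℕ :=
  initRowsCost n + (eliminateCost n m + (supRowsCost (n + n + 1) + writeOutputCost n + 1) + 1) + 1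

/-- The guarantee is conditional on good samples: if they single out R together with the identity,
then R is the output. The case R = 0 stands for s = 0. -/
lemma terminates_findPauli {n m : ℕ} {L : List (Bits (n + n))} (hL : L.length = m)
    {M : Memory} (hM : Collected n m L M) :
    Terminates n [findPauli] (findPauliCost n m) M fun M' =>
      ∀ R : PauliString n, (∀ x ∈ L, bellSign R x = 1) →
        (∀ (Q : PauliString n) (e : ℕ), (∀ x ∈ L, bellSign Q x = (-1) ^ e) →
          Even e ∧ (Q = 0 ∨ Q = R)) →
        M'.var 0 = (if R = 0 then 0 else 1) ∧ ∀ j : Fin n, M'.arr 0 j = (R j : ℕ) := by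
  refine (terminates_initRows hM.var0 hM.var1 hM.var10
    (hM.fresh 3 (by decide) (by decide))).comp ?_
  rintro M₁ ⟨r1, v17, a1, x1⟩
  refine (terminates_eliminate ((x1 1 (by simp)).trans hM.var1) ((x1 9 (by simp)).trans hM.var9)
    ((x1 10 (by simp)).trans hM.var10) v17 r1 hL ?_).comp ?_
  · intro i hi k hk
    rw [a1 2 (by decide)]
    exact hM.data i hi k hk
  rintro M₂ ⟨⟨V, r2, hnull⟩, a2, x2⟩
  have y0 : M₂.var 0 = n := by rw [x2 0 (by simp), x1 0 (by simp), hM.var0]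
  have y1 : M₂.var 1 = 1 := by rw [x2 1 (by simp), x1 1 (by simp), hM.var1]
  have y10 : M₂.var 10 = 0 := by rw [x2 10 (by simp), x1 10 (by simp), hM.var10]
  refine (terminates_supRows y1 y10 (by rw [x2 17 (by simp), v17]) r2
    (by rw [a2 5 (by decide) (by decide), a1 5 (by decide),
      hM.fresh 5 (by decide) (by decide)])).comp ?_
  rintro M₃ ⟨d3, x3⟩
  refine (terminates_writeOutput ((x3 0 (by simp)).trans y0) ((x3 1 (by simp)).trans y1)
    ((x3 10 (by simp)).trans y10)).mono le_rfl ?_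
  rintro M₄ ⟨d4, v4⟩ R hR hdet
  have hcode : ∀ j (hj : j < n), pauliCode (M₃.arr 5 j) (M₃.arr 5 (n + j)) = (R ⟨j, hj⟩ : ℕ) := by
    intro j hj
    have hdec : ∀ k : Fin 4, pauliCode (xBit k) (zBit k) = (k : ℕ) := by decide
    rw [d3 j (by omega), d3 (n + j) (by omega), hnull.sup_eq R hR hdet (by omega),
      hnull.sup_eq R hR hdet (by omega), pauliVec_left R hj, pauliVec_right R hj,
      val_natCast_zmod_two (xBit_le _), val_natCast_zmod_two (zBit_le _), hdec, pauliAt, dif_pos hj]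
  refine ⟨?_, fun j => by rw [d4 j j.2, hcode j j.2]⟩
  rw [v4]
  by_cases hR0 : R = 0
  · rw [if_pos hR0, if_neg]
    rintro ⟨j, hj, hne⟩
    rw [hcode j hj, hR0] at hne
    exact hne rfl
  · rw [if_neg hR0, if_pos]
    obtain ⟨j, hj⟩ := Function.ne_iff.1 hR0
    refine ⟨j, j.2, ?_⟩
    rw [hcode j j.2]
    exact fun h => hj (Fin.ext h)

end NISQ
end

/-! ### Polynomial bounds and the two learning algorithms -/

noncomputable section
namespace NISQ

/-! ### Polynomial running time -/

section polynomial

variable {f g : ℕ → ℕ}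

lemma polyBounded_dotCost (hf : PolyBounded f) : PolyBounded fun n => dotCost (f n) :=
  ((PolyBounded.const _).add ((hf.mul (.const _)).add (.const _))).add (.const _)

lemma polyBounded_estimateCost (k : ℕ) (hg : PolyBounded g) :
    PolyBounded fun n => estimateCost k n (g n) := by
  have h1 : PolyBounded writePauliVecCost :=
    ((PolyBounded.const _).add ((((PolyBounded.id.mul (.const _)).add (.const _)).add
      (.const _)).add (.const _))).add (.const _)
  have h2 : PolyBounded fun n => countSignsCost n (g n) :=
    ((PolyBounded.const _).add ((hg.mul (((((PolyBounded.const _).add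
      (((polyBounded_dotCost ((PolyBounded.id.add .id).add (.const _))).add (.const _)).add
        (.const _))).add (.const _))).add (.const _))).add (.const _))).add (.const _)
  exact (h1.add ((h2.add (.const _)).add (.const _))).add (.const _)

lemma polyBounded_findPauliCost (hg : PolyBounded g) :
    PolyBounded fun n => findPauliCost n (g n) := by
  have hD : PolyBounded fun n => n + n + 1 := (PolyBounded.id.add .id).add (.const _)
  have h1 : PolyBounded initRowsCost :=
    ((PolyBounded.const _).add ((hD.mul (.const _)).add (.const _))).add (.const _)
  have h2 : PolyBounded fun n => addPivotCost (n + n + 1) :=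
    ((PolyBounded.const _).add ((((hD.mul (.const _)).add (.const _)).add (.const _)).add
      (.const _))).add (.const _)
  have h3 : PolyBounded fun n => reduceRowCost (n + n + 1) :=
    ((PolyBounded.const _).add (((polyBounded_dotCost hD).add (((((h2.add (.const _)).add
      (.const _)).add (.const _)).add (.const _)))).add (.const _))).add (.const _)
  have h4 : PolyBounded fun n => eliminateCost n (g n) :=
    ((PolyBounded.const _).add ((hg.mul ((((PolyBounded.const _).add ((((hD.mul
      (h3.add (.const _))).add (.const _)).add (.const _)).add (.const _))).add (.const _)).add
        (.const _))).add (.const _))).add (.const _)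
  have h5 : PolyBounded fun n => supRowsCost (n + n + 1) :=
    ((PolyBounded.const _).add ((hD.mul ((((PolyBounded.const _).add ((((hD.mul (.const _)).add
      (.const _)).add (.const _)).add (.const _))).add (.const _)).add (.const _))).add
        (.const _))).add (.const _)
  have h6 : PolyBounded writeOutputCost :=
    ((PolyBounded.const _).add ((((PolyBounded.id.mul (.const _)).add (.const _)).add
      (.const _)).add (.const _))).add (.const _)
  exact (h1.add ((h4.add ((h5.add h6).add (.const _))).add (.const _))).add (.const _)

end polynomial

/-! ### Learning by Bell sampling -/

/-- A program that only runs the Bell circuit, and `C * n` times at that, is a `BPP^(QNC^0)`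
algorithm. -/
lemma isBPPQNC0_of_samples {A : Prog} {p : Polynomial ℕ} {C : ℕ}
    {b : ℕ → ℕ} {S : ∀ n, List (Bits (n + n)) → Memory → Prop}
    (h : ∀ n, Samples n (bellCircuit n) (C * n) [A] (b n) (Memory.init n) (S n))
    (hp : ∀ n, b n ≤ p.eval n) : A.IsBPPQNC0 p 5 fun n => 2 * C * n := by
  intro n _
  obtain ⟨k, hk, -⟩ := (h n).exists_run_eq (hp n)
  rw [Prog.exec, hk]
  refine ⟨sampleTree_always _ _ _ _ fun L _ => rfl,
    sampleTree_depthAtMost _ (bellCircuit_length n).le _ _ fun L _ => trivial, ?_⟩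
  have := sampleTree_queriesAtMost (bellCircuit n) (C * n)
    (fun L => HybridAlg.output (n := n) (some (k L))) fun L _ => trivial
  rw [bellCircuit_calls] at this
  rwa [show C * n * 2 = 2 * C * n by ring] at this

lemma prob_output_nonneg {n : ℕ} {β : Type} (lam : ℝ) (ρ : Op n) (E : Set β) (b : β) :
    0 ≤ (HybridAlg.output (n := n) b).prob lam ρ E := by
  rw [HybridAlg.prob]
  split <;> norm_num

lemma one_le_prob_output {n : ℕ} {β : Type} (lam : ℝ) (ρ : Op n) {E : Set β} {b : β} (h : b ∈ E) :
    1 ≤ (HybridAlg.output (n := n) b).prob lam ρ E := (if_pos h).ge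

/-- A wrong sign pattern survives a sample with probability at most 1/2, so C n samples with the
constant of `exists_pow_bound` at q = 1/2 suffice. -/
theorem exists_pauli_identification {δ : ℝ} (hδ : 0 < δ) :
    ∃ (A : Prog) (p : Polynomial ℕ) (d C : ℕ),
      A.IsBPPQNC0 p d (fun n => C * n) ∧
      ∀ (n : ℕ), 1 ≤ n → ∀ (s : Fin 2) (P : PauliString n), P ≠ 0 →
        1 - δ ^ n ≤ (A.exec n (p.eval n)).prob 0 (pauliState s P)
          {o | ∃ M : Memory, o = some M ∧ M.var 0 = (s : ℕ) ∧
            (s = 1 → ∀ j : Fin n, M.arr 0 j = (P j : ℕ))} := by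
  obtain ⟨C, -, hC⟩ := exists_pow_bound (q := 1 / 2) (by norm_num) (by norm_num) hδ
  have hA : ∀ n, Samples n (bellCircuit n) (C * n) [collect C ⨾ findPauli]
      (collectCost C n + findPauliCost n (C * n) + 1) (Memory.init n) fun L M =>
        ∀ R : PauliString n, (∀ x ∈ L, bellSign R x = 1) →
          (∀ (Q : PauliString n) (e : ℕ), (∀ x ∈ L, bellSign Q x = (-1) ^ e) →
            Even e ∧ (Q = 0 ∨ Q = R)) →
          M.var 0 = (if R = 0 then 0 else 1) ∧ ∀ j : Fin n, M.arr 0 j = (R j : ℕ) :=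
    fun n => (samples_collect C n).comp fun L M hL hM => terminates_findPauli hL hM
  obtain ⟨p, hp⟩ := ((polyBounded_collectCost C).add
    (polyBounded_findPauliCost ((PolyBounded.const C).mul .id))).add (.const 1)
  refine ⟨collect C ⨾ findPauli, p, 5, 2 * C, isBPPQNC0_of_samples hA hp, fun n hn s P hP => ?_⟩
  obtain ⟨k, hk, hS⟩ := (hA n).exists_run_eq (hp n)
  rw [Prog.exec, hk, sampleTree_prob]
  refine (sub_le_sub_left (hC n hn) 1).trans
    (le_expect_of_determined s hP _ (fun L => prob_output_nonneg _ _ _ _) fun L hL h1 h2 => ?_)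
  refine one_le_prob_output _ _ ⟨k L, rfl, ?_⟩
  have key := hS L hL (if s = 1 then P else 0) ?_ fun Q e hQ => ?_
  · obtain rfl | rfl : s = 0 ∨ s = 1 := by fin_cases s <;> simp
    · simpa using key.1
    · simpa [hP] using key
  · intro x hx
    split
    · next hs => exact h1 hs x hx
    · exact Finset.prod_eq_one fun j _ => by simp [bellFactor, xBit, zBit]
  · refine ⟨(h2 Q e hQ).1, ?_⟩
    rcases (h2 Q e hQ).2 with h | ⟨hs, h⟩
    · exact .inl h
    · exact .inr (by rw [if_pos hs, h])

/-- Half of the error budget goes to the statistical error e of the roots, which requires accuracy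
e² for the squares; the other half goes to the grid width 1/(k + 1). -/
theorem exists_pauli_estimation {ε δ : ℝ} (hε : 0 < ε) (hδ : 0 < δ) :
    ∃ (A B : Prog) (p : Polynomial ℕ) (d C : ℕ),
      A.IsBPPQNC0 p d (fun n => C * n) ∧
      ∀ (n : ℕ), 1 ≤ n →
        (A.exec n (p.eval n)).Always (fun o => ∀ M, o = some M → ∀ P : PauliString n,
          ∃ M', run n (p.eval n) [B] (M.withPauli P) = .output (some M')) ∧
        ∀ (ρ : Op n), IsState ρ →
          1 - δ ^ n ≤ (A.exec n (p.eval n)).prob 0 ρ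
            {o | ∃ M, o = some M ∧ ∀ P : PauliString n,
              ∃ M', run n (p.eval n) [B] (M.withPauli P) = .output (some M') ∧
                |(M'.var 0 : ℝ) / (M'.var 1 : ℝ) - ‖(P.op * ρ).trace‖| ≤ ε} := by
  -- The cap at 1 is needed because the concentration bound assumes an error of at most 1.
  obtain ⟨e, he0, he1, heε⟩ : ∃ e : ℝ, 0 < e ∧ e ≤ 1 ∧ e ≤ ε / 2 :=
    ⟨min 1 (ε / 2), by positivity, min_le_left _ _, min_le_right _ _⟩
  obtain ⟨k, hk⟩ := exists_nat_one_div_lt (half_pos hε)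
  have he2 : 0 < e ^ 2 := by positivity
  obtain ⟨C, hC1, hC⟩ := exists_pow_bound (q := Real.exp (-((e ^ 2) ^ 2 / 16)))
    (Real.exp_pos _).le (Real.exp_lt_one_iff.2 (by linarith [pow_pos he2 2])) hδ
  obtain ⟨p₁, hp₁⟩ := polyBounded_collectCost C
  obtain ⟨p₂, hp₂⟩ := polyBounded_estimateCost (k + 1) ((PolyBounded.const C).mul .id)
  have hp : ∀ n, collectCost C n ≤ (p₁ + p₂).eval n := fun n => by
    rw [Polynomial.eval_add]; exact (hp₁ n).trans (Nat.le_add_right _ _)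
  have hp' : ∀ n, estimateCost (k + 1) n (C * n) ≤ (p₁ + p₂).eval n := fun n => by
    rw [Polynomial.eval_add]; exact (hp₂ n).trans (Nat.le_add_left _ _)
  refine ⟨collect C, estimate (k + 1), p₁ + p₂, 5, 2 * C,
    isBPPQNC0_of_samples (samples_collect C) hp, fun n hn => ?_⟩
  obtain ⟨K, hK, hS⟩ := (samples_collect C n).exists_run_eq (hp n)
  have hB := fun (L : List (Bits (n + n))) (hL : L.length = C * n) (P : PauliString n) =>
    (terminates_estimate (k + 1) hL (hS L hL) P).exists_run_eq (hp' n)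
  rw [Prog.exec, hK]
  refine ⟨sampleTree_always _ _ _ _ fun L hL M hM P => ?_, fun ρ hρ => ?_⟩
  · obtain rfl : K L = M := by simpa using hM
    obtain ⟨M', h, -⟩ := hB L hL P
    exact ⟨M', h⟩
  · rw [sampleTree_prob]
    refine (sub_le_sub_left (hC n hn) 1).trans
      (le_expect_of_accurate hρ he2 (pow_le_one₀ he0.le he1) _
        (fun L => prob_output_nonneg _ _ _ _) fun L hL hacc => ?_)
    refine one_le_prob_output _ _ ⟨K L, rfl, fun P => ?_⟩
    obtain ⟨M', h, hv1, V, hV, hv0⟩ := hB L hL P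
    refine ⟨M', h, ?_⟩
    rw [hv1, hv0]
    refine (gridCount_accurate (norm_nonneg _) (norm_trace_pauli_mul_le_one hρ P) he0
      (Nat.mul_pos hC1 hn) k.succ_pos hV (hacc P)).trans ?_
    push_cast
    linarith

end NISQ
end

open NISQ in
theorem theorem5 :
    -- No `NISQ_lam` algorithm with `o((1 - lam) ^ (-n))` queries ...
    (∀ η : ℝ, 0 < η → ∃ c : ℝ, 0 < c ∧
      ∀ (lam : ℝ), 0 ≤ lam → lam ≤ 1 → ∀ (n : ℕ), 1 ≤ n → ∀ (N : ℕ),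
        -- ... determines `s` with advantage `η`, whichever full-weight `P` is used,
        (∀ (P : PauliString n), P.FullWeight →
          ∀ (A : HybridAlg n (Fin 2)), A.QueriesAtMost N →
            1 / 2 + η ≤ (A.prob lam (pauliState 0 P) {0} + A.prob lam (pauliState 1 P) {1}) / 2 →
            c ≤ N * (1 - lam) ^ n) ∧
        -- ... or determines a random full-weight `P` with advantage `η` over guessing,
        (∀ (A : HybridAlg n (PauliString n)), A.QueriesAtMost N →
            1 / 3 ^ n + η ≤
              (∑ P : PauliString n with P.FullWeight, A.prob lam (pauliState 1 P) {P}) / 3 ^ n →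
            c ≤ N * (1 - lam) ^ n) ∧
        -- ... or learns all `|Tr (P ρ)|` up to a constant error.
        (∀ (ε : ℝ), ε < 1 / 2 →
          ∀ (A : HybridAlg n (PauliString n → ℝ)), A.QueriesAtMost N →
            (∀ ρ : Op n, IsState ρ →
              1 / 2 + η ≤ A.prob lam ρ {f | ∀ P, |f P - ‖(P.op * ρ).trace‖| ≤ ε}) →
            c ≤ N * (1 - lam) ^ n)) ∧
    -- Noiseless constant-depth circuits and `O(n)` queries suffice to determine `s` and `P`.
    (∀ δ : ℝ, 0 < δ → ∃ (A : Prog) (p : Polynomial ℕ) (d C : ℕ),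
      A.IsBPPQNC0 p d (fun n => C * n) ∧
      ∀ (n : ℕ), 1 ≤ n → ∀ (s : Fin 2) (P : PauliString n), P ≠ 0 →
        1 - δ ^ n ≤ (A.exec n (p.eval n)).prob 0 (pauliState s P)
          {o | ∃ M : Memory, o = some M ∧ M.var 0 = (s : ℕ) ∧ (s = 1 → ∀ j : Fin n, M.arr 0 j = (P j : ℕ))}) ∧
    -- They also suffice to estimate `|Tr (P ρ)|` for all `P` at once and for any state `ρ`: the
    -- program `B` computes the estimate for `P` from `P` and the memory that `A` has left.
    (∀ ε δ : ℝ, 0 < ε → 0 < δ → ∃ (A B : Prog) (p : Polynomial ℕ) (d C : ℕ),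
      A.IsBPPQNC0 p d (fun n => C * n) ∧
      ∀ (n : ℕ), 1 ≤ n →
        (A.exec n (p.eval n)).Always (fun o => ∀ M, o = some M → ∀ P : PauliString n,
          ∃ M', run n (p.eval n) [B] (M.withPauli P) = .output (some M')) ∧
        ∀ (ρ : Op n), IsState ρ →
          1 - δ ^ n ≤ (A.exec n (p.eval n)).prob 0 ρ
            {o | ∃ M, o = some M ∧ ∀ P : PauliString n,
              ∃ M', run n (p.eval n) [B] (M.withPauli P) = .output (some M') ∧
                |(M'.var 0 : ℝ) / (M'.var 1 : ℝ) - ‖(P.op * ρ).trace‖| ≤ ε}) := by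
  -- The constant c is η itself, because every query changes the probability of an event by at most
  -- (1 - λ)^n.
  exact ⟨fun η hη => ⟨η, hη, fun lam h0 h1 n hn N => noisy_lower_bound η hη lam h0 h1 n hn N⟩,
    fun _ hδ => exists_pauli_identification hδ,
    fun _ _ hε hδ => exists_pauli_estimation hε hδ⟩
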